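/- Let $M$ be a (real, Hausdorff, second countable) smooth manifold with a Poisson bivector field $\Pi$, locally $\pi^{ij}$, so that $\{f,g\}=\Pi(df,dg)$; let $\#:T^*M\to TM$ be given by $\langle\beta,\#\alpha\rangle=\Pi(\alpha,\beta)$, and let $[\alpha,\beta]=\mathcal L_{\#\alpha}\beta-\mathcal L_{\#\beta}\alpha-d\Pi(\alpha,\beta)$ be the Lie bracket on $\Omega^1(M)$. Let $\nabla^\bullet$ and ${}^\dagger\nabla^\bullet$ be contravariant connections on $T^*M$ (that is, bilinear maps $(\alpha,\beta)\mapsto\nabla^\alpha\beta$ on $\Omega^1(M)$ with $\nabla^{f\alpha}\beta=f\nabla^\alpha\beta$ and $\nabla^\alpha(f\beta)=f\nabla^\alpha\beta+(\#\alpha)(f)\beta$; the dual connections on $TM$ are denoted in the same way) which are associated, i.e. ${}^\dagger\nabla^\alpha\#\beta-\nabla^\beta\#\alpha-\#[\alpha,\beta]=0$ for all $\alpha,\beta\in\Omega^1(M)$, and such that ${}^\dagger\nabla^\bullet$ is torsion-free, i.e. ${}^\dagger\nabla^\alpha\beta-{}^\dagger\nabla^\beta\alpha=[\alpha,\beta]$.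 Let $Z$ be the zero section of $p:T^*M\to M$, and let $C^\infty(T^*M,Z)$ be the algebra of formal functions on the formal neighbourhood of $Z$: locally, formal power series in the fibre coordinates $\xi_i$ with coefficients smooth in $x$. Let $\bar\nabla^\alpha$ be the derivations of this algebra given locally by $\bar\nabla^{dx^i}=\pi^{ij}\frac{\partial}{\partial x^j}+\Gamma^{ij}_k\xi_j\frac{\partial}{\partial\xi_k}$, where $\nabla^{dx^i}dx^j=-\Gamma^{ij}_kdx^k$ and $\bar\nabla^\alpha$ is $C^\infty(M)$-linear in $\alpha$; let $R^{\bar\nabla}(\alpha,\beta)=[\bar\nabla^\alpha,\bar\nabla^\beta]-\bar\nabla^{[\alpha,\beta]}$ be its curvature, $\Omega=\frac12\pi^{ij}d\xi_i\wedge d\xi_j$, $\mathcal E=\xi_k\frac{\partial}{\partial\xi_k}$ and $\bar Q(\alpha,\beta)=\frac12\Omega(\mathcal E,R^{\bar\nabla}(\alpha,\beta))$. Let $\mathcal H_\Omega$ be the algebra of those $F\in C^\infty(T^*M,Z)$ for which there is a formal vertical vector field $H_F$ on $(T^*M,Z)$ with $\iota(H_F)\Omega=-d_\xi F$, where $d_\xi$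 is the fibrewise differential, with the bracket $\{F,G\}_\Omega=H_FG$, which does not depend on the choice of $H_F$. Let $U$ be a global formal vertical 1-form on $(T^*M,Z)$, and write $U(\alpha)$ for its value on the vertical vector field $\alpha_i\frac{\partial}{\partial\xi_i}$. Suppose that on a covering of $M$ by coordinate charts there exist formal functions $u_k(x,\xi)$, $v^i_k(x,\xi)$ with $$\pi^{is}v^j_s=\pi^{js}\frac{\partial u_s}{\partial\xi_i},\qquad U(dx^i)=\pi^{ik}u_k,\qquad u_k=-\xi_k\ (\mathrm{mod}\ \xi^2),\qquad v^i_k=\delta^i_k\ (\mathrm{mod}\ \xi),$$ and that $U$ satisfies, for all $\alpha,\beta\in\Omega^1(M)$, the Fundamental Equation $$\Pi(\alpha,\beta)=\bar Q(\alpha,\beta)-\bar\nabla^\alpha U(\beta)+\bar\nabla^\beta U(\alpha)+U([\alpha,\beta])+\{U(\alpha),U(\beta)\}_\Omega.$$ Then for every $f\in C^\infty(M)$ there is a unique $F\in\mathcal H_\Omega$ such that $\bar\nabla^\alpha F=\{U(\alpha),F\}_\Omega$ for all $\alpha\in\Omega^1(M)$ and $F|_Z=p^*f|_Z$; and the map $\theta:f\mapsto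 F$ is a Poisson morphism from $(C^\infty(M),\{\cdot,\cdot\})$ to $(\mathcal H_\Omega,\{\cdot,\cdot\}_\Omega)$: it is a homomorphism of unital $\mathbb R$-algebras and $\theta(\{f,g\})=\{\theta(f),\theta(g)\}_\Omega$ for all $f,g\in C^\infty(M)$. -/

import Mathlib

open scoped Manifold ContDiff

noncomputable section

namespace FormalLift

/-! ### Tensor calculus on a manifold `M` of dimension `n` -/

/-- The cotangent space `T*_x M`. -/
abbrev Cot {n : ℕ} {M : Type*} [TopologicalSpace M]
    [ChartedSpace (EuclideanSpace ℝ (Fin n)) M] (x : M) : Type :=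
  TangentSpace (𝓡 n) x →L[ℝ] ℝ

/-- Fields of tangent vectors on `M` (no regularity). -/
abbrev VField (n : ℕ) (M : Type*) [TopologicalSpace M]
    [ChartedSpace (EuclideanSpace ℝ (Fin n)) M] : Type _ :=
  ∀ x : M, TangentSpace (𝓡 n) x

/-- Fields of covectors on `M` (no regularity; see `IsSmoothForm`). -/
abbrev Form (n : ℕ) (M : Type*) [TopologicalSpace M]
    [ChartedSpace (EuclideanSpace ℝ (Fin n)) M] : Type _ :=
  ∀ x : M, Cot (n := n) x

/-- The smooth local charts of `M`: all charts of the maximal smooth atlas. -/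
abbrev Charts (n : ℕ) (M : Type*) [TopologicalSpace M]
    [ChartedSpace (EuclideanSpace ℝ (Fin n)) M] :
    Set (OpenPartialHomeomorph M (EuclideanSpace ℝ (Fin n))) :=
  IsManifold.maximalAtlas (𝓡 n) ∞ M

section Tensor

variable {n : ℕ} {M : Type*} [TopologicalSpace M] [ChartedSpace (EuclideanSpace ℝ (Fin n)) M]

/-- The basis `e_i` of `T_x M`, which is by definition the coordinate basis of the preferred chart
at `x`. -/
def stdVec (x : M) (i : Fin n) : TangentSpace (𝓡 n) x :=
  (EuclideanSpace.single i (1 : ℝ) : EuclideanSpace ℝ (Fin n))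

/-- The basis of `T*_x M` dual to `stdVec`. -/
def stdCovec (x : M) (i : Fin n) : Cot (n := n) x :=
  (EuclideanSpace.proj i : EuclideanSpace ℝ (Fin n) →L[ℝ] ℝ)

/-- The differential `df` of a real function. -/
def dfun (f : M → ℝ) : Form n M := fun x => mfderiv (𝓡 n) 𝓘(ℝ, ℝ) f x

/-- The coordinate 1-form `dx^i` of the chart `φ` (meaningful on `φ.source`). -/
def dx (φ : OpenPartialHomeomorph M (EuclideanSpace ℝ (Fin n))) (i : Fin n) : Form n M :=
  fun x => (EuclideanSpace.proj i : EuclideanSpace ℝ (Fin n) →L[ℝ] ℝ).comp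
    (mfderiv (𝓡 n) (𝓡 n) φ x)

/-- The coordinate vector field `∂_i` of the chart `φ` (meaningful on `φ.source`). -/
def frame (φ : OpenPartialHomeomorph M (EuclideanSpace ℝ (Fin n))) (i : Fin n) : VField n M :=
  fun x => ContinuousLinearMap.inverse (mfderiv (𝓡 n) (𝓡 n) φ x)
    (EuclideanSpace.single i (1 : ℝ) : EuclideanSpace ℝ (Fin n))

/-- A 1-form is smooth if its coordinates are smooth in every chart. -/
def IsSmoothForm (α : Form n M) : Prop :=
  ∀ φ ∈ Charts n M, ∀ i,
    ContMDiffOn (𝓡 n) 𝓘(ℝ, ℝ) ∞ (fun x => α x (frame φ i x)) φ.source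

/-- The Lie derivative `𝓛_X β`, at the point `x` computed in the preferred chart at `x`:
`(X^s ∂_s β_k + β_s ∂_k X^s) dx^k`. -/
def lieDeriv (X : VField n M) (β : Form n M) : Form n M := fun x =>
  let φ := chartAt (EuclideanSpace ℝ (Fin n)) x
  ∑ k, (dfun (n := n) (fun y => β y (frame φ k y)) x (X x)
    + ∑ s, β x (frame φ s x) * dfun (n := n) (fun y => dx φ s y (X y)) x (frame φ k x)) • dx φ k x

variable (n M) in
/-- A Poisson structure on `M`: a smooth bivector field `Π` such that `{f, g} = Π(df, dg)` satisfies
the Jacobi identity. -/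
structure PoissonStructure where
  /-- the bivector at each point, as a form on covectors -/
  bivector : ∀ x : M, Cot (n := n) x →ₗ[ℝ] Cot (n := n) x →ₗ[ℝ] ℝ
  alt : ∀ x α, bivector x α α = 0
  smooth : ∀ φ ∈ Charts n M, ∀ i j,
    ContMDiffOn (𝓡 n) 𝓘(ℝ, ℝ) ∞ (fun x => bivector x (dx φ i x) (dx φ j x)) φ.source
  jacobi : ∀ (f g h : C^∞⟮𝓡 n, M; ℝ⟯) (x : M),
    bivector x (dfun f x) (dfun (fun y => bivector y (dfun g y) (dfun h y)) x)
      + bivector x (dfun g x) (dfun (fun y => bivector y (dfun h y) (dfun f y)) x)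
      + bivector x (dfun h x) (dfun (fun y => bivector y (dfun f y) (dfun g y)) x) = 0

/-- The components `π^{ij}` of the Poisson tensor in the chart `φ`. -/
def PoissonStructure.comp (P : PoissonStructure n M)
    (φ : OpenPartialHomeomorph M (EuclideanSpace ℝ (Fin n))) (i j : Fin n) (x : M) : ℝ :=
  P.bivector x (dx φ i x) (dx φ j x)

/-- The vector field `#α`, determined by `⟨β, #α⟩ = Π(α, β)`. -/
def sharp (P : PoissonStructure n M) (α : Form n M) : VField n M := fun x =>
  ∑ i, P.bivector x (α x) (stdCovec x i) • stdVec x i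

/-- The bracket of 1-forms `[α, β] = 𝓛_{#α} β - 𝓛_{#β} α - d Π(α, β)`. -/
def formBracket (P : PoissonStructure n M) (α β : Form n M) : Form n M := fun x =>
  lieDeriv (sharp P α) β x - lieDeriv (sharp P β) α x
    - dfun (fun y => P.bivector y (α y) (β y)) x

/-- A (linear) contravariant connection on `T*M`. Only its values on smooth 1-forms matter. -/
structure ContravariantConnection (P : PoissonStructure n M) where
  /-- `toFun α β` is `∇^α β` -/
  toFun : Form n M → Form n M → Form n M
  smooth : ∀ α β, IsSmoothForm α → IsSmoothForm β → IsSmoothForm (toFun α β)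
  add_left : ∀ α α' β, IsSmoothForm α → IsSmoothForm α' → IsSmoothForm β →
    toFun (fun x => α x + α' x) β = fun x => toFun α β x + toFun α' β x
  add_right : ∀ α β β', IsSmoothForm α → IsSmoothForm β → IsSmoothForm β' →
    toFun α (fun x => β x + β' x) = fun x => toFun α β x + toFun α β' x
  smul_left : ∀ (f : C^∞⟮𝓡 n, M; ℝ⟯) α β, IsSmoothForm α → IsSmoothForm β →
    toFun (fun x => f x • α x) β = fun x => f x • toFun α β x
  leibniz : ∀ (f : C^∞⟮𝓡 n, M; ℝ⟯) α β, IsSmoothForm α → IsSmoothForm β →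
    toFun α (fun x => f x • β x) =
      fun x => f x • toFun α β x + dfun f x (sharp P α x) • β x

/-- The function `⟨γ, ∇^α X⟩ = (#α)⟨γ, X⟩ - ⟨∇^α γ, X⟩`, where `∇^α X` refers to the corresponding
connection on vector fields. -/
def ContravariantConnection.pairVField {P : PoissonStructure n M}
    (D : ContravariantConnection P) (α : Form n M) (X : VField n M) (γ : Form n M) (x : M) : ℝ :=
  dfun (n := n) (fun y => γ y (X y)) x (sharp P α x) - D.toFun α γ x (X x)

/-- `∇` and `∇'` are associated: `∇'^α #β - ∇^β #α - #[α, β] = 0`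
(an identity of vector fields, tested on all smooth 1-forms `γ`). -/
def Associated {P : PoissonStructure n M} (D D' : ContravariantConnection P) : Prop :=
  ∀ α β γ : Form n M, IsSmoothForm α → IsSmoothForm β → IsSmoothForm γ → ∀ x,
    D'.pairVField α (sharp P β) γ x - D.pairVField β (sharp P α) γ x
      - γ x (sharp P (formBracket P α β) x) = 0

/-- `∇^α β - ∇^β α - [α, β] = 0`. -/
def TorsionFree {P : PoissonStructure n M} (D : ContravariantConnection P) : Prop :=
  ∀ α β : Form n M, IsSmoothForm α → IsSmoothForm β → ∀ x,
    D.toFun α β x - D.toFun β α x - formBracket P α β x = 0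

end Tensor

section Bracket

variable {n : ℕ} {M : Type*} [TopologicalSpace M] [ChartedSpace (EuclideanSpace ℝ (Fin n)) M]

lemma mdifferentiable_of_mem_charts [IsManifold (𝓡 n) ∞ M]
    {φ : OpenPartialHomeomorph M (EuclideanSpace ℝ (Fin n))} (hφ : φ ∈ Charts n M) :
    φ.MDifferentiable (𝓡 n) (𝓡 n) :=
  ⟨(contMDiffOn_of_mem_maximalAtlas hφ).mdifferentiableOn (by simp),
    (contMDiffOn_symm_of_mem_maximalAtlas hφ).mdifferentiableOn (by simp)⟩

lemma mfderiv_frame [IsManifold (𝓡 n) ∞ M]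
    {φ : OpenPartialHomeomorph M (EuclideanSpace ℝ (Fin n))} (hφ : φ ∈ Charts n M) {x : M}
    (hx : x ∈ φ.source) (i : Fin n) :
    frame φ i x = mfderiv (𝓡 n) (𝓡 n) φ.symm (φ x)
      (EuclideanSpace.single i (1 : ℝ) : EuclideanSpace ℝ (Fin n)) := by
  have h := ContinuousLinearMap.inverse_equiv ((mdifferentiable_of_mem_charts hφ).mfderiv hx)
  exact congrArg (fun L => L (EuclideanSpace.single i (1 : ℝ) : EuclideanSpace ℝ (Fin n))) h

lemma covector_eq_sum [IsManifold (𝓡 n) ∞ M]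
    {φ : OpenPartialHomeomorph M (EuclideanSpace ℝ (Fin n))} (hφ : φ ∈ Charts n M) {x : M}
    (hx : x ∈ φ.source) (α : Cot (n := n) x) :
    α = ∑ i, α (frame φ i x) • dx φ i x := by
  ext w
  have h1 : w = ∑ i, dx φ i x w • frame φ i x := by
    have h2 := congrArg (fun L => L w) ((mdifferentiable_of_mem_charts hφ).symm_comp_deriv hx)
    have h3 : ∀ z : EuclideanSpace ℝ (Fin n),
        z = ∑ i, z i • (EuclideanSpace.single i (1 : ℝ) : EuclideanSpace ℝ (Fin n)) := by
      intro z
      ext j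
      simp [Pi.single_apply]
    refine h2.symm.trans ?_
    refine (congrArg (mfderiv (𝓡 n) (𝓡 n) φ.symm (φ x))
      (h3 (mfderiv (𝓡 n) (𝓡 n) φ x w))).trans ?_
    refine (map_sum (mfderiv (𝓡 n) (𝓡 n) φ.symm (φ x)) _ _).trans
      (Finset.sum_congr rfl fun i _ => ?_)
    rw [mfderiv_frame hφ hx]
    exact map_smul (mfderiv (𝓡 n) (𝓡 n) φ.symm (φ x)) _ _
  conv_lhs => rw [h1]
  simp [mul_comm]

lemma contMDiffOn_partial [IsManifold (𝓡 n) ∞ M] (f : C^∞⟮𝓡 n, M; ℝ⟯)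
    {φ : OpenPartialHomeomorph M (EuclideanSpace ℝ (Fin n))} (hφ : φ ∈ Charts n M) (i : Fin n) :
    ContMDiffOn (𝓡 n) 𝓘(ℝ, ℝ) ∞ (fun x => dfun f x (frame φ i x)) φ.source := by
  have h1 : ContMDiffOn (𝓡 n) 𝓘(ℝ, ℝ) ∞ (f ∘ φ.symm) φ.target :=
    f.contMDiff.comp_contMDiffOn (contMDiffOn_symm_of_mem_maximalAtlas hφ)
  have h2 : ContDiffOn ℝ ∞ (f ∘ φ.symm) φ.target := contMDiffOn_iff_contDiffOn.1 h1
  have h3 : ContDiffOn ℝ ∞ (fun y => fderiv ℝ (f ∘ φ.symm) y (EuclideanSpace.single i (1 : ℝ)))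
      φ.target :=
    (h2.fderiv_of_isOpen φ.open_target (m := ∞) (by simp)).clm_apply contDiffOn_const
  have h4 := (contMDiffOn_iff_contDiffOn.2 h3).comp (contMDiffOn_of_mem_maximalAtlas hφ)
    (fun x hx => φ.map_source hx)
  refine h4.congr fun x hx => ?_
  have h5 : mfderiv (𝓡 n) 𝓘(ℝ, ℝ) (f ∘ φ.symm) (φ x) =
      (mfderiv (𝓡 n) 𝓘(ℝ, ℝ) f (φ.symm (φ x))).comp (mfderiv (𝓡 n) (𝓡 n) φ.symm (φ x)) :=
    mfderiv_comp (φ x) (f.contMDiff.mdifferentiableAt (by simp))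
      ((mdifferentiable_of_mem_charts hφ).mdifferentiableAt_symm (φ.map_source hx))
  rw [mfderiv_eq_fderiv, φ.left_inv hx] at h5
  rw [mfderiv_frame hφ hx]
  exact (congrArg (fun L : EuclideanSpace ℝ (Fin n) →L[ℝ] ℝ =>
    L (EuclideanSpace.single i (1 : ℝ))) h5).symm

/-- The Poisson bracket `{f, g} = Π(df, dg)` on `C^∞(M)`. -/
def poissonBracket [IsManifold (𝓡 n) ∞ M] (P : PoissonStructure n M)
    (f g : C^∞⟮𝓡 n, M; ℝ⟯) : C^∞⟮𝓡 n, M; ℝ⟯ :=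
  ⟨fun x => P.bivector x (dfun f x) (dfun g x), by
    intro x
    let φ := chartAt (EuclideanSpace ℝ (Fin n)) x
    have hφ : φ ∈ Charts n M := IsManifold.chart_mem_maximalAtlas x
    have hx : x ∈ φ.source := mem_chart_source _ x
    have h : ContMDiffOn (𝓡 n) 𝓘(ℝ, ℝ) ∞ (fun y => ∑ i, ∑ j, dfun f y (frame φ i y) *
        (dfun g y (frame φ j y) * P.bivector y (dx φ i y) (dx φ j y))) φ.source :=
      contMDiffOn_finsetSum fun i _ => contMDiffOn_finsetSum fun j _ =>
        (contMDiffOn_partial f hφ i).mul ((contMDiffOn_partial g hφ j).mul (P.smooth φ hφ i j))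
    refine (h.congr fun y hy => ?_).contMDiffAt (φ.open_source.mem_nhds hx)
    conv_lhs => rw [covector_eq_sum hφ hy (dfun f y), covector_eq_sum hφ hy (dfun g y)]
    simp only [map_sum, map_smul, LinearMap.sum_apply, LinearMap.smul_apply, smul_eq_mul,
      Finset.mul_sum]
    rw [Finset.sum_comm]
    exact Finset.sum_congr rfl fun i _ => Finset.sum_congr rfl fun j _ => by ring⟩

end Bracket

/-! ### Formal functions on the formal neighbourhood `(T*M, Z)` of the zero section

At a point `x`, a formal function is a formal power series in the linear coordinates
`ξ_1, …, ξ_n` on `T*_x M` which correspond to the basis `stdVec x`. -/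

/-- Families of fibrewise formal power series (no regularity in `x`; see `formalFunctions`). -/
abbrev FField (n : ℕ) (M : Type*) : Type _ := M → MvPowerSeries (Fin n) ℝ

/-- Formal vector fields `H` along the fibres of `T*M` (no regularity in `x`). A vector `v` in `T_x M`
is a linear function on `T*_x M`, and `H x v` is its derivative along `H`. So the coefficients
of `H = ∑ a_i ∂/∂ξ_i` are `a_i = H x e_i`. -/
abbrev VertField (n : ℕ) (M : Type*) [TopologicalSpace M]
    [ChartedSpace (EuclideanSpace ℝ (Fin n)) M] : Type _ :=
  ∀ x : M, TangentSpace (𝓡 n) x →ₗ[ℝ] MvPowerSeries (Fin n) ℝ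

/-- Formal 1-forms `U` along the fibres of `T*M` (no regularity in `x`). A covector `α` at `x` is a
constant vector field on the fibre `T*_x M`, and `U x α` is the value of `U` on it. -/
abbrev VertForm (n : ℕ) (M : Type*) [TopologicalSpace M]
    [ChartedSpace (EuclideanSpace ℝ (Fin n)) M] : Type _ :=
  ∀ x : M, Cot (n := n) x →ₗ[ℝ] MvPowerSeries (Fin n) ℝ

section Formal

variable {n : ℕ} {M : Type*} [TopologicalSpace M] [ChartedSpace (EuclideanSpace ℝ (Fin n)) M]

/-- All coefficients of the family of series are smooth functions of `x ∈ s`. -/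
def SmoothCoeffOn (F : FField n M) (s : Set M) : Prop :=
  ∀ m : Fin n →₀ ℕ,
    ContMDiffOn (𝓡 n) 𝓘(ℝ, ℝ) ∞ (fun x => MvPowerSeries.coeff m (F x)) s

/-- The fibre coordinates `ξ_i` with respect to `stdVec x`, expressed through the fibre coordinates
of the chart `φ`. -/
def fibreChange (φ : OpenPartialHomeomorph M (EuclideanSpace ℝ (Fin n))) (x : M) (i : Fin n) :
    MvPowerSeries (Fin n) ℝ :=
  ∑ k, dx φ k x (stdVec x i) • MvPowerSeries.X k

/-- The expression `F(x, ξ)` of a formal function in the fibre coordinates of the chart `φ`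
(meaningful for `x ∈ φ.source`). -/
def toChart (φ : OpenPartialHomeomorph M (EuclideanSpace ℝ (Fin n))) (F : FField n M) :
    FField n M :=
  fun x => MvPowerSeries.subst (fibreChange φ x) (F x)

/-- The function `v̂` on the fibre at `x`: a tangent vector as a linear function on covectors. -/
def hat (x : M) : TangentSpace (𝓡 n) x →ₗ[ℝ] MvPowerSeries (Fin n) ℝ :=
  ∑ i, LinearMap.smulRight ((stdCovec x i : Cot (n := n) x) : TangentSpace (𝓡 n) x →ₗ[ℝ] ℝ)
    (MvPowerSeries.X i : MvPowerSeries (Fin n) ℝ)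

/-- The formal function equal to the fibre coordinate `ξ_k` of the chart `φ` over `φ.source`. -/
def fibreCoord (φ : OpenPartialHomeomorph M (EuclideanSpace ℝ (Fin n))) (k : Fin n) :
    FField n M :=
  fun x => hat x (frame φ k x)

/-- Smoothness of a formal vertical vector field: smooth coefficients in every chart. -/
def IsSmoothVertField (H : VertField n M) : Prop :=
  ∀ φ ∈ Charts n M, ∀ k, SmoothCoeffOn (toChart φ (fun x => H x (frame φ k x))) φ.source

/-- Smoothness of a formal vertical 1-form: smooth coefficients in every chart. -/
def IsSmoothVertForm (U : VertForm n M) : Prop :=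
  ∀ φ ∈ Charts n M, ∀ i, SmoothCoeffOn (toChart φ (fun x => U x (dx φ i x))) φ.source

/-- The formal function `H F = ∑ a_k ∂F/∂ξ_k`. -/
def VertField.act (H : VertField n M) (F : FField n M) : FField n M := fun x =>
  ∑ k, H x (stdVec x k) * MvPowerSeries.pderiv ℝ k (F x)

/-- The formal function `U(α)`. -/
def VertForm.eval (U : VertForm n M) (α : Form n M) : FField n M := fun x => U x (α x)

/-- The fibrewise Euler field `𝓔 = ξ_k ∂/∂ξ_k`. -/
def euler : VertField n M := fun x => hat x

/-- The value `Ω(H, K) = π^{ij} a_i b_j` of the fibrewise form `Ω = ½ π^{ij} dξ_i ∧ dξ_j`. -/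
def Omega (P : PoissonStructure n M) (H K : VertField n M) : FField n M := fun x =>
  ∑ i, ∑ j, P.bivector x (stdCovec x i) (stdCovec x j) • (H x (stdVec x i) * K x (stdVec x j))

/-- `H` is a (smooth) Hamiltonian vector field of `F`: `ι(H)Ω = - d_ξ F`. -/
structure IsHamiltonianField (P : PoissonStructure n M) (F : FField n M)
    (H : VertField n M) : Prop where
  smooth : IsSmoothVertField H
  eq : ∀ K : VertField n M, Omega P H K = - K.act F

lemma hasSubst_fibreChange (φ : OpenPartialHomeomorph M (EuclideanSpace ℝ (Fin n))) (x : M) :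
    MvPowerSeries.HasSubst (fibreChange φ x) := by
  apply MvPowerSeries.hasSubst_of_constantCoeff_zero
  intro s
  simp [fibreChange, MvPowerSeries.smul_eq_C_mul]

lemma toChart_add (φ : OpenPartialHomeomorph M (EuclideanSpace ℝ (Fin n))) (F G : FField n M) :
    toChart φ (F + G) = toChart φ F + toChart φ G := by
  funext x
  exact MvPowerSeries.subst_add (hasSubst_fibreChange φ x) _ _

lemma toChart_mul (φ : OpenPartialHomeomorph M (EuclideanSpace ℝ (Fin n))) (F G : FField n M) :
    toChart φ (F * G) = toChart φ F * toChart φ G := by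
  funext x
  exact MvPowerSeries.subst_mul (hasSubst_fibreChange φ x) _ _

lemma toChart_algebraMap (φ : OpenPartialHomeomorph M (EuclideanSpace ℝ (Fin n))) (r : ℝ) :
    toChart φ (algebraMap ℝ (FField n M) r) = algebraMap ℝ (FField n M) r := by
  funext x
  have := (MvPowerSeries.substAlgHom (R := ℝ) (hasSubst_fibreChange φ x)).commutes r
  rw [MvPowerSeries.substAlgHom_apply] at this
  exact this

lemma SmoothCoeffOn.add {F G : FField n M} {s : Set M} (hF : SmoothCoeffOn F s)
    (hG : SmoothCoeffOn G s) : SmoothCoeffOn (F + G) s := by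
  intro m
  exact (hF m).add (hG m)

lemma SmoothCoeffOn.mul {F G : FField n M} {s : Set M} (hF : SmoothCoeffOn F s)
    (hG : SmoothCoeffOn G s) : SmoothCoeffOn (F * G) s := by
  classical
  intro m
  have : ContMDiffOn (𝓡 n) 𝓘(ℝ, ℝ) ∞ (fun x => ∑ p ∈ Finset.HasAntidiagonal.antidiagonal m,
      MvPowerSeries.coeff p.1 (F x) * MvPowerSeries.coeff p.2 (G x)) s :=
    contMDiffOn_finsetSum fun p _ => (hF p.1).mul (hG p.2)
  refine this.congr fun x _ => ?_
  simp [MvPowerSeries.coeff_mul]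

lemma smoothCoeffOn_algebraMap (r : ℝ) (s : Set M) :
    SmoothCoeffOn (algebraMap ℝ (FField n M) r) s := fun _ => contMDiffOn_const

variable (n M) in
/-- The algebra `C^∞(T*M, Z)` of formal functions on the formal neighbourhood of the zero section:
fibrewise formal power series whose coefficients in every chart are smooth functions of `x`. -/
def formalFunctions : Subalgebra ℝ (FField n M) where
  carrier := {F | ∀ φ ∈ Charts n M, SmoothCoeffOn (toChart φ F) φ.source}
  add_mem' := fun hF hG φ hφ => by
    rw [toChart_add]; exact (hF φ hφ).add (hG φ hφ)
  mul_mem' := fun hF hG φ hφ => by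
    rw [toChart_mul]; exact (hF φ hφ).mul (hG φ hφ)
  algebraMap_mem' := fun r φ _ => by
    rw [toChart_algebraMap]; exact smoothCoeffOn_algebraMap r _

lemma IsHamiltonianField.add {P : PoissonStructure n M} {F G : FField n M} {H K : VertField n M}
    (hF : IsHamiltonianField P F H) (hG : IsHamiltonianField P G K) :
    IsHamiltonianField P (F + G) (H + K) where
  smooth φ hφ k := by
    have := (hF.smooth φ hφ k).add (hG.smooth φ hφ k)
    rw [← toChart_add] at this
    exact this
  eq L := by
    have h1 := hF.eq L
    have h2 := hG.eq L
    funext x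
    have h1 := congrFun h1 x
    have h2 := congrFun h2 x
    simp only [Omega, VertField.act, Pi.neg_apply, Pi.add_apply, map_add, mul_add,
      LinearMap.add_apply, add_mul, smul_add, Finset.sum_add_distrib] at h1 h2 ⊢
    rw [h1, h2, neg_add]

lemma IsHamiltonianField.mul {P : PoissonStructure n M} {F G : FField n M} {H K : VertField n M}
    (hFs : F ∈ formalFunctions n M) (hGs : G ∈ formalFunctions n M)
    (hF : IsHamiltonianField P F H) (hG : IsHamiltonianField P G K) :
    IsHamiltonianField P (F * G)
      (fun x => (LinearMap.mulLeft ℝ (F x)).comp (K x) + (LinearMap.mulLeft ℝ (G x)).comp (H x))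
    where
  smooth φ hφ k := by
    have := ((hFs φ hφ).mul (hG.smooth φ hφ k)).add ((hGs φ hφ).mul (hF.smooth φ hφ k))
    rw [← toChart_mul, ← toChart_mul, ← toChart_add] at this
    exact this
  eq L := by
    funext x
    have h1 := congrFun (hF.eq L) x
    have h2 := congrFun (hG.eq L) x
    simp only [Omega, VertField.act, Pi.neg_apply] at h1 h2
    simp only [Omega, VertField.act, Pi.neg_apply, Pi.mul_apply, LinearMap.add_apply,
      LinearMap.comp_apply, LinearMap.mulLeft_apply, add_mul, smul_add, Finset.sum_add_distrib,
      Derivation.leibniz, smul_eq_mul, mul_add]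
    have e1 : ∀ (A : MvPowerSeries (Fin n) ℝ) (N : VertField n M),
        ∑ i, ∑ j, P.bivector x (stdCovec x i) (stdCovec x j) •
          (A * N x (stdVec x i) * L x (stdVec x j)) =
        A * ∑ i, ∑ j, P.bivector x (stdCovec x i) (stdCovec x j) •
          (N x (stdVec x i) * L x (stdVec x j)) := by
      intro A N
      simp only [Finset.mul_sum, mul_smul_comm, mul_assoc]
    have e2 : ∀ A B : MvPowerSeries (Fin n) ℝ,
        ∑ k, L x (stdVec x k) * (A * MvPowerSeries.pderiv ℝ k B) =
        A * ∑ k, L x (stdVec x k) * MvPowerSeries.pderiv ℝ k B := by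
      intro A B
      simp only [Finset.mul_sum]
      exact Finset.sum_congr rfl fun k _ => by ring
    rw [e1, e1, e2, e2, h1, h2]
    ring

lemma isHamiltonianField_algebraMap (P : PoissonStructure n M) (r : ℝ) :
    IsHamiltonianField P (algebraMap ℝ (FField n M) r) 0 where
  smooth φ hφ k := by
    have h : toChart φ (fun x => (0 : VertField n M) x (frame φ k x)) =
        algebraMap ℝ (FField n M) 0 := by
      rw [← toChart_algebraMap φ 0]
      congr 1
      funext x
      simp
    rw [h]
    exact smoothCoeffOn_algebraMap 0 _
  eq L := by
    funext x
    simp [Omega, VertField.act]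

/-- The algebra `𝓗_Ω` of Hamiltonian functions of `Ω`: the formal functions `F` which admit a formal
vertical vector field `H_F` with `ι(H_F)Ω = - d_ξ F`. -/
def hamiltonianFunctions (P : PoissonStructure n M) : Subalgebra ℝ (FField n M) where
  carrier := {F | F ∈ formalFunctions n M ∧ ∃ H, IsHamiltonianField P F H}
  add_mem' := fun ⟨hF, H, hH⟩ ⟨hG, K, hK⟩ =>
    ⟨(formalFunctions n M).add_mem hF hG, H + K, hH.add hK⟩
  mul_mem' := fun ⟨hF, _, hH⟩ ⟨hG, _, hK⟩ =>
    ⟨(formalFunctions n M).mul_mem hF hG, _, hH.mul hF hG hK⟩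
  algebraMap_mem' := fun r =>
    ⟨(formalFunctions n M).algebraMap_mem r, 0, isHamiltonianField_algebraMap P r⟩

open Classical in
/-- The bracket `{F, G}_Ω = H_F G` on `𝓗_Ω`, for any Hamiltonian vector field `H_F` of `F`
(see `bracketOmega_eq`); it is meant for `F, G ∈ 𝓗_Ω` only. -/
def bracketOmega (P : PoissonStructure n M) (F G : FField n M) : FField n M :=
  if h : ∃ H, IsHamiltonianField P F H then (Classical.choose h).act G else 0

lemma omega_antisymm (P : PoissonStructure n M) (H K : VertField n M) :
    Omega P H K = - Omega P K H := by
  funext x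
  simp only [Omega, Pi.neg_apply]
  rw [Finset.sum_comm, ← Finset.sum_neg_distrib]
  refine Finset.sum_congr rfl fun i _ => ?_
  rw [← Finset.sum_neg_distrib]
  refine Finset.sum_congr rfl fun j _ => ?_
  have h : P.bivector x (stdCovec x j) (stdCovec x i) =
      - P.bivector x (stdCovec x i) (stdCovec x j) := by
    have := P.alt x (stdCovec x i + stdCovec x j)
    simp only [map_add, LinearMap.add_apply, P.alt] at this
    linarith
  rw [h, neg_smul, mul_comm]

/-- On `𝓗_Ω` the bracket does not depend on the choice of `H_F`, and
`{F, G}_Ω = H_F G = - H_G F = Ω(H_F, H_G)`. -/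
lemma bracketOmega_eq {P : PoissonStructure n M} {F G : FField n M} {H K : VertField n M}
    (hF : IsHamiltonianField P F H) (hG : IsHamiltonianField P G K) :
    bracketOmega P F G = H.act G ∧ bracketOmega P F G = - K.act F ∧
      bracketOmega P F G = Omega P H K := by
  have h : ∃ H, IsHamiltonianField P F H := ⟨H, hF⟩
  have key : ∀ H', IsHamiltonianField P F H' → H'.act G = - K.act F := by
    intro H' hH'
    rw [← hH'.eq K, omega_antisymm, hG.eq H', neg_neg]
  have hb : bracketOmega P F G = - K.act F := by
    rw [bracketOmega, dif_pos h]
    exact key _ (Classical.choose_spec h)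
  exact ⟨hb.trans (key H hF).symm, hb, hb.trans (hF.eq K).symm⟩

/-- `∂F/∂x^s` in the chart `φ`, with the fibre coordinates of `φ` kept fixed. -/
def partialBase (φ : OpenPartialHomeomorph M (EuclideanSpace ℝ (Fin n))) (s : Fin n)
    (F : FField n M) : FField n M := fun x m =>
  dfun (n := n) (fun y => MvPowerSeries.coeff m (toChart φ F y)) x (frame φ s x)

end Formal

section Lift

variable {n : ℕ} {M : Type*} [TopologicalSpace M] [ChartedSpace (EuclideanSpace ℝ (Fin n)) M]

/-- A global smooth 1-form which coincides near `x` with `dx^j`, for the preferred chart at `x`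
(`dx^j` times a bump function which equals `1` near `x`; `M` is Hausdorff). -/
def coordForm (x : M) (j : Fin n) : Form n M := fun y =>
  (Classical.arbitrary (SmoothBumpFunction (𝓡 n) x)) y • dx (chartAt (EuclideanSpace ℝ (Fin n)) x) j y

/-- The contravariant connection `∇̄` on `(T*M, Z)` induced by `∇`. At the point `x` it is computed in
the preferred chart at `x` by `∇̄^{dx^i} = π^{is} ∂/∂x^s + Γ_k^{ij} ξ_j ∂/∂ξ_k`, where
`∇^{dx^i} dx^j = - Γ_k^{ij} dx^k`. -/
def nablaBar {P : PoissonStructure n M} (D : ContravariantConnection P) (α : Form n M)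
    (F : FField n M) : FField n M := fun x =>
  let φ := chartAt (EuclideanSpace ℝ (Fin n)) x
  (∑ s, dx φ s x (sharp P α x) • partialBase φ s F x)
    + ∑ j, ∑ k, (-(D.toFun α (coordForm x j) x (frame φ k x))) •
        (MvPowerSeries.X j * MvPowerSeries.pderiv ℝ k (toChart φ F x))

/-- The curvature `R(α, β) = [∇̄^α, ∇̄^β] - ∇̄^{[α, β]}` of `∇̄`, a vertical vector field, given by its
values on the fibre coordinates. -/
def curvatureBar {P : PoissonStructure n M} (D : ContravariantConnection P) (α β : Form n M) :
    VertField n M := fun x =>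
  let φ := chartAt (EuclideanSpace ℝ (Fin n)) x
  ∑ k, LinearMap.smulRight ((dx φ k x : Cot (n := n) x) : TangentSpace (𝓡 n) x →ₗ[ℝ] ℝ)
    (nablaBar D α (nablaBar D β (fibreCoord φ k)) x
      - nablaBar D β (nablaBar D α (fibreCoord φ k)) x
      - nablaBar D (formBracket P α β) (fibreCoord φ k) x)

/-- `Q̄(α, β) = ½ Ω(𝓔, R(α, β))`. -/
def Qbar {P : PoissonStructure n M} (D : ContravariantConnection P) (α β : Form n M) :
    FField n M := (1 / 2 : ℝ) • Omega P euler (curvatureBar D α β)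

/-- The Fundamental Equation
`Π(α, β) = Q̄(α, β) - ∇̄^α U(β) + ∇̄^β U(α) + U([α, β]) + {U(α), U(β)}_Ω`. -/
def FundamentalEquation {P : PoissonStructure n M} (D : ContravariantConnection P)
    (U : VertForm n M) : Prop :=
  ∀ α β : Form n M, IsSmoothForm α → IsSmoothForm β →
    (fun x => MvPowerSeries.C (P.bivector x (α x) (β x))) =
      Qbar D α β - nablaBar D α (U.eval β) + nablaBar D β (U.eval α)
        + U.eval (formBracket P α β) + bracketOmega P (U.eval α) (U.eval β)

/-- `u_k(x, ξ)` and `v^i_k(x, ξ)` (written `v i k`) are local potentials of `U` on the chart `φ`; they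
are formal series in the fibre coordinates `ξ` of `φ` with smooth coefficients. -/
structure IsLocalPotential (P : PoissonStructure n M) (U : VertForm n M)
    (φ : OpenPartialHomeomorph M (EuclideanSpace ℝ (Fin n)))
    (u : Fin n → FField n M) (v : Fin n → Fin n → FField n M) : Prop where
  smooth_u : ∀ k, SmoothCoeffOn (u k) φ.source
  smooth_v : ∀ i k, SmoothCoeffOn (v i k) φ.source
  /-- `π^{is} v_s^j = π^{js} ∂u_s/∂ξ_i` -/
  agree : ∀ x ∈ φ.source, ∀ i j,
    ∑ s, P.comp φ i s x • v j s x = ∑ s, P.comp φ j s x • MvPowerSeries.pderiv ℝ i (u s x)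
  /-- `U(dx^i) = π^{ik} u_k` -/
  potential : ∀ x ∈ φ.source, ∀ i,
    toChart φ (U.eval (dx φ i)) x = ∑ k, P.comp φ i k x • u k x
  /-- `u_k = - ξ_k (mod ξ²)` -/
  u_mod : ∀ x ∈ φ.source, ∀ k, ∀ m : Fin n →₀ ℕ, m.degree < 2 →
    MvPowerSeries.coeff m (u k x) = MvPowerSeries.coeff m (-MvPowerSeries.X k)
  /-- `v^i_k = δ^i_k (mod ξ)` -/
  v_mod : ∀ x ∈ φ.source, ∀ i k,
    MvPowerSeries.constantCoeff (v i k x) = if i = k then 1 else 0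

/-- There are local potentials of `U` on a covering of `M` by coordinate charts. -/
def HasLocalPotentials (P : PoissonStructure n M) (U : VertForm n M) : Prop :=
  ∀ x : M, ∃ φ ∈ Charts n M, x ∈ φ.source ∧ ∃ u v, IsLocalPotential P U φ u v

/-- `F ∈ 𝓗_Ω` is a solution of the system `∇̄^α F = {U(α), F}_Ω` with `F|_Z = f`. -/
structure IsLift {P : PoissonStructure n M} (D : ContravariantConnection P) (U : VertForm n M)
    (f : C^∞⟮𝓡 n, M; ℝ⟯) (F : FField n M) : Prop where
  mem : F ∈ hamiltonianFunctions P
  eq : ∀ α : Form n M, IsSmoothForm α → nablaBar D α F = bracketOmega P (U.eval α) F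
  initial : ∀ x, MvPowerSeries.constantCoeff (F x) = f x

end Lift

end FormalLift

end

open scoped Manifold ContDiff

noncomputable section

namespace FormalLift

/-! ### Formal power series over a ring with derivations -/

section PowerSeries

open MvPowerSeries

variable {n : ℕ} {R : Type*} [CommRing R] [Algebra ℝ R]

/-! Over a coordinate domain, `R` is the ring of smooth functions and formal functions are power
series in ξ over `R`. The system becomes `op i F = 0` for n derivations `op i = {U(dx^i), ·} -
∇̄^{dx^i}`. In terms of gradients, op F = W ∂_ξF - Π ∂_xF with W = v - Γξ. Since W is the identity
modulo ξ, it is invertible, and the system is an evolution equation ∂_ξF = W⁻¹Π ∂_xF in the fibre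
directions with initial value f on Z.

Two facts make this work. First, the identity between u and v and the association of the two
connections give WΠ = ΠW' (`W_mul_Pi`). Hence ∂_ξF = ΠW'⁻¹∂_xF for a solution, and solutions are
automatically Hamiltonian (`exists_ham`). Second, the system is involutive. The Jacobi identity
makes the curvature [op_i, op_j] + ∂_sπ^{ij} op_s a vertical field. Since Π is parallel
(`parallel`), every term of the Fundamental Equation has an explicit Hamiltonian field (`ham_q`,
`ham_nabla`, `ham_vert`). Differentiating the equation along the fibres, where Π(dx^i, dx^j) is
constant, shows that the coefficients of the curvature lie in the kernel of Π (`ham_opCurv`). Such a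
field does not see the part ΠW'⁻¹∂_xF of ∂_ξF, so the curvature applied to F is a combination of the
op_i F (`opCurv_eq`).

Uniqueness holds because op_i is ∂/∂ξ_i to leading order (`eq_of_op_eq_zero`). For existence, the
radial combination of the equations is solved by a fixed point in the ξ-adic topology
(`exists_radial`). Involutivity and a Poincaré lemma with error terms then raise the order of
vanishing of all op_i F without bound (`exists_solution`). For solutions F and G the field [op_i,
H_F] is Hamiltonian for op_i F = 0, so it kills G and {F, G} is again a solution
(`op_vert_eq_zero`). Its value on Z is Π(df, dg) (`constantCoeff_vert`).

Passing to M requires three things: `nablaBar` and its curvature, defined pointwise in preferred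
charts, must be computed in any chart (`toChart_nablaBar_eq_connOp`, `toChart_curvatureBar`); local
Hamiltonian fields are glued by a partition of unity (`exists_isHamiltonianField`); local solutions
are glued by uniqueness (`exists_isLift`). Uniqueness also yields every algebraic property of θ. -/

/-- A derivation of the coefficient ring, extended to formal power series coefficientwise. -/
def coeffDerivation (δ : Derivation ℝ R R) :
    Derivation ℝ (MvPowerSeries (Fin n) R) (MvPowerSeries (Fin n) R) :=
  Derivation.mk'
    { toFun := fun F m => δ (coeff m F)
      map_add' := fun F G => by
        funext m
        change δ (coeff m (F + G)) = δ (coeff m F) + δ (coeff m G)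
        simp
      map_smul' := fun r F => by
        funext m
        change δ (coeff m (r • F)) = r • δ (coeff m F)
        have : coeff m (r • F) = r • coeff m F := rfl
        rw [this, δ.map_smul] }
    (fun F G => by
      classical
      ext m
      change δ (coeff m (F * G)) = _
      rw [coeff_mul, map_sum, map_add, smul_eq_mul, smul_eq_mul, coeff_mul, mul_comm G, coeff_mul,
        ← Finset.sum_add_distrib]
      refine Finset.sum_congr rfl fun p _ => ?_
      change _ = coeff p.1 F * δ (coeff p.2 G) + δ (coeff p.1 F) * coeff p.2 G
      simp
      ring)

@[simp] lemma coeff_coeffDerivation (δ : Derivation ℝ R R) (F : MvPowerSeries (Fin n) R)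
    (m : Fin n →₀ ℕ) : coeff m (coeffDerivation δ F) = δ (coeff m F) := rfl

@[simp] lemma coeffDerivation_C (δ : Derivation ℝ R R) (r : R) :
    coeffDerivation δ (C r : MvPowerSeries (Fin n) R) = C (δ r) := by
  classical
  ext m
  simp only [coeff_coeffDerivation, coeff_C]
  split_ifs <;> simp

@[simp] lemma coeffDerivation_X (δ : Derivation ℝ R R) (k : Fin n) :
    coeffDerivation δ (X k : MvPowerSeries (Fin n) R) = 0 := by
  classical
  ext m
  simp only [coeff_coeffDerivation, coeff_X]
  split_ifs <;> simp

lemma coeffDerivation_pderiv (δ : Derivation ℝ R R) (k : Fin n) (F : MvPowerSeries (Fin n) R) :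
    coeffDerivation δ (pderiv R k F) = pderiv R k (coeffDerivation δ F) := by
  ext m
  -- The factor produced by `pderiv` is a natural number, hence a constant of δ.
  have : δ ((m k : R) + 1) = 0 := by
    have h : ((m k : R) + 1) = ((m k + 1 : ℕ) : R) := by push_cast; ring
    rw [h]
    exact δ.map_natCast _
  simp [coeff_pderiv, this, mul_comm]

lemma pderiv_comm {R : Type*} [CommRing R] (k l : Fin n) (F : MvPowerSeries (Fin n) R) :
    pderiv R k (pderiv R l F) = pderiv R l (pderiv R k F) := by
  classical
  ext m
  simp only [coeff_pderiv]
  rcases eq_or_ne k l with rfl | h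
  · rfl
  · have h1 : (m + Finsupp.single k 1 : Fin n →₀ ℕ) l = m l := by simp [h]
    have h2 : (m + Finsupp.single l 1 : Fin n →₀ ℕ) k = m k := by simp [h.symm]
    rw [h1, h2, add_right_comm]
    ring

/-- A series whose product with the variable `X k` is the part `|m|⁻¹ m_k F_m ξ^m` of `F`. -/
def eulerQuotient (k : Fin n) (F : MvPowerSeries (Fin n) R) : MvPowerSeries (Fin n) R :=
  fun m => (((m k : ℝ) + 1) * ((m.degree : ℝ) + 1)⁻¹) • coeff (m + Finsupp.single k 1) F

lemma coeff_X_mul_eulerQuotient (k : Fin n) (F : MvPowerSeries (Fin n) R) (m : Fin n →₀ ℕ) :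
    coeff m (X k * eulerQuotient k F) = ((m k : ℝ) * (m.degree : ℝ)⁻¹) • coeff m F := by
  classical
  rw [mul_comm, X_def, coeff_mul_monomial, mul_one]
  by_cases hk : Finsupp.single k 1 ≤ m
  · obtain ⟨m', rfl⟩ := exists_add_of_le hk
    rw [if_pos hk, add_tsub_cancel_left, add_comm (Finsupp.single k 1)]
    change (((m' k : ℝ) + 1) * ((m'.degree : ℝ) + 1)⁻¹) • coeff (m' + Finsupp.single k 1) F = _
    simp
  · have : m k = 0 := by
      by_contra h0
      exact hk (by simpa [Finsupp.single_le_iff] using Nat.one_le_iff_ne_zero.2 h0)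
    rw [if_neg hk, this]
    simp

/-- Hadamard's lemma by way of Euler's identity: the monomial ξ^m is shared among the variables with
weights m_k/|m|, which add up to 1 unless m = 0. -/
lemma exists_eq_C_add_sum_X_mul (F : MvPowerSeries (Fin n) R) :
    ∃ G : Fin n → MvPowerSeries (Fin n) R, F = C (constantCoeff F) + ∑ k, X k * G k := by
  classical
  refine ⟨fun k => eulerQuotient k F, ?_⟩
  ext m
  rw [map_add, map_sum, coeff_C]
  simp only [coeff_X_mul_eulerQuotient]
  split_ifs with hm
  · subst hm
    simp
  · have hd : (m.degree : ℝ) ≠ 0 := by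
      simpa [Finsupp.degree_eq_zero_iff] using hm
    rw [zero_add, ← Finset.sum_smul, ← Finset.sum_mul]
    have : ∑ k, (m k : ℝ) = (m.degree : ℝ) := by
      rw [Finsupp.degree_eq_sum]; push_cast; rfl
    rw [this, mul_inv_cancel₀ hd, one_smul]

/-- A map satisfying the Leibniz rule over a ring homomorphism `e` which preserves the ideal
generated by the variables vanishes as soon as it kills constants and variables. -/
lemma eq_zero_of_leibniz {S : Type*} [CommRing S]
    (e : MvPowerSeries (Fin n) R →+* MvPowerSeries (Fin n) S)
    (he : ∀ k, constantCoeff (e (X k)) = 0)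
    (δ : MvPowerSeries (Fin n) R → MvPowerSeries (Fin n) S)
    (hadd : ∀ F G, δ (F + G) = δ F + δ G)
    (hmul : ∀ F G, δ (F * G) = e F * δ G + e G * δ F)
    (hC : ∀ r, δ (C r) = 0) (hX : ∀ k, δ (X k) = 0) (F : MvPowerSeries (Fin n) R) : δ F = 0 := by
  classical
  have hsum : ∀ G : Fin n → MvPowerSeries (Fin n) R, δ (∑ k, G k) = ∑ k, δ (G k) := by
    intro G
    exact map_sum (AddMonoidHom.mk' δ hadd) G _
  -- No continuity of δ is available, so density of polynomials is of no use. Splitting F = C + ∑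
  -- X_k G_k instead expresses a coefficient of δF through lower ones of the δG_k, because `e (X k)`
  -- has no constant term.
  have key : ∀ N : ℕ, ∀ F, ∀ m : Fin n →₀ ℕ, m.degree < N → coeff m (δ F) = 0 := by
    intro N
    induction N with
    | zero => intro F m hm; omega
    | succ N ih =>
      intro F m hm
      obtain ⟨G, hG⟩ := exists_eq_C_add_sum_X_mul F
      rw [hG, hadd, hsum, hC, zero_add, map_sum]
      refine Finset.sum_eq_zero fun k _ => ?_
      rw [hmul, hX, mul_zero, add_zero, coeff_mul]
      refine Finset.sum_eq_zero fun p hp => ?_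
      rw [Finset.HasAntidiagonal.mem_antidiagonal] at hp
      rcases eq_or_ne p.1 0 with h0 | h0
      · rw [h0, coeff_zero_eq_constantCoeff_apply, he, zero_mul]
      · rw [ih (G k) p.2, mul_zero]
        have h1 : p.1.degree ≠ 0 := by simpa [Finsupp.degree_eq_zero_iff] using h0
        have h2 : p.1.degree + p.2.degree = m.degree := by rw [← hp, map_add]
        omega
  ext m
  exact key (m.degree + 1) F m (Nat.lt_succ_self _)

/-- The vertical vector field with coefficients `a`. -/
def vert (a : Fin n → MvPowerSeries (Fin n) R) :
    Derivation ℝ (MvPowerSeries (Fin n) R) (MvPowerSeries (Fin n) R) :=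
  ∑ k, a k • (pderiv R k).restrictScalars ℝ

lemma vert_apply (a : Fin n → MvPowerSeries (Fin n) R) (F : MvPowerSeries (Fin n) R) :
    vert a F = ∑ k, a k * pderiv R k F := by
  rw [vert, ← Derivation.coeFnAddMonoidHom_apply, map_sum, Finset.sum_apply]
  rfl

@[simp] lemma vert_X (a : Fin n → MvPowerSeries (Fin n) R) (k : Fin n) : vert a (X k) = a k := by
  classical
  rw [vert_apply, Finset.sum_eq_single k]
  · simp
  · intro l _ hl
    rw [pderiv_X_of_ne hl.symm, mul_zero]
  · simp

@[simp] lemma vert_C (a : Fin n → MvPowerSeries (Fin n) R) (r : R) : vert a (C r) = 0 := by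
  simp [vert_apply]

/-- A derivation over `R` is compared with the vertical field taking the same values on the
variables; `eq_zero_of_leibniz` applies to the difference. -/
lemma eq_vert {δ : Derivation ℝ (MvPowerSeries (Fin n) R) (MvPowerSeries (Fin n) R)}
    (hC : ∀ r, δ (C r) = 0) (F : MvPowerSeries (Fin n) R) :
    δ F = ∑ k, δ (X k) * pderiv R k F := by
  have h := eq_zero_of_leibniz (RingHom.id (MvPowerSeries (Fin n) R)) (by simp)
    (fun F => (δ - vert fun k => δ (X k)) F) (fun F G => map_add _ _ _)
    (fun F G => Derivation.leibniz _ _ _) (fun r => by simp [hC]) (fun k => by simp) F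
  rw [← vert_apply]
  exact sub_eq_zero.1 h

end PowerSeries

/-! ### Local model: connection, Hamiltonian fields and curvature over a ring with derivations. -/

section LocalModel

open MvPowerSeries

/-- The local data of a Poisson tensor and a pair of associated contravariant connections over a
ring `R` of functions with coordinate derivations `δ`. -/
structure LocalModel (n : ℕ) (R : Type*) [CommRing R] [Algebra ℝ R] where
  /-- the coordinate derivations -/
  δ : Fin n → Derivation ℝ R R
  δ_comm : ∀ s t r, δ s (δ t r) = δ t (δ s r)
  /-- the components of the Poisson tensor -/
  π : Fin n → Fin n → R
  skew : ∀ i j, π i j = - π j i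
  jacobi : ∀ i j k, ∑ s, (π i s * δ s (π j k) + π j s * δ s (π k i) + π k s * δ s (π i j)) = 0
  /-- the Christoffel symbols `Γ^{ij}_k` of the first connection -/
  Γ : Fin n → Fin n → Fin n → R
  /-- the Christoffel symbols of the second connection -/
  Γ' : Fin n → Fin n → Fin n → R
  assoc : ∀ i j k, ∑ l, Γ' i k l * π j l = ∑ l, Γ j k l * π i l
  torsion : ∀ l k s, Γ' k l s - Γ' l k s = δ s (π l k)

namespace LocalModel

variable {n : ℕ} {R : Type*} [CommRing R] [Algebra ℝ R] (L : LocalModel n R)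

/-- The derivation of `R[[ξ]]` given by `∂/∂x^s`. -/
abbrev base (s : Fin n) : Derivation ℝ (MvPowerSeries (Fin n) R) (MvPowerSeries (Fin n) R) :=
  coeffDerivation (L.δ s)

/-- The vertical part `Γ^{ij}_k ξ_j ∂/∂ξ_k` of the connection, by its coefficients. -/
def christoffel (i k : Fin n) : MvPowerSeries (Fin n) R := ∑ j, C (L.Γ i j k) * X j

/-- The derivation `∇̄^{dx^i} = π^{is} ∂/∂x^s + Γ_k^{ij} ξ_j ∂/∂ξ_k`. -/
def nabla (i : Fin n) : Derivation ℝ (MvPowerSeries (Fin n) R) (MvPowerSeries (Fin n) R) :=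
  (∑ s, (C (L.π i s) : MvPowerSeries (Fin n) R) • L.base s) + vert (L.christoffel i)

lemma sum_smul_apply {ι : Type*} (t : Finset ι) (a : ι → MvPowerSeries (Fin n) R)
    (D : ι → Derivation ℝ (MvPowerSeries (Fin n) R) (MvPowerSeries (Fin n) R))
    (F : MvPowerSeries (Fin n) R) : (∑ s ∈ t, a s • D s) F = ∑ s ∈ t, a s * D s F := by
  rw [← Derivation.coeFnAddMonoidHom_apply, map_sum, Finset.sum_apply]
  rfl

lemma nabla_apply (i : Fin n) (F : MvPowerSeries (Fin n) R) :
    L.nabla i F = ∑ s, C (L.π i s) * L.base s F + ∑ k, L.christoffel i k * pderiv R k F := by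
  rw [nabla, Derivation.add_apply, sum_smul_apply, vert_apply]

@[simp] lemma nabla_C (i : Fin n) (r : R) :
    L.nabla i (C r) = C (∑ s, L.π i s * L.δ s r) := by
  simp [nabla_apply]

@[simp] lemma nabla_X (i k : Fin n) : L.nabla i (X k) = L.christoffel i k := by
  rw [nabla, Derivation.add_apply, sum_smul_apply, vert_X]
  simp

lemma pderiv_christoffel (i l k : Fin n) :
    pderiv R l (L.christoffel i k) = C (L.Γ i l k) := by
  classical
  rw [christoffel, map_sum, Finset.sum_eq_single l]
  · simp
  · intro j _ hj
    simp [pderiv_X_of_ne hj]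
  · simp

/-- `F` has the Hamiltonian vector field with coefficients `a`. -/
def Ham (F : MvPowerSeries (Fin n) R) (a : Fin n → MvPowerSeries (Fin n) R) : Prop :=
  ∀ l, pderiv R l F = ∑ k, C (L.π l k) * a k

lemma C_skew (i j : Fin n) : (C (L.π i j) : MvPowerSeries (Fin n) R) = - C (L.π j i) := by
  rw [L.skew i j, map_neg]

/-- The Poisson tensor is parallel. -/
lemma parallel (i l k : Fin n) :
    ∑ s, (L.π i s * L.δ s (L.π l k) + L.Γ i l s * L.π s k + L.π l s * L.Γ i k s) = 0 := by
  -- Torsion-freeness writes ∂_sπ^{lk} as a difference of symbols Γ'. Association then trades each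
  -- contracted Γ' for a contracted Γ, and everything cancels.
  have h1 := L.assoc k i l
  have h2 := L.assoc l i k
  have h3 : ∀ s, L.π i s * L.δ s (L.π l k) + L.Γ i l s * L.π s k + L.π l s * L.Γ i k s =
      L.Γ' k l s * L.π i s - L.Γ i l s * L.π k s - (L.Γ' l k s * L.π i s - L.Γ i k s * L.π l s) := by
    intro s
    rw [← L.torsion, L.skew s k]
    ring
  simp only [h3, Finset.sum_sub_distrib, h1, h2]
  ring

/-- If ∂G = Πb, then c·Πb = -b·Πc by skewness. In particular a field in the kernel of Π kills every
Hamiltonian function. -/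
lemma ham_swap {G : MvPowerSeries (Fin n) R} {b : Fin n → MvPowerSeries (Fin n) R} (hG : L.Ham G b)
    (c : Fin n → MvPowerSeries (Fin n) R) :
    ∑ l, c l * pderiv R l G = - ∑ k, b k * ∑ l, C (L.π k l) * c l := by
  simp only [Ham] at hG
  simp only [hG, Finset.mul_sum]
  rw [Finset.sum_comm, ← Finset.sum_neg_distrib]
  refine Finset.sum_congr rfl fun k _ => ?_
  rw [← Finset.sum_neg_distrib]
  refine Finset.sum_congr rfl fun l _ => ?_
  rw [L.C_skew l k]
  ring

lemma pderiv_vert (l : Fin n) (a : Fin n → MvPowerSeries (Fin n) R) (F : MvPowerSeries (Fin n) R) :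
    pderiv R l (vert a F) = vert a (pderiv R l F) + ∑ k, pderiv R l (a k) * pderiv R k F := by
  simp only [vert_apply, map_sum, Derivation.leibniz, smul_eq_mul, Finset.sum_add_distrib]
  congr 1
  · exact Finset.sum_congr rfl fun k _ => by rw [pderiv_comm]
  · exact Finset.sum_congr rfl fun k _ => by ring

lemma vert_sum_C_mul (a c : Fin n → MvPowerSeries (Fin n) R) (r : Fin n → R) :
    vert a (∑ k, C (r k) * c k) = ∑ k, C (r k) * vert a (c k) := by
  simp

lemma pderiv_sum_C_mul {R : Type*} [CommRing R] (l : Fin n) (c : Fin n → MvPowerSeries (Fin n) R) (r : Fin n → R) :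
    pderiv R l (∑ k, C (r k) * c k) = ∑ k, C (r k) * pderiv R l (c k) := by
  simp

/-- The commutator of two Hamiltonian fields is a Hamiltonian field of the bracket. As Π is constant
along the fibres, this needs no Jacobi identity: differentiating H_F G produces ∂a·∂G, which
`ham_swap` turns into -H_G(∂F). -/
lemma ham_vert {F G : MvPowerSeries (Fin n) R} {a b : Fin n → MvPowerSeries (Fin n) R}
    (hF : L.Ham F a) (hG : L.Ham G b) :
    L.Ham (vert a G) (fun k => vert a (b k) - vert b (a k)) := by
  intro l
  rw [pderiv_vert, hG l, vert_sum_C_mul, L.ham_swap hG]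
  have h : ∀ k, b k * ∑ j, C (L.π k j) * pderiv R l (a j) = b k * pderiv R k (pderiv R l F) := by
    intro k
    rw [pderiv_comm, hF k, pderiv_sum_C_mul]
  simp only [h]
  rw [← vert_apply, hF l, vert_sum_C_mul]
  simp [mul_sub]
  ring

lemma nabla_sum_C_mul (i : Fin n) (c : Fin n → MvPowerSeries (Fin n) R) (r : Fin n → R) :
    L.nabla i (∑ k, C (r k) * c k) =
      ∑ k, C (r k) * L.nabla i (c k) + ∑ k, C (∑ s, L.π i s * L.δ s (r k)) * c k := by
  simp only [map_sum, Derivation.leibniz, smul_eq_mul, nabla_C, Finset.sum_add_distrib]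
  congr 1
  exact Finset.sum_congr rfl fun k _ => mul_comm _ _

lemma pderiv_nabla (i l : Fin n) (F : MvPowerSeries (Fin n) R) :
    pderiv R l (L.nabla i F) =
      L.nabla i (pderiv R l F) + ∑ k, C (L.Γ i l k) * pderiv R k F := by
  simp only [nabla_apply, map_add, map_sum, Derivation.leibniz, smul_eq_mul, pderiv_C, mul_zero,
    add_zero, coeffDerivation_pderiv, pderiv_christoffel, Finset.sum_add_distrib, add_assoc]
  congr 2
  · exact Finset.sum_congr rfl fun k _ => by rw [pderiv_comm]
  · exact Finset.sum_congr rfl fun k _ => mul_comm _ _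

/-- Because Π is parallel, ∇̄ preserves Hamiltonian functions; the coefficients are those of the
commutator of ∇̄^i with H_F. -/
lemma ham_nabla (i : Fin n) {F : MvPowerSeries (Fin n) R} {a : Fin n → MvPowerSeries (Fin n) R}
    (hF : L.Ham F a) :
    L.Ham (L.nabla i F) (fun k => L.nabla i (a k) - ∑ s, a s * C (L.Γ i s k)) := by
  intro l
  rw [pderiv_nabla, hF l, nabla_sum_C_mul]
  simp only [hF _, mul_sub, Finset.sum_sub_distrib]
  have h := fun k => congrArg (C (σ := Fin n)) (L.parallel i l k)
  simp only [map_sum, map_add, map_mul, Finset.sum_add_distrib, map_zero] at h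
  have h1 : ∑ k, C (L.Γ i l k) * ∑ s, C (L.π k s) * a s =
      ∑ s, (∑ k, C (L.Γ i l k) * C (L.π k s)) * a s := by
    simp only [Finset.mul_sum, Finset.sum_mul]
    rw [Finset.sum_comm]
    exact Finset.sum_congr rfl fun _ _ => Finset.sum_congr rfl fun _ _ => by ring
  have h2 : ∑ k, C (L.π l k) * ∑ s, a s * C (L.Γ i s k) =
      ∑ s, (∑ k, C (L.π l k) * C (L.Γ i s k)) * a s := by
    simp only [Finset.mul_sum, Finset.sum_mul]
    rw [Finset.sum_comm]
    exact Finset.sum_congr rfl fun _ _ => Finset.sum_congr rfl fun _ _ => by ring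
  rw [h1, h2, sub_eq_add_neg, add_assoc]
  congr 1
  rw [eq_neg_iff_add_eq_zero, ← Finset.sum_add_distrib, ← Finset.sum_add_distrib]
  refine Finset.sum_eq_zero fun s _ => ?_
  simp only [map_sum, map_mul]
  linear_combination a s * h s

/-- The curvature `[∇̄^i, ∇̄^j] - ∇̄^{[dx^i, dx^j]}`. -/
def curv (i j : Fin n) : Derivation ℝ (MvPowerSeries (Fin n) R) (MvPowerSeries (Fin n) R) :=
  ⁅L.nabla i, L.nabla j⁆ - ∑ s, (C (L.δ s (L.π i j)) : MvPowerSeries (Fin n) R) • L.nabla s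

lemma curv_apply (i j : Fin n) (F : MvPowerSeries (Fin n) R) :
    L.curv i j F = L.nabla i (L.nabla j F) - L.nabla j (L.nabla i F)
      - ∑ s, C (L.δ s (L.π i j)) * L.nabla s F := by
  rw [curv, Derivation.sub_apply, sum_smul_apply, Derivation.commutator_apply]

/-- The anchor # is a morphism of Lie brackets. Second derivatives cancel by symmetry, and the
first-order terms by the Jacobi identity. -/
lemma commutator_base (i j : Fin n) (r : R) :
    ∑ s, L.π i s * L.δ s (∑ t, L.π j t * L.δ t r) - ∑ s, L.π j s * L.δ s (∑ t, L.π i t * L.δ t r) =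
      ∑ s, L.δ s (L.π i j) * ∑ t, L.π s t * L.δ t r := by
  have h1 : ∀ i j, ∑ s, L.π i s * L.δ s (∑ t, L.π j t * L.δ t r) =
      ∑ t, (∑ s, L.π i s * L.δ s (L.π j t)) * L.δ t r
        + ∑ s, ∑ t, L.π i s * L.π j t * L.δ s (L.δ t r) := by
    intro i j
    have e : ∑ t, (∑ s, L.π i s * L.δ s (L.π j t)) * L.δ t r =
        ∑ s, ∑ t, L.π i s * L.δ s (L.π j t) * L.δ t r := by
      simp only [Finset.sum_mul]
      rw [Finset.sum_comm]
    rw [e]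
    simp only [map_sum, Derivation.leibniz, smul_eq_mul, Finset.mul_sum]
    rw [← Finset.sum_add_distrib]
    refine Finset.sum_congr rfl fun s _ => ?_
    rw [← Finset.sum_add_distrib]
    exact Finset.sum_congr rfl fun t _ => by ring
  have h2 : ∑ s, ∑ t, L.π i s * L.π j t * L.δ s (L.δ t r) =
      ∑ s, ∑ t, L.π j s * L.π i t * L.δ s (L.δ t r) := by
    rw [Finset.sum_comm]
    exact Finset.sum_congr rfl fun s _ => Finset.sum_congr rfl fun t _ => by
      rw [L.δ_comm]; ring
  have h3 : ∑ s, L.δ s (L.π i j) * ∑ t, L.π s t * L.δ t r =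
      ∑ t, (∑ s, L.δ s (L.π i j) * L.π s t) * L.δ t r := by
    simp only [Finset.mul_sum, Finset.sum_mul]
    rw [Finset.sum_comm]
    exact Finset.sum_congr rfl fun s _ => Finset.sum_congr rfl fun t _ => by ring
  rw [h1, h1, h2, h3, add_sub_add_right_eq_sub, ← Finset.sum_sub_distrib]
  refine Finset.sum_congr rfl fun t _ => ?_
  rw [← sub_mul]
  congr 1
  have h4 := L.jacobi i j t
  simp only [Finset.sum_add_distrib] at h4
  have h5 : ∑ s, L.π j s * L.δ s (L.π t i) = - ∑ s, L.π j s * L.δ s (L.π i t) := by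
    rw [← Finset.sum_neg_distrib]
    exact Finset.sum_congr rfl fun s _ => by rw [L.skew t i, map_neg]; ring
  have h6 : ∑ s, L.δ s (L.π i j) * L.π s t = - ∑ s, L.π t s * L.δ s (L.π i j) := by
    rw [← Finset.sum_neg_distrib]
    exact Finset.sum_congr rfl fun s _ => by rw [L.skew s t]; ring
  rw [h6]
  rw [h5] at h4
  linear_combination h4

-- By `commutator_base` no base derivative survives in the curvature, so it is vertical and
-- `R`-linear.
@[simp] lemma curv_C (i j : Fin n) (r : R) : L.curv i j (C r) = 0 := by
  simp only [curv_apply, nabla_C, ← map_mul, ← map_sum, ← map_sub]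
  rw [commutator_base, sub_self, map_zero]

lemma curv_C_mul (i j : Fin n) (r : R) (F : MvPowerSeries (Fin n) R) :
    L.curv i j (C r * F) = C r * L.curv i j F := by
  simp

/-- The coefficients of the curvature, which is linear in the fibre coordinates. -/
def curvCoeff (i j l k : Fin n) : R :=
  ∑ t, (L.π i t * L.δ t (L.Γ j l k) - L.π j t * L.δ t (L.Γ i l k) + L.Γ j t k * L.Γ i l t
    - L.Γ i t k * L.Γ j l t - L.δ t (L.π i j) * L.Γ t l k)

lemma curv_X (i j k : Fin n) : L.curv i j (X k) = ∑ l, C (L.curvCoeff i j l k) * X l := by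
  have h : ∀ i j, L.nabla i (L.christoffel j k) =
      ∑ l, C (∑ t, (L.π i t * L.δ t (L.Γ j l k) + L.Γ j t k * L.Γ i l t)) * X l := by
    intro i j
    rw [christoffel, nabla_sum_C_mul]
    simp only [nabla_X, christoffel, Finset.sum_add_distrib, map_add, add_mul, Finset.mul_sum,
      map_sum, Finset.sum_mul]
    rw [add_comm, Finset.sum_comm (f := fun t l => C (L.Γ j t k) * _)]
    congr 1
    exact Finset.sum_congr rfl fun _ _ => Finset.sum_congr rfl fun _ _ => by rw [map_mul]; ring
  rw [curv_apply, nabla_X, nabla_X, h, h]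
  simp only [nabla_X, christoffel, Finset.mul_sum]
  rw [Finset.sum_comm (f := fun t l => C (L.δ t (L.π i j)) * _), ← Finset.sum_sub_distrib,
    ← Finset.sum_sub_distrib]
  refine Finset.sum_congr rfl fun l _ => ?_
  simp only [← mul_assoc, ← Finset.sum_mul, ← map_mul, ← map_sum, ← sub_mul, ← map_sub]
  congr 2
  rw [curvCoeff, ← Finset.sum_sub_distrib, ← Finset.sum_sub_distrib]
  exact Finset.sum_congr rfl fun _ _ => by ring

/-- `π^{lk} ξ_k`. -/
def moment (l : Fin n) : MvPowerSeries (Fin n) R := ∑ k, C (L.π l k) * X k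

/-- This is parallelism contracted with ξ: the functions π^{lk}ξ_k transform under ∇̄ as the forms
dx^l do under ∇. -/
lemma nabla_moment (i l : Fin n) : L.nabla i (L.moment l) = - ∑ s, C (L.Γ i l s) * L.moment s := by
  have h := fun k => congrArg (C (σ := Fin n)) (L.parallel i l k)
  simp only [map_sum, map_add, map_mul, Finset.sum_add_distrib, map_zero] at h
  rw [moment, nabla_sum_C_mul, eq_neg_iff_add_eq_zero]
  simp only [nabla_X, christoffel, moment]
  have h1 : ∑ k, C (L.Γ i l k) * ∑ s, C (L.π k s) * X (R := R) s =
      ∑ s, (∑ k, C (L.Γ i l k) * C (L.π k s)) * X s := by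
    simp only [Finset.mul_sum, Finset.sum_mul]
    rw [Finset.sum_comm]
    exact Finset.sum_congr rfl fun _ _ => Finset.sum_congr rfl fun _ _ => by ring
  have h2 : ∑ k, C (L.π l k) * ∑ s, C (L.Γ i s k) * X (R := R) s =
      ∑ s, (∑ k, C (L.π l k) * C (L.Γ i s k)) * X s := by
    simp only [Finset.mul_sum, Finset.sum_mul]
    rw [Finset.sum_comm]
    exact Finset.sum_congr rfl fun _ _ => Finset.sum_congr rfl fun _ _ => by ring
  rw [h1, h2, ← Finset.sum_add_distrib, ← Finset.sum_add_distrib]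
  refine Finset.sum_eq_zero fun s _ => ?_
  simp only [map_sum, map_mul]
  linear_combination X s * h s

/-- Compared with the expansion of the left side by `R`-linearity, this says that the linear field
R(dx^i, dx^j) preserves Π, which is what makes it Hamiltonian. -/
lemma curv_moment (i j l : Fin n) :
    L.curv i j (L.moment l) = - ∑ s, C (L.curvCoeff i j l s) * L.moment s := by
  have h : ∀ i j, L.nabla i (L.nabla j (L.moment l)) =
      ∑ s, C (∑ t, (L.Γ j l t * L.Γ i t s - L.π i t * L.δ t (L.Γ j l s))) * L.moment s := by
    intro i j
    rw [nabla_moment, map_neg, nabla_sum_C_mul]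
    simp only [nabla_moment, Finset.sum_sub_distrib, map_sub, sub_mul, Finset.mul_sum, mul_neg,
      Finset.sum_neg_distrib, map_sum, Finset.sum_mul]
    rw [neg_add, neg_neg, Finset.sum_comm, sub_eq_add_neg]
    congr 1
    exact Finset.sum_congr rfl fun _ _ => Finset.sum_congr rfl fun _ _ => by rw [map_mul]; ring
  rw [curv_apply, h, h]
  simp only [nabla_moment, mul_neg, Finset.sum_neg_distrib, Finset.mul_sum]
  rw [Finset.sum_comm (f := fun t l => C (L.δ t (L.π i j)) * _), ← Finset.sum_sub_distrib,
    sub_neg_eq_add, ← Finset.sum_add_distrib, ← Finset.sum_neg_distrib]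
  refine Finset.sum_congr rfl fun s _ => ?_
  simp only [← mul_assoc, ← Finset.sum_mul, ← map_mul, ← map_sum, ← sub_mul, ← map_sub, ← neg_mul,
    ← map_neg, ← add_mul, ← map_add]
  congr 2
  rw [curvCoeff, ← Finset.sum_sub_distrib, ← Finset.sum_add_distrib, ← Finset.sum_neg_distrib]
  exact Finset.sum_congr rfl fun _ _ => by ring

/-- `Q̄(dx^i, dx^j) = ½ Ω(𝓔, R(dx^i, dx^j))`. -/
def q (i j : Fin n) : MvPowerSeries (Fin n) R :=
  (1 / 2 : ℝ) • ∑ s, ∑ k, C (L.π s k) * (X s * L.curv i j (X k))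

/-- A linear field preserving a constant bivector has a quadratic Hamiltonian. Differentiating the
contraction with the Euler field gives two terms, equal by `curv_moment`, whence the factor ½. -/
lemma ham_q (i j : Fin n) : L.Ham (L.q i j) (fun k => L.curv i j (X k)) := by
  classical
  intro l
  have h1 : ∑ s, ∑ k, C (L.π s k) * (X s * L.curv i j (X k)) =
      - ∑ k, L.moment k * L.curv i j (X k) := by
    rw [Finset.sum_comm, ← Finset.sum_neg_distrib]
    refine Finset.sum_congr rfl fun k _ => ?_
    rw [moment, Finset.sum_mul, ← Finset.sum_neg_distrib]
    exact Finset.sum_congr rfl fun s _ => by rw [L.C_skew s k]; ring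
  have h2 : ∀ k, pderiv R l (L.moment k) = C (L.π k l) := by
    intro k
    rw [moment, pderiv_sum_C_mul, Finset.sum_eq_single l]
    · simp
    · intro j _ hj
      simp [pderiv_X_of_ne hj]
    · simp
  have h3 : ∀ k, pderiv R l (L.curv i j (X k)) = C (L.curvCoeff i j l k) := by
    intro k
    rw [curv_X, pderiv_sum_C_mul, Finset.sum_eq_single l]
    · simp
    · intro j _ hj
      simp [pderiv_X_of_ne hj]
    · simp
  have h4 : L.curv i j (L.moment l) = ∑ k, C (L.π l k) * L.curv i j (X k) := by
    rw [moment, map_sum]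
    exact Finset.sum_congr rfl fun k _ => L.curv_C_mul _ _ _ _
  have h5 : pderiv R l (∑ s, ∑ k, C (L.π s k) * (X s * L.curv i j (X k))) =
      (2 : ℝ) • ∑ k, C (L.π l k) * L.curv i j (X k) := by
    rw [h1, map_neg, map_sum]
    simp only [Derivation.leibniz, smul_eq_mul, h2, h3, Finset.sum_add_distrib]
    rw [two_smul, neg_add]
    congr 1
    · rw [← h4, curv_moment]
      congr 1
      exact Finset.sum_congr rfl fun k _ => mul_comm _ _
    · rw [← Finset.sum_neg_distrib]
      exact Finset.sum_congr rfl fun k _ => by rw [L.C_skew k l]; ring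
  -- `pderiv` is `R`-linear, so the real scalar ½ is passed through `R`.
  rw [q, ← (algebraMap_smul R (1 / 2 : ℝ) (_ : MvPowerSeries (Fin n) R)), Derivation.map_smul, h5,
    algebraMap_smul, smul_smul]
  norm_num

end LocalModel
end LocalModel

/-! ### The ξ-adic filtration, fixed points, and matrices congruent to the identity. -/

section Vanish

open MvPowerSeries

variable {n : ℕ} {R : Type*} [CommRing R]

/-- All coefficients of degree `< N` of `F` are zero. -/
def VanishTo (N : ℕ) (F : MvPowerSeries (Fin n) R) : Prop :=
  ∀ m : Fin n →₀ ℕ, m.degree < N → coeff m F = 0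

namespace VanishTo

variable {N : ℕ} {F G : MvPowerSeries (Fin n) R}

lemma zero_left : VanishTo 0 F := fun _ h => by omega

lemma mono {N' : ℕ} (h : N ≤ N') (hF : VanishTo N' F) : VanishTo N F := fun m hm =>
  hF m (hm.trans_le h)

lemma add (hF : VanishTo N F) (hG : VanishTo N G) : VanishTo N (F + G) := fun m hm => by
  rw [map_add, hF m hm, hG m hm, add_zero]

lemma neg (hF : VanishTo N F) : VanishTo N (-F) := fun m hm => by
  rw [map_neg, hF m hm, neg_zero]

lemma sub (hF : VanishTo N F) (hG : VanishTo N G) : VanishTo N (F - G) := fun m hm => by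
  rw [map_sub, hF m hm, hG m hm, sub_zero]

lemma sum {ι : Type*} {t : Finset ι} {F : ι → MvPowerSeries (Fin n) R}
    (h : ∀ i ∈ t, VanishTo N (F i)) : VanishTo N (∑ i ∈ t, F i) := fun m hm => by
  rw [map_sum]
  exact Finset.sum_eq_zero fun i hi => h i hi m hm

lemma mul_left (A : MvPowerSeries (Fin n) R) (hF : VanishTo N F) : VanishTo N (A * F) := by
  classical
  intro m hm
  rw [coeff_mul]
  refine Finset.sum_eq_zero fun p hp => ?_
  rw [Finset.HasAntidiagonal.mem_antidiagonal] at hp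
  have h2 : p.1.degree + p.2.degree = m.degree := by rw [← hp, map_add]
  rw [hF p.2 (by omega), mul_zero]

lemma mul_of_constantCoeff {A : MvPowerSeries (Fin n) R} (hA : constantCoeff A = 0)
    (hF : VanishTo N F) : VanishTo (N + 1) (A * F) := by
  classical
  intro m hm
  rw [coeff_mul]
  refine Finset.sum_eq_zero fun p hp => ?_
  rw [Finset.HasAntidiagonal.mem_antidiagonal] at hp
  have h2 : p.1.degree + p.2.degree = m.degree := by rw [← hp, map_add]
  rcases eq_or_ne p.1 0 with h0 | h0
  · rw [h0, coeff_zero_eq_constantCoeff_apply, hA, zero_mul]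
  · have h1 : p.1.degree ≠ 0 := by simpa [Finsupp.degree_eq_zero_iff] using h0
    rw [hF p.2 (by omega), mul_zero]

lemma pderiv (k : Fin n) (hF : VanishTo (N + 1) F) : VanishTo N (pderiv R k F) := fun m hm => by
  rw [coeff_pderiv, hF _ (by simpa [map_add] using hm), zero_mul]

/-- The order lost by differentiating is regained from the factor without constant term. -/
lemma mul_pderiv {A : MvPowerSeries (Fin n) R} (hA : constantCoeff A = 0) (k : Fin n)
    (hF : VanishTo N F) : VanishTo N (A * MvPowerSeries.pderiv R k F) := by
  rcases N with _ | N
  · exact zero_left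
  · exact (hF.pderiv k).mul_of_constantCoeff hA

lemma eq_zero (h : ∀ N, VanishTo N F) : F = 0 := by
  ext m
  exact h (m.degree + 1) m (Nat.lt_succ_self _)

variable [Algebra ℝ R]

lemma coeffDerivation (δ : Derivation ℝ R R) (hF : VanishTo N F) :
    VanishTo N (coeffDerivation δ F) := fun m hm => by
  rw [coeff_coeffDerivation, hF m hm, map_zero]

end VanishTo

lemma coeff_sum_X_mul_pderiv (F : MvPowerSeries (Fin n) R) (m : Fin n →₀ ℕ) :
    coeff m (∑ k, X k * pderiv R k F) = (m.degree : R) * coeff m F := by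
  classical
  have h : ∀ k, coeff m (X k * pderiv R k F) = (m k : R) * coeff m F := by
    intro k
    rw [mul_comm, X_def, coeff_mul_monomial, mul_one]
    by_cases hk : Finsupp.single k 1 ≤ m
    · obtain ⟨m', rfl⟩ := exists_add_of_le hk
      rw [if_pos hk, add_tsub_cancel_left, coeff_pderiv, add_comm (Finsupp.single k 1)]
      simp [mul_comm]
    · have : m k = 0 := by
        by_contra h0
        exact hk (by simpa [Finsupp.single_le_iff] using Nat.one_le_iff_ne_zero.2 h0)
      rw [if_neg hk, this]
      simp
  rw [map_sum]
  simp only [h]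
  rw [← Finset.sum_mul, Finsupp.degree_eq_sum]
  push_cast
  rfl

/-- A self-map of the formal power series which raises the order of agreement has a fixed point. -/
lemma exists_fixedPoint (T : MvPowerSeries (Fin n) R → MvPowerSeries (Fin n) R)
    (hT : ∀ N F G, VanishTo N (F - G) → VanishTo (N + 1) (T F - T G)) : ∃ F, T F = F := by
  -- The iterates of 0 form a Cauchy sequence: from the N-th one on, the coefficients of degree
  -- below N are frozen.
  have h1 : ∀ N j, VanishTo N (T^[N + j] 0 - T^[N] 0) := by
    intro N
    induction N with
    | zero => exact fun j => VanishTo.zero_left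
    | succ N ih =>
      intro j
      have := hT N _ _ (ih j)
      rwa [← Function.iterate_succ_apply' T, ← Function.iterate_succ_apply' T,
        show (N + j).succ = N + 1 + j by omega] at this
  -- After |m| + 1 iterations the coefficient at m no longer changes.
  let F : MvPowerSeries (Fin n) R := fun m => coeff m (T^[m.degree + 1] 0)
  have h2 : ∀ N, VanishTo N (T^[N] 0 - F) := by
    intro N m hm
    rw [map_sub]
    change _ - coeff m (T^[m.degree + 1] 0) = 0
    have := h1 (m.degree + 1) (N - (m.degree + 1)) m (by omega)
    rwa [show m.degree + 1 + (N - (m.degree + 1)) = N by omega, map_sub] at this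
  refine ⟨F, sub_eq_zero.1 (VanishTo.eq_zero fun N => ?_)⟩
  have h3 := hT N _ _ (h2 N)
  rw [← Function.iterate_succ_apply' T] at h3
  -- Both F and T F agree with the iterate number N + 1, to orders N + 1.
  have h4 := (h2 (N + 1)).sub h3
  rw [sub_sub_sub_cancel_left] at h4
  exact h4.mono (Nat.le_succ N)

lemma natCast_mul_eq_zero [Algebra ℝ R] {k : ℕ} (hk : k ≠ 0) {r : R} (h : (k : R) * r = 0) :
    r = 0 := by
  have h1 : (k : ℝ) • r = 0 := by rw [Algebra.smul_def, map_natCast, h]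
  have h2 := congrArg (fun y => (k : ℝ)⁻¹ • y) h1
  simpa [smul_smul, hk] using h2

/-- By Euler's identity |m| F_m is a coefficient of ∑ X_k ∂_kF, and |m| is invertible in a real
algebra unless m = 0. -/
lemma VanishTo.of_pderiv [Algebra ℝ R] {N : ℕ} {F : MvPowerSeries (Fin n) R}
    (h0 : constantCoeff F = 0) (h : ∀ k, VanishTo N (MvPowerSeries.pderiv R k F)) :
    VanishTo (N + 1) F := by
  intro m hm
  by_cases hm0 : m.degree = 0
  · have : m = 0 := by simpa [Finsupp.degree_eq_zero_iff] using hm0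
    rw [this, coeff_zero_eq_constantCoeff_apply, h0]
  · have h1 : VanishTo (N + 1) (∑ k, X k * MvPowerSeries.pderiv R k F) :=
      VanishTo.sum fun k _ => (h k).mul_of_constantCoeff (by simp)
    have h2 := h1 m hm
    rw [coeff_sum_X_mul_pderiv] at h2
    exact natCast_mul_eq_zero hm0 h2

/-- A power series is a unit once its constant term is, and here the constant term of the
determinant is det 1. -/
lemma isUnit_det_of_constantCoeff {W : Matrix (Fin n) (Fin n) (MvPowerSeries (Fin n) R)}
    (h : ∀ i k, constantCoeff (W i k) = if i = k then 1 else 0) : IsUnit W.det := by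
  rw [isUnit_iff_constantCoeff, RingHom.map_det]
  have : (constantCoeff (σ := Fin n) (R := R)).mapMatrix W = 1 := by
    ext i k
    simp [h, Matrix.one_apply]
  rw [this, Matrix.det_one]
  exact isUnit_one

lemma constantCoeff_inv {W : Matrix (Fin n) (Fin n) (MvPowerSeries (Fin n) R)}
    (h : ∀ i k, constantCoeff (W i k) = if i = k then 1 else 0) (i k : Fin n) :
    constantCoeff (W⁻¹ i k) = if i = k then 1 else 0 := by
  have h1 : (constantCoeff (σ := Fin n) (R := R)).mapMatrix W = 1 := by
    ext i k
    simp [h, Matrix.one_apply]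
  have h2 := congrArg (constantCoeff (σ := Fin n) (R := R)).mapMatrix
    (Matrix.mul_nonsing_inv W (isUnit_det_of_constantCoeff h))
  rw [map_mul, h1, one_mul, map_one] at h2
  have h3 := congrFun (congrFun h2 i) k
  simpa [Matrix.one_apply] using h3

end Vanish

/-! ### The system over the local model: involutivity, existence, uniqueness, brackets. -/

section LocalModel

open MvPowerSeries

namespace LocalModel

variable {n : ℕ} {R : Type*} [CommRing R] [Algebra ℝ R] {L : LocalModel n R}

lemma Ham.add {F G : MvPowerSeries (Fin n) R} {a b : Fin n → MvPowerSeries (Fin n) R}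
    (hF : L.Ham F a) (hG : L.Ham G b) : L.Ham (F + G) (fun k => a k + b k) := by
  intro l
  rw [map_add, hF l, hG l, ← Finset.sum_add_distrib]
  exact Finset.sum_congr rfl fun k _ => by ring

lemma Ham.sub {F G : MvPowerSeries (Fin n) R} {a b : Fin n → MvPowerSeries (Fin n) R}
    (hF : L.Ham F a) (hG : L.Ham G b) : L.Ham (F - G) (fun k => a k - b k) := by
  intro l
  rw [map_sub, hF l, hG l, ← Finset.sum_sub_distrib]
  exact Finset.sum_congr rfl fun k _ => by ring

lemma Ham.sum {ι : Type*} (t : Finset ι) (r : ι → R) {F : ι → MvPowerSeries (Fin n) R}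
    {a : ι → Fin n → MvPowerSeries (Fin n) R} (hF : ∀ s, L.Ham (F s) (a s)) :
    L.Ham (∑ s ∈ t, C (r s) * F s) (fun k => ∑ s ∈ t, C (r s) * a s k) := by
  intro l
  simp only [map_sum, Derivation.leibniz, pderiv_C, smul_eq_mul, hF _ l, Finset.mul_sum, mul_zero,
    add_zero]
  rw [Finset.sum_comm]
  exact Finset.sum_congr rfl fun k _ => Finset.sum_congr rfl fun s _ => by ring

/-- A solution of the Fundamental Equation over a local model, given by its potentials. -/
structure Potential (L : LocalModel n R) where
  /-- the potentials `u_k` -/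
  u : Fin n → MvPowerSeries (Fin n) R
  /-- the potentials `v^i_k` -/
  v : Fin n → Fin n → MvPowerSeries (Fin n) R
  agree : ∀ i j, ∑ s, C (L.π i s) * v j s = ∑ s, C (L.π j s) * pderiv R i (u s)
  u_mod : ∀ i k, constantCoeff (pderiv R i (u k)) = - if i = k then 1 else 0
  v_mod : ∀ i k, constantCoeff (v i k) = if i = k then 1 else 0
  fundamental : ∀ i j, C (L.π i j) = L.q i j - L.nabla i (∑ k, C (L.π j k) * u k)
    + L.nabla j (∑ k, C (L.π i k) * u k)
    + ∑ s, C (L.δ s (L.π i j)) * (∑ k, C (L.π s k) * u k)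
    + vert (v i) (∑ k, C (L.π j k) * u k)

namespace Potential

variable (p : Potential L)

lemma ham (i : Fin n) : L.Ham (∑ k, C (L.π i k) * p.u k) (p.v i) := by
  intro l
  rw [pderiv_sum_C_mul, p.agree]

/-- The derivation `F ↦ {U(dx^i), F} - ∇̄^{dx^i} F`. -/
def op (i : Fin n) : Derivation ℝ (MvPowerSeries (Fin n) R) (MvPowerSeries (Fin n) R) :=
  vert (p.v i) - L.nabla i

lemma op_apply (i : Fin n) (F : MvPowerSeries (Fin n) R) :
    p.op i F = vert (p.v i) F - L.nabla i F := rfl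

/-- The vertical part `v - Γ ξ` of the operators `op`. -/
def W : Matrix (Fin n) (Fin n) (MvPowerSeries (Fin n) R) := fun i k => p.v i k - L.christoffel i k

/-- The transposed counterpart of `W` under the Poisson tensor. -/
def W' : Matrix (Fin n) (Fin n) (MvPowerSeries (Fin n) R) := fun k s =>
  - pderiv R s (p.u k) + ∑ j, C (L.Γ' s j k) * X j

variable (L) in
/-- The matrix of the Poisson tensor. -/
def Pi : Matrix (Fin n) (Fin n) (MvPowerSeries (Fin n) R) := fun i k => C (L.π i k)

/-- The v-part is the identity `agree` and the Γ-part is the association of the connections, each up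
to the skewness of Π. The relation allows W⁻¹Π to be rewritten with Π on the left. -/
lemma W_mul_Pi : p.W * Pi L = Pi L * p.W' := by
  ext1 i s
  simp only [Matrix.mul_apply, W, W', Pi, sub_mul, mul_add, Finset.sum_sub_distrib,
    Finset.sum_add_distrib, mul_neg, Finset.sum_neg_distrib]
  rw [sub_eq_add_neg]
  congr 1
  · rw [← p.agree s i, ← Finset.sum_neg_distrib]
    exact Finset.sum_congr rfl fun k _ => by rw [L.C_skew s k]; ring
  · simp only [christoffel, Finset.sum_mul, Finset.mul_sum]
    rw [Finset.sum_comm, Finset.sum_comm (γ := Fin n) (f := fun k j => C (L.π i k) * _),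
      ← Finset.sum_neg_distrib]
    refine Finset.sum_congr rfl fun j _ => ?_
    have h := congrArg (C (σ := Fin n)) (L.assoc s i j)
    simp only [map_sum, map_mul] at h
    have h1 : ∑ k, C (L.Γ i j k) * X (R := R) j * C (L.π k s) =
        - ((∑ l, C (L.Γ i j l) * C (L.π s l)) * X j) := by
      rw [Finset.sum_mul, ← Finset.sum_neg_distrib]
      exact Finset.sum_congr rfl fun k _ => by rw [L.C_skew k s]; ring
    rw [h1, neg_neg, ← h, Finset.sum_mul]
    exact Finset.sum_congr rfl fun k _ => by ring

lemma constantCoeff_W (i k : Fin n) : constantCoeff (p.W i k) = if i = k then 1 else 0 := by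
  simp [W, christoffel, p.v_mod]

lemma constantCoeff_W' (i k : Fin n) : constantCoeff (p.W' i k) = if i = k then 1 else 0 := by
  simp [W', p.u_mod, eq_comm]

lemma W_inv_mul : p.W⁻¹ * p.W = 1 :=
  Matrix.nonsing_inv_mul _ (isUnit_det_of_constantCoeff p.constantCoeff_W)

lemma W_inv_mul_Pi : p.W⁻¹ * Pi L = Pi L * p.W'⁻¹ := by
  have h' := Matrix.mul_nonsing_inv _ (isUnit_det_of_constantCoeff p.constantCoeff_W')
  calc p.W⁻¹ * Pi L = p.W⁻¹ * (Pi L * p.W') * p.W'⁻¹ := by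
        rw [Matrix.mul_assoc, Matrix.mul_assoc, h', Matrix.mul_one]
    _ = Pi L * p.W'⁻¹ := by
        rw [← W_mul_Pi, ← Matrix.mul_assoc, W_inv_mul, Matrix.one_mul]

variable (L) in
/-- The gradient in the base directions. -/
def baseGrad (F : MvPowerSeries (Fin n) R) : Fin n → MvPowerSeries (Fin n) R := fun s => L.base s F

/-- The gradient in the fibre directions. -/
def fibreGrad (F : MvPowerSeries (Fin n) R) : Fin n → MvPowerSeries (Fin n) R :=
  fun s => pderiv R s F

open Matrix in
lemma op_eq (F : MvPowerSeries (Fin n) R) :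
    (fun i => p.op i F) = p.W *ᵥ fibreGrad F - Pi L *ᵥ baseGrad L F := by
  funext i
  simp only [op_apply, vert_apply, nabla_apply, Pi.sub_apply, Matrix.mulVec, dotProduct, W, Pi,
    fibreGrad, baseGrad, sub_mul, Finset.sum_sub_distrib]
  ring

-- `op_eq` is solved for the fibre gradient; for a solution of the system only the term in base
-- derivatives remains.
open Matrix in
lemma fibreGrad_eq (F : MvPowerSeries (Fin n) R) :
    fibreGrad F = p.W⁻¹ *ᵥ (fun i => p.op i F) + (p.W⁻¹ * Pi L) *ᵥ baseGrad L F := by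
  rw [op_eq, Matrix.mulVec_sub, Matrix.mulVec_mulVec, Matrix.mulVec_mulVec, W_inv_mul,
    Matrix.one_mulVec, sub_add_cancel]

-- The fibre gradient of a solution is W⁻¹Π∂_xF = ΠW'⁻¹∂_xF, visibly in the image of Π. This is why
-- solutions belong to 𝓗_Ω.
open Matrix in
lemma exists_ham {F : MvPowerSeries (Fin n) R} (hF : ∀ i, p.op i F = 0) :
    L.Ham F (p.W'⁻¹ *ᵥ baseGrad L F) := by
  intro l
  have h := p.fibreGrad_eq F
  have h0 : (fun i => p.op i F) = 0 := funext hF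
  rw [h0, Matrix.mulVec_zero, zero_add, W_inv_mul_Pi, ← Matrix.mulVec_mulVec] at h
  exact congrFun h l

/-- The curvature of the operators `op`. -/
def opCurv (i j : Fin n) : Derivation ℝ (MvPowerSeries (Fin n) R) (MvPowerSeries (Fin n) R) :=
  -- On functions of x, `op i` acts as minus the anchor of dx^i; hence the plus sign of the bracket
  -- term.
  ⁅p.op i, p.op j⁆ + ∑ s, (C (L.δ s (L.π i j)) : MvPowerSeries (Fin n) R) • p.op s

lemma opCurv_apply (i j : Fin n) (F : MvPowerSeries (Fin n) R) :
    p.opCurv i j F = p.op i (p.op j F) - p.op j (p.op i F)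
      + ∑ s, C (L.δ s (L.π i j)) * p.op s F := by
  rw [opCurv, Derivation.add_apply, sum_smul_apply, Derivation.commutator_apply]

@[simp] lemma op_C (i : Fin n) (r : R) : p.op i (C r) = - C (∑ s, L.π i s * L.δ s r) := by
  rw [op_apply, vert_C, nabla_C, zero_sub]

lemma opCurv_C (i j : Fin n) (r : R) : p.opCurv i j (C r) = 0 := by
  rw [opCurv_apply]
  simp only [op_C, map_neg, neg_neg, mul_neg, Finset.sum_neg_distrib, ← map_mul, ← map_sum]
  rw [← map_sub, commutator_base]
  simp

/-- This is the fibrewise derivative of the Fundamental Equation. The terms on its right have known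
Hamiltonian fields, which add up to the curvature of the operators, and its left side is constant
along the fibres. So the curvature lies in the kernel of Π, though it need not vanish. -/
lemma ham_opCurv (i j : Fin n) : L.Ham 0 (fun k => p.opCurv i j (X k)) := by
  have h := ((((L.ham_q i j).sub (L.ham_nabla i (p.ham j))).add (L.ham_nabla j (p.ham i))).add
    (Ham.sum Finset.univ (fun s => L.δ s (L.π i j)) p.ham)).add (L.ham_vert (p.ham i) (p.ham j))
  rw [← p.fundamental] at h
  intro l
  have h1 := h l
  rw [pderiv_C] at h1
  rw [map_zero, h1]
  refine Finset.sum_congr rfl fun k _ => ?_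
  congr 1
  dsimp only
  have h2 : ∀ i j, vert (p.v i) (L.christoffel j k) = ∑ s, p.v i s * C (L.Γ j s k) := by
    intro i j
    rw [vert_apply]
    simp only [pderiv_christoffel]
  rw [curv_apply, opCurv_apply]
  simp only [op_apply, vert_X, nabla_X, map_sub, h2, mul_sub, Finset.sum_sub_distrib]
  ring

-- Involutivity. The curvature is vertical with coefficients annihilated by Π, so in ∂_ξF = W⁻¹ op F
-- + ΠW'⁻¹∂_xF the second summand does not contribute.
open Matrix in
lemma opCurv_eq (i j : Fin n) (F : MvPowerSeries (Fin n) R) :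
    p.opCurv i j F = (fun k => p.opCurv i j (X k)) ⬝ᵥ p.W⁻¹ *ᵥ (fun i => p.op i F) := by
  have h : p.opCurv i j F = (fun k => p.opCurv i j (X k)) ⬝ᵥ fibreGrad F :=
    eq_vert (p.opCurv_C i j) F
  have h0 : (fun k => p.opCurv i j (X k)) ᵥ* Pi L = 0 := by
    funext l
    have := p.ham_opCurv i j l
    rw [map_zero] at this
    rw [Pi.zero_apply, ← neg_eq_zero, this]
    simp only [vecMul, dotProduct, Pi]
    rw [← Finset.sum_neg_distrib]
    exact Finset.sum_congr rfl fun k _ => by rw [L.C_skew k l]; ring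
  rw [h, p.fibreGrad_eq F, dotProduct_add, W_inv_mul_Pi, ← Matrix.mulVec_mulVec,
    dotProduct_mulVec _ (Pi L), h0, zero_dotProduct, add_zero]

lemma vanishTo_mulVec {R : Type*} [CommRing R] {N : ℕ} (A : Matrix (Fin n) (Fin n) (MvPowerSeries (Fin n) R))
    {g : Fin n → MvPowerSeries (Fin n) R} (hg : ∀ k, VanishTo N (g k)) (i : Fin n) :
    VanishTo N (A.mulVec g i) := by
  simp only [Matrix.mulVec, dotProduct]
  exact VanishTo.sum fun k _ => (hg k).mul_left _

/-- To leading order `op i` is ∂/∂ξ_i: base derivatives do not lower the order of vanishing, and W -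
1 has no constant term. -/
lemma vanishTo_op_sub {N : ℕ} {F : MvPowerSeries (Fin n) R} (hF : VanishTo N F) (i : Fin n) :
    VanishTo N (p.op i F - pderiv R i F) := by
  have h := congrFun (p.op_eq F) i
  have h1 : pderiv R i F = ((1 : Matrix _ _ _).mulVec (fibreGrad F)) i := by
    rw [Matrix.one_mulVec]; rfl
  simp only [Pi.sub_apply] at h
  rw [h, h1, sub_right_comm, ← Pi.sub_apply, ← Matrix.sub_mulVec]
  simp only [Matrix.mulVec, dotProduct]
  refine VanishTo.sub (VanishTo.sum fun k _ => VanishTo.mul_pderiv ?_ k hF)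
    (VanishTo.sum fun k _ => (hF.coeffDerivation _).mul_left _)
  rw [Matrix.sub_apply, map_sub, constantCoeff_W, Matrix.one_apply]
  split_ifs <;> simp

/-- If the difference of two solutions vanishes to order N, so do its fibre derivatives by
`vanishTo_op_sub`, and the order rises to N + 1 because the constant terms agree. -/
lemma eq_of_op_eq_zero {F G : MvPowerSeries (Fin n) R} (hF : ∀ i, p.op i F = 0)
    (hG : ∀ i, p.op i G = 0) (h : constantCoeff F = constantCoeff G) : F = G := by
  rw [← sub_eq_zero]
  refine VanishTo.eq_zero fun N => ?_
  induction N with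
  | zero => exact VanishTo.zero_left
  | succ N ih =>
    refine VanishTo.of_pderiv (by rw [map_sub, h, sub_self]) fun k => ?_
    have h1 := (p.vanishTo_op_sub ih k).neg
    rwa [map_sub, hF, hG, sub_self, zero_sub, neg_neg] at h1

open Matrix in
/-- The solution of the radial part of the system. -/
lemma exists_radial (f : R) : ∃ F : MvPowerSeries (Fin n) R, constantCoeff F = f ∧
    ∑ k, X k * pderiv R k F = ∑ k, X k * ((p.W⁻¹ * Pi L) *ᵥ baseGrad L F) k := by
  classical
  let S : MvPowerSeries (Fin n) R → MvPowerSeries (Fin n) R := fun F =>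
    ∑ k, X k * ((p.W⁻¹ * Pi L) *ᵥ baseGrad L F) k
  -- E inverts the Euler operator in positive degrees. In degree 0 the convention 0⁻¹ = 0 makes it
  -- vanish, which leaves the constant term free to be f.
  let E : MvPowerSeries (Fin n) R → MvPowerSeries (Fin n) R := fun G m =>
    (m.degree : ℝ)⁻¹ • coeff m G
  have hE : ∀ G m, coeff m (E G) = (m.degree : ℝ)⁻¹ • coeff m G := fun G m => rfl
  obtain ⟨F, hF⟩ := exists_fixedPoint (fun F => C f + E (S F)) (by
    intro N F G h m hm
    have h1 : S F - S G = S (F - G) := by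
      simp only [S, ← Finset.sum_sub_distrib, ← mul_sub]
      refine Finset.sum_congr rfl fun k _ => ?_
      rw [← Pi.sub_apply, ← Matrix.mulVec_sub]
      congr 3
      funext s
      simp [baseGrad]
    -- Coefficientwise base derivatives keep the order, and the factor ξ_k raises it by one: S is a
    -- contraction.
    have h2 : VanishTo (N + 1) (S (F - G)) := VanishTo.sum fun k _ =>
      VanishTo.mul_of_constantCoeff (by simp)
        (vanishTo_mulVec _ (fun s => h.coeffDerivation (L.δ s)) k)
    simp only [map_sub, map_add, hE]
    rw [add_sub_add_left_eq_sub, ← smul_sub, ← map_sub, h1, h2 m hm, smul_zero])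
  refine ⟨F, ?_, ?_⟩
  · rw [← coeff_zero_eq_constantCoeff_apply, ← hF, map_add, hE]
    simp
  · ext m
    rw [coeff_sum_X_mul_pderiv]
    change _ = coeff m (S F)
    by_cases hm : m = 0
    · subst hm
      simp [S]
    · have hd : (m.degree : ℝ) ≠ 0 := by simpa [Finsupp.degree_eq_zero_iff] using hm
      have h1 : coeff m F = (m.degree : ℝ)⁻¹ • coeff m (S F) := by
        conv_lhs => rw [← hF]
        rw [map_add, hE, coeff_C, if_neg hm, zero_add]
      have h2 : (m.degree : R) = algebraMap ℝ R m.degree := by simp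
      rw [h1, h2, ← Algebra.smul_def, smul_smul, mul_inv_cancel₀ hd, one_smul]

-- The radial equation is the single combination ξ·W⁻¹ op F = 0. The remaining equations follow by
-- induction on the order of op F: involutivity makes it a closed 1-form up to errors, and a closed
-- 1-form with vanishing radial part is zero.
open Matrix in
lemma exists_solution (f : R) : ∃ F : MvPowerSeries (Fin n) R, constantCoeff F = f ∧
    ∀ i, p.op i F = 0 := by
  obtain ⟨F, hf, hF⟩ := p.exists_radial f
  refine ⟨F, hf, ?_⟩
  have h0 : ∑ k, X k * (p.W⁻¹ *ᵥ (fun i => p.op i F)) k = 0 := by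
    have h := p.fibreGrad_eq F
    have h1 : ∀ k, X k * pderiv R k F = X k * (p.W⁻¹ *ᵥ (fun i => p.op i F)) k
        + X k * ((p.W⁻¹ * Pi L) *ᵥ baseGrad L F) k := fun k => by
      rw [← mul_add, ← Pi.add_apply, ← h]; rfl
    simp only [h1, Finset.sum_add_distrib] at hF
    simpa using hF
  have key : ∀ N, ∀ i, VanishTo N (p.op i F) := by
    intro N
    induction N with
    | zero => exact fun i => VanishTo.zero_left
    | succ N ih =>
      intro j
      have h1 : ∀ i, VanishTo N (pderiv R i (p.op j F) - pderiv R j (p.op i F)) := by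
        intro i
        -- By `opCurv_eq` the curvature term is as small as the op_i F themselves, so the mixed
        -- fibre derivatives of op F agree to order N.
        have h2 : VanishTo N (p.opCurv i j F) := by
          rw [opCurv_eq]
          exact VanishTo.sum fun k _ => (vanishTo_mulVec _ ih k).mul_left _
        rw [opCurv_apply] at h2
        have h3 : VanishTo N (∑ s, C (L.δ s (L.π i j)) * p.op s F) :=
          VanishTo.sum fun s _ => (ih s).mul_left _
        have h4 := ((h2.sub h3).sub (p.vanishTo_op_sub (ih j) i)).add (p.vanishTo_op_sub (ih i) j)
        convert h4 using 1
        ring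
      -- As ξ·W⁻¹ op F = 0, the radial part of op F is ξ·(1 - W⁻¹) op F. Two orders are gained, one
      -- from ξ and one from 1 - W⁻¹; one of them is spent on the derivative below.
      have h2 : VanishTo (N + 2) (∑ k, X k * p.op k F) := by
        have h3 : ∑ k, X k * p.op k F =
            ∑ k, X k * ((1 - p.W⁻¹) *ᵥ (fun i => p.op i F)) k := by
          simp only [Matrix.sub_mulVec, Matrix.one_mulVec, Pi.sub_apply, mul_sub,
            Finset.sum_sub_distrib, h0, sub_zero]
        rw [h3]
        simp only [Matrix.mulVec, dotProduct]
        refine VanishTo.sum fun k _ => VanishTo.mul_of_constantCoeff (by simp)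
          (VanishTo.sum fun l _ => VanishTo.mul_of_constantCoeff ?_ (ih l))
        rw [Matrix.sub_apply, map_sub, constantCoeff_inv p.constantCoeff_W, Matrix.one_apply]
        split_ifs <;> simp
      have h3 : ∑ i, X i * pderiv R j (p.op i F) = pderiv R j (∑ k, X k * p.op k F) - p.op j F := by
        simp only [map_sum, Derivation.leibniz, smul_eq_mul, Finset.sum_add_distrib]
        have : ∑ k, p.op k F * pderiv R j (X k) = p.op j F := by
          rw [Finset.sum_eq_single j]
          · simp
          · intro k _ hk
            rw [pderiv_X_of_ne hk, mul_zero]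
          · simp
        rw [this]
        ring
      -- Cartan's formula for the Euler field: the Lie derivative of op F is its contracted
      -- differential plus the differential of its contraction, both small.
      have h4 : VanishTo (N + 1) (∑ i, X i * pderiv R i (p.op j F) + p.op j F) := by
        have h5 : VanishTo (N + 1)
            (∑ i, X i * (pderiv R i (p.op j F) - pderiv R j (p.op i F))) :=
          VanishTo.sum fun i _ => VanishTo.mul_of_constantCoeff (by simp) (h1 i)
        simp only [mul_sub, Finset.sum_sub_distrib] at h5
        rw [h3] at h5
        have h6 := h5.add (h2.pderiv j)
        convert h6 using 1
        ring
      intro m hm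
      have h5 := h4 m hm
      rw [map_add, coeff_sum_X_mul_pderiv] at h5
      -- The Euler operator plus one multiplies the coefficient at m by |m| + 1, which is never
      -- zero.
      refine natCast_mul_eq_zero (k := m.degree + 1) (Nat.succ_ne_zero _) ?_
      rw [← h5]
      push_cast
      ring
  exact fun i => VanishTo.eq_zero fun N => key N i

/-- The commutator of `op i` with H_F is vertical and is a Hamiltonian field of op_i F = 0, so it
lies in the kernel of Π and kills the Hamiltonian function G. Then op_i(H_F G) = H_F(op_i G) = 0. -/
lemma op_vert_eq_zero {F G : MvPowerSeries (Fin n) R} {a b : Fin n → MvPowerSeries (Fin n) R}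
    (hF : ∀ i, p.op i F = 0) (hG : ∀ i, p.op i G = 0) (hFa : L.Ham F a) (hGb : L.Ham G b)
    (i : Fin n) : p.op i (vert a G) = 0 := by
  have h1 := (L.ham_vert (p.ham i) hFa).sub (L.ham_nabla i hFa)
  rw [← op_apply, hF] at h1
  have h2 : ∀ r, (⁅p.op i, vert a⁆ : Derivation ℝ _ _) (C r) = 0 := by
    intro r
    simp [Derivation.commutator_apply]
  have h3 := eq_vert h2 G
  rw [Derivation.commutator_apply, hG, map_zero, sub_zero] at h3
  rw [h3, L.ham_swap hGb]
  have h4 : ∀ l, (⁅p.op i, vert a⁆ : Derivation ℝ _ _) (X l) =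
      vert (p.v i) (a l) - vert a (p.v i l) - (L.nabla i (a l) - ∑ s, a s * C (L.Γ i s l)) := by
    intro l
    rw [Derivation.commutator_apply, vert_X, op_apply, op_apply, vert_X, nabla_X, map_sub,
      vert_apply a (L.christoffel i l)]
    simp only [pderiv_christoffel]
    ring
  simp only [h4, ← h1 _]
  simp

/-- On Z the terms Γξ vanish and v is the identity, so the system determines the first-order part of
F. -/
lemma constantCoeff_pderiv {F : MvPowerSeries (Fin n) R} (hF : ∀ i, p.op i F = 0) (i : Fin n) :
    constantCoeff (pderiv R i F) = ∑ s, L.π i s * L.δ s (constantCoeff F) := by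
  have h := congrArg (constantCoeff (σ := Fin n) (R := R)) (hF i)
  rw [op_apply, vert_apply, nabla_apply] at h
  simp only [map_sub, map_sum, map_add, map_mul, p.v_mod, christoffel, constantCoeff_X, mul_zero,
    Finset.sum_const_zero, zero_mul, add_zero, ite_mul, one_mul, map_zero, Finset.sum_ite_eq,
    Finset.mem_univ, if_true, constantCoeff_C] at h
  exact sub_eq_zero.1 h

/-- On Z the field `a` enters only through Πa, which `constantCoeff_pderiv` identifies with Π df;
its ambiguity in the kernel of Π is harmless. -/
lemma constantCoeff_vert {F G : MvPowerSeries (Fin n) R} {a : Fin n → MvPowerSeries (Fin n) R}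
    (hF : ∀ i, p.op i F = 0) (hG : ∀ i, p.op i G = 0) (hFa : L.Ham F a) :
    constantCoeff (vert a G) = ∑ i, ∑ s, L.π i s * L.δ i (constantCoeff F)
      * L.δ s (constantCoeff G) := by
  have h : ∀ i, ∑ s, L.π i s * L.δ s (constantCoeff F) =
      ∑ k, L.π i k * constantCoeff (a k) := by
    intro i
    rw [← p.constantCoeff_pderiv hF, hFa i]
    simp
  rw [vert_apply]
  simp only [map_sum, map_mul, p.constantCoeff_pderiv hG, Finset.mul_sum]
  have e1 : ∑ k, ∑ s, constantCoeff (a k) * (L.π k s * L.δ s (constantCoeff G)) =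
      - ∑ s, L.δ s (constantCoeff G) * ∑ k, L.π s k * constantCoeff (a k) := by
    rw [Finset.sum_comm, ← Finset.sum_neg_distrib]
    refine Finset.sum_congr rfl fun s _ => ?_
    rw [Finset.mul_sum, ← Finset.sum_neg_distrib]
    exact Finset.sum_congr rfl fun k _ => by rw [L.skew k s]; ring
  rw [e1]
  simp only [← h, Finset.mul_sum]
  rw [Finset.sum_comm, ← Finset.sum_neg_distrib]
  refine Finset.sum_congr rfl fun s _ => ?_
  rw [← Finset.sum_neg_distrib]
  exact Finset.sum_congr rfl fun k _ => by rw [L.skew k s]; ring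

end Potential
end LocalModel
end LocalModel

/-! ### Differentials, coordinate frames and the Poisson tensor in charts. -/

section Calculus

open Filter Topology

variable {n : ℕ} {M : Type*} [TopologicalSpace M] [ChartedSpace (EuclideanSpace ℝ (Fin n)) M]

lemma dfun_congr {f g : M → ℝ} {x : M} (h : f =ᶠ[𝓝 x] g) :
    dfun (n := n) f x = dfun (n := n) g x := h.mfderiv_eq

lemma dfun_add {f g : M → ℝ} {x : M} (hf : MDifferentiableAt (𝓡 n) 𝓘(ℝ, ℝ) f x)
    (hg : MDifferentiableAt (𝓡 n) 𝓘(ℝ, ℝ) g x) (w : TangentSpace (𝓡 n) x) :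
    dfun (n := n) (fun y => f y + g y) x w = dfun (n := n) f x w + dfun (n := n) g x w := by
  have h := (hf.hasMFDerivAt.add hg.hasMFDerivAt).mfderiv
  exact congrArg (fun L : EuclideanSpace ℝ (Fin n) →L[ℝ] ℝ => L w) h

lemma dfun_mul {f g : M → ℝ} {x : M} (hf : MDifferentiableAt (𝓡 n) 𝓘(ℝ, ℝ) f x)
    (hg : MDifferentiableAt (𝓡 n) 𝓘(ℝ, ℝ) g x) (w : TangentSpace (𝓡 n) x) :
    dfun (n := n) (fun y => f y * g y) x w =
      f x * dfun (n := n) g x w + g x * dfun (n := n) f x w := by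
  have h := (hf.hasMFDerivAt.mul hg.hasMFDerivAt).mfderiv
  exact congrArg (fun L : EuclideanSpace ℝ (Fin n) →L[ℝ] ℝ => L w) h

lemma dfun_const (c : ℝ) (x : M) (w : TangentSpace (𝓡 n) x) :
    dfun (n := n) (fun _ : M => c) x w = 0 := by
  have h := (hasMFDerivAt_const (I := 𝓡 n) (I' := 𝓘(ℝ, ℝ)) c x).mfderiv
  exact congrArg (fun L : EuclideanSpace ℝ (Fin n) →L[ℝ] ℝ => L w) h

lemma dfun_sum {ι : Type*} (t : Finset ι) {f : ι → M → ℝ} {x : M}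
    (hf : ∀ i ∈ t, MDifferentiableAt (𝓡 n) 𝓘(ℝ, ℝ) (f i) x) (w : TangentSpace (𝓡 n) x) :
    MDifferentiableAt (𝓡 n) 𝓘(ℝ, ℝ) (fun y => ∑ i ∈ t, f i y) x ∧
    dfun (n := n) (fun y => ∑ i ∈ t, f i y) x w = ∑ i ∈ t, dfun (n := n) (f i) x w := by
  classical
  induction t using Finset.induction_on with
  | empty => simpa using ⟨mdifferentiableAt_const, dfun_const 0 x w⟩
  | insert a t ha ih =>
    obtain ⟨h1, h2⟩ := ih fun i hi => hf i (Finset.mem_insert_of_mem hi)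
    have h3 := hf a (Finset.mem_insert_self a t)
    simp only [Finset.sum_insert ha]
    exact ⟨h3.add h1, by rw [dfun_add h3 h1, h2]⟩

variable {s : Set M}

lemma mdifferentiableAt_of_contMDiffOn (hs : IsOpen s) {g : M → ℝ}
    (hg : ContMDiffOn (𝓡 n) 𝓘(ℝ, ℝ) ∞ g s) {x : M} (hx : x ∈ s) :
    MDifferentiableAt (𝓡 n) 𝓘(ℝ, ℝ) g x :=
  (hg.contMDiffAt (hs.mem_nhds hx)).mdifferentiableAt (by simp)

lemma contDiffOn_comp_symm {φ : OpenPartialHomeomorph M (EuclideanSpace ℝ (Fin n))} (hφ : φ ∈ Charts n M) {g : M → ℝ}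
    (hg : ContMDiffOn (𝓡 n) 𝓘(ℝ, ℝ) ∞ g s) :
    ContDiffOn ℝ ∞ (g ∘ φ.symm) (φ.target ∩ φ.symm ⁻¹' s) :=
  contMDiffOn_iff_contDiffOn.1 (hg.comp
    ((contMDiffOn_symm_of_mem_maximalAtlas hφ).mono Set.inter_subset_left) fun _ hy => hy.2)

lemma bivector_antisymm (P : PoissonStructure n M) (x : M) (α β : Cot (n := n) x) :
    P.bivector x α β = - P.bivector x β α := by
  have := P.alt x (α + β)
  simp only [map_add, LinearMap.add_apply, P.alt] at this
  linarith

variable [IsManifold (𝓡 n) ∞ M] {φ : OpenPartialHomeomorph M (EuclideanSpace ℝ (Fin n))}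

lemma dx_frame (hφ : φ ∈ Charts n M) {x : M} (hx : x ∈ φ.source) (i j : Fin n) :
    dx φ i x (frame φ j x) = if i = j then 1 else 0 := by
  rw [mfderiv_frame hφ hx]
  have h := congrArg
    (fun L : EuclideanSpace ℝ (Fin n) →L[ℝ] EuclideanSpace ℝ (Fin n) =>
      L (EuclideanSpace.single j (1 : ℝ)))
    ((mdifferentiable_of_mem_charts hφ).comp_symm_deriv (φ.map_source hx))
  rw [φ.left_inv hx] at h
  refine (congrArg (fun z : EuclideanSpace ℝ (Fin n) => z i) h).trans ?_
  change (EuclideanSpace.single j (1 : ℝ) : EuclideanSpace ℝ (Fin n)) i = _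
  simp

lemma vector_eq_sum (hφ : φ ∈ Charts n M) {x : M} (hx : x ∈ φ.source) (w : TangentSpace (𝓡 n) x) :
    w = ∑ i, dx φ i x w • frame φ i x := by
  have h2 := congrArg (fun L => L w) ((mdifferentiable_of_mem_charts hφ).symm_comp_deriv hx)
  have h3 : ∀ z : EuclideanSpace ℝ (Fin n),
      z = ∑ i, z i • (EuclideanSpace.single i (1 : ℝ) : EuclideanSpace ℝ (Fin n)) := by
    intro z
    ext j
    simp [Pi.single_apply]
  refine h2.symm.trans ?_
  refine (congrArg (mfderiv (𝓡 n) (𝓡 n) φ.symm (φ x))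
    (h3 (mfderiv (𝓡 n) (𝓡 n) φ x w))).trans ?_
  refine (map_sum (mfderiv (𝓡 n) (𝓡 n) φ.symm (φ x)) _ _).trans
    (Finset.sum_congr rfl fun i _ => ?_)
  rw [mfderiv_frame hφ hx]
  exact map_smul (mfderiv (𝓡 n) (𝓡 n) φ.symm (φ x)) _ _

lemma covector_apply_eq_sum (hφ : φ ∈ Charts n M) {x : M} (hx : x ∈ φ.source) (α : Cot (n := n) x)
    (w : TangentSpace (𝓡 n) x) : α w = ∑ i, α (frame φ i x) * dx φ i x w := by
  conv_lhs => rw [covector_eq_sum hφ hx α]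
  simp

lemma dfun_frame (hφ : φ ∈ Charts n M) {x : M} (hx : x ∈ φ.source) {g : M → ℝ}
    (hg : MDifferentiableAt (𝓡 n) 𝓘(ℝ, ℝ) g x) (i : Fin n) :
    dfun (n := n) g x (frame φ i x) =
      fderiv ℝ (g ∘ φ.symm) (φ x) (EuclideanSpace.single i (1 : ℝ)) := by
  have hg' : MDifferentiableAt (𝓡 n) 𝓘(ℝ, ℝ) g (φ.symm (φ x)) := by rwa [φ.left_inv hx]
  have h5 : mfderiv (𝓡 n) 𝓘(ℝ, ℝ) (g ∘ φ.symm) (φ x) =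
      (mfderiv (𝓡 n) 𝓘(ℝ, ℝ) g (φ.symm (φ x))).comp (mfderiv (𝓡 n) (𝓡 n) φ.symm (φ x)) :=
    mfderiv_comp (φ x) hg'
      ((mdifferentiable_of_mem_charts hφ).mdifferentiableAt_symm (φ.map_source hx))
  rw [mfderiv_eq_fderiv, φ.left_inv hx] at h5
  rw [mfderiv_frame hφ hx]
  exact (congrArg (fun L : EuclideanSpace ℝ (Fin n) →L[ℝ] ℝ =>
    L (EuclideanSpace.single i (1 : ℝ))) h5).symm

lemma contMDiffOn_dfun_frame (hφ : φ ∈ Charts n M) (hs : IsOpen s) (hsφ : s ⊆ φ.source) {g : M → ℝ}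
    (hg : ContMDiffOn (𝓡 n) 𝓘(ℝ, ℝ) ∞ g s) (i : Fin n) :
    ContMDiffOn (𝓡 n) 𝓘(ℝ, ℝ) ∞ (fun x => dfun (n := n) g x (frame φ i x)) s := by
  have h2 := contDiffOn_comp_symm hφ hg
  have h3 : ContDiffOn ℝ ∞ (fun y => fderiv ℝ (g ∘ φ.symm) y (EuclideanSpace.single i (1 : ℝ)))
      (φ.target ∩ φ.symm ⁻¹' s) :=
    (h2.fderiv_of_isOpen (φ.isOpen_inter_preimage_symm hs) (m := ∞) (by simp)).clm_apply
      contDiffOn_const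
  have h4 := (contMDiffOn_iff_contDiffOn.2 h3).comp
    ((contMDiffOn_of_mem_maximalAtlas hφ).mono hsφ)
    (fun x hx => ⟨φ.map_source (hsφ hx), by
      change φ.symm (φ x) ∈ s
      rwa [φ.left_inv (hsφ hx)]⟩)
  exact h4.congr fun x hx => dfun_frame hφ (hsφ hx) (mdifferentiableAt_of_contMDiffOn hs hg hx) i

/-- Read in the chart, both sides are entries of the second Fréchet derivative, which is symmetric.
-/
lemma dfun_frame_comm (hφ : φ ∈ Charts n M) (hs : IsOpen s) (hsφ : s ⊆ φ.source) {g : M → ℝ}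
    (hg : ContMDiffOn (𝓡 n) 𝓘(ℝ, ℝ) ∞ g s) (i j : Fin n) {x : M} (hx : x ∈ s) :
    dfun (n := n) (fun y => dfun (n := n) g y (frame φ j y)) x (frame φ i x) =
      dfun (n := n) (fun y => dfun (n := n) g y (frame φ i y)) x (frame φ j x) := by
  have ho := φ.isOpen_inter_preimage_symm hs
  have hx' : φ x ∈ φ.target ∩ φ.symm ⁻¹' s := ⟨φ.map_source (hsφ hx), by
    change φ.symm (φ x) ∈ s
    rwa [φ.left_inv (hsφ hx)]⟩
  have h2 := contDiffOn_comp_symm hφ hg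
  have h2' := h2.contDiffAt (ho.mem_nhds hx')
  have key : ∀ i j, dfun (n := n) (fun y => dfun (n := n) g y (frame φ j y)) x (frame φ i x) =
      fderiv ℝ (fderiv ℝ (g ∘ φ.symm)) (φ x) (EuclideanSpace.single i (1 : ℝ))
        (EuclideanSpace.single j (1 : ℝ)) := by
    intro i j
    rw [dfun_frame hφ (hsφ hx) (mdifferentiableAt_of_contMDiffOn hs
      (contMDiffOn_dfun_frame hφ hs hsφ hg j) hx)]
    have e : ((fun y => dfun (n := n) g y (frame φ j y)) ∘ φ.symm) =ᶠ[𝓝 (φ x)]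
        fun y => fderiv ℝ (g ∘ φ.symm) y (EuclideanSpace.single j (1 : ℝ)) := by
      filter_upwards [ho.mem_nhds hx'] with y hy
      have h := dfun_frame hφ (hsφ hy.2) (mdifferentiableAt_of_contMDiffOn hs hg hy.2) j
      rw [φ.right_inv hy.1] at h
      exact h
    rw [e.fderiv_eq]
    have hd : DifferentiableAt ℝ (fderiv ℝ (g ∘ φ.symm)) (φ x) :=
      (h2'.fderiv_right (m := 1) (by exact_mod_cast (ENat.LEInfty.out : (2 : WithTop ℕ∞) ≤ ∞))).differentiableAt (by simp)
    rw [fderiv_clm_apply hd (differentiableAt_const _)]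
    simp
  rw [key, key]
  exact (h2'.isSymmSndFDerivAt (by simpa using (ENat.LEInfty.out : (2 : WithTop ℕ∞) ≤ ∞))) _ _

/-- The tangent space at x is trivialised by the preferred chart at x. This identifies `stdVec` and
`stdCovec` with its coordinate frames at that point. -/
lemma mfderiv_chartAt_self_apply (x : M) (w : EuclideanSpace ℝ (Fin n)) :
    mfderiv (𝓡 n) (𝓡 n) (chartAt (EuclideanSpace ℝ (Fin n)) x) x w = w := by
  have h := mfderiv_chartAt_eq_tangentCoordChange (I := 𝓡 n) (x := x) (y := x)
    (mem_chart_source _ x)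
  rw [h]
  exact tangentCoordChange_self (I := 𝓡 n) (mem_extChartAt_source x)

lemma dx_chartAt_self (x : M) (i : Fin n) :
    dx (chartAt (EuclideanSpace ℝ (Fin n)) x) i x = stdCovec x i := by
  ext w
  exact congrArg (fun z : EuclideanSpace ℝ (Fin n) => z i) (mfderiv_chartAt_self_apply x w)

lemma frame_chartAt_self (x : M) (i : Fin n) :
    frame (chartAt (EuclideanSpace ℝ (Fin n)) x) i x = stdVec x i := by
  have h1 : mfderiv (𝓡 n) (𝓡 n) (chartAt (EuclideanSpace ℝ (Fin n)) x) x =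
      ContinuousLinearMap.id ℝ (EuclideanSpace ℝ (Fin n)) :=
    ContinuousLinearMap.ext fun w => mfderiv_chartAt_self_apply x w
  rw [frame, h1]
  exact congrArg (fun L : EuclideanSpace ℝ (Fin n) →L[ℝ] EuclideanSpace ℝ (Fin n) =>
    L (EuclideanSpace.single i (1 : ℝ))) ContinuousLinearMap.inverse_id

variable (P : PoissonStructure n M)

lemma stdCovec_stdVec (x : M) (i j : Fin n) :
    stdCovec x i (stdVec x j) = if i = j then 1 else 0 := by
  rw [← dx_chartAt_self, ← frame_chartAt_self]
  exact dx_frame (IsManifold.chart_mem_maximalAtlas x) (mem_chart_source _ x) i j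

lemma apply_sharp (α : Form n M) (x : M) (β : Cot (n := n) x) :
    β (sharp P α x) = P.bivector x (α x) β := by
  have h := covector_eq_sum (IsManifold.chart_mem_maximalAtlas x) (mem_chart_source _ x) β
  simp only [dx_chartAt_self, frame_chartAt_self] at h
  conv_rhs => rw [h]
  rw [sharp, map_sum, map_sum]
  refine Finset.sum_congr rfl fun i _ => ?_
  rw [map_smul, map_smul]
  simp [mul_comm]

lemma bivector_eq_sum (hφ : φ ∈ Charts n M) {x : M} (hx : x ∈ φ.source) (α β : Cot (n := n) x) :
    P.bivector x α β = ∑ i, ∑ j, α (frame φ i x) * (β (frame φ j x) * P.comp φ i j x) := by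
  conv_lhs => rw [covector_eq_sum hφ hx α, covector_eq_sum hφ hx β]
  simp only [map_sum, map_smul, LinearMap.sum_apply, LinearMap.smul_apply, smul_eq_mul,
    Finset.mul_sum]
  rw [Finset.sum_comm]
  exact Finset.sum_congr rfl fun i _ => Finset.sum_congr rfl fun j _ => by
    rw [PoissonStructure.comp]; ring

lemma isSmoothForm_dfun (f : C^∞⟮𝓡 n, M; ℝ⟯) : IsSmoothForm (dfun (n := n) f) :=
  fun _ hφ i => contMDiffOn_partial f hφ i

end Calculus

/-! ### Lie derivatives and brackets of exact forms. -/

section Exact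

open Filter Topology

variable {n : ℕ} {M : Type*} [TopologicalSpace M] [ChartedSpace (EuclideanSpace ℝ (Fin n)) M]
  {φ : OpenPartialHomeomorph M (EuclideanSpace ℝ (Fin n))} {s : Set M}

lemma contMDiffOn_coord (hφ : φ ∈ Charts n M) (i : Fin n) :
    ContMDiffOn (𝓡 n) 𝓘(ℝ, ℝ) ∞ (fun y => φ y i) φ.source :=
  (EuclideanSpace.proj i : EuclideanSpace ℝ (Fin n) →L[ℝ] ℝ).contDiff.contMDiff.comp_contMDiffOn
    (contMDiffOn_of_mem_maximalAtlas hφ)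

variable [IsManifold (𝓡 n) ∞ M]

lemma contMDiffOn_bivector (P : PoissonStructure n M) (hφ : φ ∈ Charts n M) (hsφ : s ⊆ φ.source)
    {α β : Form n M}
    (hα : ∀ i, ContMDiffOn (𝓡 n) 𝓘(ℝ, ℝ) ∞ (fun x => α x (frame φ i x)) s)
    (hβ : ∀ i, ContMDiffOn (𝓡 n) 𝓘(ℝ, ℝ) ∞ (fun x => β x (frame φ i x)) s) :
    ContMDiffOn (𝓡 n) 𝓘(ℝ, ℝ) ∞ (fun x => P.bivector x (α x) (β x)) s := by
  have h : ContMDiffOn (𝓡 n) 𝓘(ℝ, ℝ) ∞ (fun y => ∑ i, ∑ j, α y (frame φ i y) *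
      (β y (frame φ j y) * P.comp φ i j y)) s :=
    contMDiffOn_finsetSum fun i _ => contMDiffOn_finsetSum fun j _ =>
      (hα i).mul ((hβ j).mul ((P.smooth φ hφ i j).mono hsφ))
  exact h.congr fun y hy => bivector_eq_sum P hφ (hsφ hy) _ _

lemma dfun_coord (hφ : φ ∈ Charts n M) {x : M} (hx : x ∈ φ.source) (i : Fin n) :
    dfun (n := n) (fun y => φ y i) x = dx φ i x := by
  have h1 := (mdifferentiable_of_mem_charts hφ).mdifferentiableAt hx
  have h2 := (EuclideanSpace.proj i : EuclideanSpace ℝ (Fin n) →L[ℝ] ℝ).hasMFDerivAt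
    (x := φ x)
  exact (h2.comp x h1.hasMFDerivAt).mfderiv

lemma contMDiffOn_dx_frame {ψ : OpenPartialHomeomorph M (EuclideanSpace ℝ (Fin n))}
    (hφ : φ ∈ Charts n M) (hψ : ψ ∈ Charts n M) (i j : Fin n) :
    ContMDiffOn (𝓡 n) 𝓘(ℝ, ℝ) ∞ (fun x => dx ψ j x (frame φ i x)) (φ.source ∩ ψ.source) :=
  (contMDiffOn_dfun_frame hφ (φ.open_source.inter ψ.open_source) Set.inter_subset_left
    ((contMDiffOn_coord hψ j).mono Set.inter_subset_right) i).congr fun x hx => by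
      rw [dfun_coord hψ hx.2]

/-- Lie derivatives commute with d; in coordinates this is the Leibniz rule and the symmetry of
second derivatives of g. -/
lemma lieDeriv_dfun (X : VField n M) (g : C^∞⟮𝓡 n, M; ℝ⟯)
    (hX : ∀ φ ∈ Charts n M, ∀ i,
      ContMDiffOn (𝓡 n) 𝓘(ℝ, ℝ) ∞ (fun x => dx φ i x (X x)) φ.source) (x : M) :
    lieDeriv X (dfun g) x = dfun (n := n) (fun y => dfun g y (X y)) x := by
  set φ := chartAt (EuclideanSpace ℝ (Fin n)) x with hφdef
  have hφ : φ ∈ Charts n M := IsManifold.chart_mem_maximalAtlas x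
  have hx : x ∈ φ.source := mem_chart_source _ x
  have hg := fun i => contMDiffOn_partial g hφ i
  have hd : ∀ {h : M → ℝ}, ContMDiffOn (𝓡 n) 𝓘(ℝ, ℝ) ∞ h φ.source →
      MDifferentiableAt (𝓡 n) 𝓘(ℝ, ℝ) h x :=
    fun h => mdifferentiableAt_of_contMDiffOn φ.open_source h hx
  rw [covector_eq_sum hφ hx (dfun (n := n) (fun y => dfun g y (X y)) x)]
  rw [lieDeriv]
  refine Finset.sum_congr rfl fun k _ => ?_
  congr 1
  have e1 : (fun y => dfun g y (X y)) =ᶠ[𝓝 x]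
      fun y => ∑ i, dfun g y (frame φ i y) * dx φ i y (X y) := by
    filter_upwards [φ.open_source.mem_nhds hx] with y hy
    exact covector_apply_eq_sum hφ hy _ _
  have e2 := (dfun_sum (f := fun i y => dfun g y (frame φ i y) * dx φ i y (X y)) Finset.univ
    (fun i _ => (hd (hg i)).mul (hd (hX φ hφ i))) (frame φ k x)).2
  rw [dfun_congr e1, e2,
    covector_apply_eq_sum hφ hx _ (X x), ← Finset.sum_add_distrib]
  refine Finset.sum_congr rfl fun i _ => ?_
  rw [dfun_mul (hd (hg i)) (hd (hX φ hφ i)), dfun_frame_comm hφ φ.open_source subset_rfl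
    (g.contMDiff.contMDiffOn) i k hx]
  ring

lemma contMDiffOn_dx_sharp (P : PoissonStructure n M) {α : Form n M} (hα : IsSmoothForm α)
    (hφ : φ ∈ Charts n M) (i : Fin n) :
    ContMDiffOn (𝓡 n) 𝓘(ℝ, ℝ) ∞ (fun x => dx φ i x (sharp P α x)) φ.source := by
  simp only [apply_sharp]
  refine contMDiffOn_bivector P hφ subset_rfl (hα φ hφ) fun j => ?_
  exact (contMDiffOn_const (c := if i = j then (1 : ℝ) else 0)).congr
    fun x hx => dx_frame hφ hx i j

/-- The two Lie derivatives contribute d{f,g} twice and the last term removes one copy. Since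
coordinates are extended to global functions, the local computations only need this case of the
bracket. -/
lemma formBracket_dfun (P : PoissonStructure n M) (f g : C^∞⟮𝓡 n, M; ℝ⟯) :
    formBracket P (dfun f) (dfun g) = dfun (poissonBracket P f g) := by
  funext x
  have h1 := lieDeriv_dfun (sharp P (dfun f)) g
    (fun φ hφ i => contMDiffOn_dx_sharp P (isSmoothForm_dfun f) hφ i) x
  have h2 := lieDeriv_dfun (sharp P (dfun g)) f
    (fun φ hφ i => contMDiffOn_dx_sharp P (isSmoothForm_dfun g) hφ i) x
  rw [formBracket, h1, h2]
  simp only [apply_sharp]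
  have h3 : (fun y => P.bivector y (dfun g y) (dfun f y)) =
      fun y => - P.bivector y (dfun f y) (dfun g y) := funext fun y => bivector_antisymm P _ _ _
  have h4 : dfun (n := n) (fun y => - P.bivector y (dfun f y) (dfun g y)) x =
      - dfun (n := n) (fun y => P.bivector y (dfun f y) (dfun g y)) x :=
    mfderiv_neg (I := 𝓡 n) (f := fun y => P.bivector y (dfun f y) (dfun g y)) (x := x)
  rw [h3, h4]
  change _ = dfun (n := n) (fun y => P.bivector y (dfun f y) (dfun g y)) x
  abel

end Exact

/-! ### Coordinates extended to global functions, and finite sums in connections. -/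

section Coord

open Filter Topology

variable {n : ℕ} {M : Type*} [TopologicalSpace M] [ChartedSpace (EuclideanSpace ℝ (Fin n)) M]

lemma IsSmoothForm.add {α β : Form n M} (hα : IsSmoothForm α) (hβ : IsSmoothForm β) :
    IsSmoothForm (fun x => α x + β x) := fun φ hφ i => (hα φ hφ i).add (hβ φ hφ i)

lemma IsSmoothForm.smul (f : C^∞⟮𝓡 n, M; ℝ⟯) {β : Form n M} (hβ : IsSmoothForm β) :
    IsSmoothForm (fun x => f x • β x) := fun φ hφ i => f.contMDiff.contMDiffOn.mul (hβ φ hφ i)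

lemma isSmoothForm_zero : IsSmoothForm (fun _ => 0 : Form n M) := fun _ _ _ => contMDiffOn_const

lemma IsSmoothForm.sum {ι : Type*} (t : Finset ι) {α : ι → Form n M}
    (h : ∀ i, IsSmoothForm (α i)) : IsSmoothForm (fun x => ∑ i ∈ t, α i x) := by
  classical
  induction t using Finset.induction_on with
  | empty => simpa using isSmoothForm_zero
  | insert a t ha ih =>
    simp only [Finset.sum_insert ha]
    exact (h a).add ih

variable (n M) in
/-- An open set with the coordinates of a chart, which are extended to smooth functions on the
whole manifold. -/
structure CoordDomain where
  /-- the chart -/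
  φ : OpenPartialHomeomorph M (EuclideanSpace ℝ (Fin n))
  mem : φ ∈ Charts n M
  /-- the domain -/
  s : Set M
  isOpen : IsOpen s
  subset : s ⊆ φ.source
  /-- the extended coordinates -/
  f : Fin n → C^∞⟮𝓡 n, M; ℝ⟯
  f_eq : ∀ i, ∀ x ∈ s, f i x = φ x i

namespace CoordDomain

/-- A smaller domain with the same coordinates. -/
def restrict (c : CoordDomain n M) (t : Set M) (ht : IsOpen t) (hts : t ⊆ c.s) :
    CoordDomain n M where
  φ := c.φ
  mem := c.mem
  s := t
  isOpen := ht
  subset := hts.trans c.subset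
  f := c.f
  f_eq i x hx := c.f_eq i x (hts hx)

variable [IsManifold (𝓡 n) ∞ M] (c : CoordDomain n M)

lemma dfun_f (i : Fin n) {x : M} (hx : x ∈ c.s) : dfun (c.f i) x = dx c.φ i x := by
  rw [← dfun_coord c.mem (c.subset hx), dfun_congr]
  filter_upwards [c.isOpen.mem_nhds hx] with y hy
  exact c.f_eq i y hy

lemma form_eq_sum (α : Form n M) {x : M} (hx : x ∈ c.s) :
    α x = ∑ i, α x (frame c.φ i x) • dfun (c.f i) x := by
  simp only [c.dfun_f _ hx]
  exact covector_eq_sum c.mem (c.subset hx) (α x)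

end CoordDomain

namespace ContravariantConnection

variable {P : PoissonStructure n M} (D : ContravariantConnection P) {α β : Form n M}

lemma sum_left {ι : Type*} (t : Finset ι) (a : ι → C^∞⟮𝓡 n, M; ℝ⟯) {α : ι → Form n M}
    (hα : ∀ i, IsSmoothForm (α i)) (hβ : IsSmoothForm β) :
    D.toFun (fun x => ∑ i ∈ t, a i x • α i x) β = fun x => ∑ i ∈ t, a i x • D.toFun (α i) β x := by
  classical
  induction t using Finset.induction_on with
  | empty =>
    -- The value on the zero form is obtained by scaling with the zero function.
    have := D.smul_left 0 β β hβ hβ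
    simpa using this
  | insert j t hj ih =>
    simp only [Finset.sum_insert hj]
    rw [D.add_left (fun x => a j x • α j x) (fun x => ∑ i ∈ t, a i x • α i x) β ((hα j).smul _)
      (IsSmoothForm.sum t fun i => (hα i).smul _) hβ, ih, D.smul_left _ _ _ (hα j) hβ]

lemma sum_right {ι : Type*} (t : Finset ι) (a : ι → C^∞⟮𝓡 n, M; ℝ⟯) {β : ι → Form n M}
    (hα : IsSmoothForm α) (hβ : ∀ i, IsSmoothForm (β i)) :
    D.toFun α (fun x => ∑ i ∈ t, a i x • β i x) =
      fun x => ∑ i ∈ t, (a i x • D.toFun α (β i) x + dfun (a i) x (sharp P α x) • β i x) := by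
  classical
  induction t using Finset.induction_on with
  | empty =>
    have := D.leibniz 0 α α hα hα
    have h0 : ∀ x, dfun (n := n) (0 : M → ℝ) x (sharp P α x) = 0 :=
      fun x => dfun_const 0 x _
    simpa [h0] using this
  | insert j t hj ih =>
    simp only [Finset.sum_insert hj]
    rw [D.add_right α (fun x => a j x • β j x) (fun x => ∑ i ∈ t, a i x • β i x) hα ((hβ j).smul _)
      (IsSmoothForm.sum t fun i => (hβ i).smul _), ih, D.leibniz _ _ _ hα (hβ j)]

end ContravariantConnection

end Coord

/-! ### Bump functions and locality of contravariant connections. -/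

section Bump

open Filter Topology

variable {n : ℕ} {M : Type*} [TopologicalSpace M] [T2Space M]
  [ChartedSpace (EuclideanSpace ℝ (Fin n)) M]
  [IsManifold (𝓡 n) ∞ M] {φ : OpenPartialHomeomorph M (EuclideanSpace ℝ (Fin n))} {s : Set M}

lemma exists_bump {x : M} (hs : s ∈ 𝓝 x) :
    ∃ χ : C^∞⟮𝓡 n, M; ℝ⟯, (⇑χ =ᶠ[𝓝 x] fun _ => 1) ∧ tsupport χ ⊆ s := by
  obtain ⟨χ, -, hχ⟩ := (SmoothBumpFunction.nhds_basis_tsupport (I := 𝓡 n) x).mem_iff.1 hs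
  exact ⟨⟨χ, χ.contMDiff⟩, χ.eventuallyEq_one, hχ⟩

lemma exists_smooth_extension (hs : IsOpen s) {x : M} (hx : x ∈ s) {h : M → ℝ}
    (hh : ContMDiffOn (𝓡 n) 𝓘(ℝ, ℝ) ∞ h s) : ∃ g : C^∞⟮𝓡 n, M; ℝ⟯, ⇑g =ᶠ[𝓝 x] h := by
  obtain ⟨χ, hχ1, hχs⟩ := exists_bump (n := n) (hs.mem_nhds hx)
  refine ⟨⟨fun y => χ y * h y, contMDiff_of_tsupport fun y hy => ?_⟩, ?_⟩
  · have hy' : y ∈ s := hχs (tsupport_mul_subset_left hy)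
    exact χ.contMDiff.contMDiffAt.mul (hh.contMDiffAt (hs.mem_nhds hy'))
  · filter_upwards [hχ1] with y hy
    change χ y * h y = h y
    rw [hy, one_mul]

lemma CoordDomain.exists_mem (hφ : φ ∈ Charts n M) {x : M} (hx : x ∈ φ.source) :
    ∃ c : CoordDomain n M, c.φ = φ ∧ x ∈ c.s := by
  have h : ∀ i, ∃ g : C^∞⟮𝓡 n, M; ℝ⟯, ⇑g =ᶠ[𝓝 x] fun y => φ y i := by
    intro i
    exact exists_smooth_extension φ.open_source hx (contMDiffOn_coord hφ i)
  choose f hf using h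
  have h1 : {y | (∀ i, f i y = φ y i) ∧ y ∈ φ.source} ∈ 𝓝 x := by
    filter_upwards [eventually_all.2 hf, φ.open_source.mem_nhds hx] with y hy hy'
    exact ⟨hy, hy'⟩
  obtain ⟨s, hs, hso, hxs⟩ := mem_nhds_iff.1 h1
  exact ⟨⟨φ, hφ, s, hso, fun y hy => (hs hy).2, f, fun i y hy => (hs hy).1 i⟩, rfl, hxs⟩

namespace ContravariantConnection

variable {P : PoissonStructure n M} (D : ContravariantConnection P) {α α' β β' : Form n M}

/-- A bump function χ with support in the set of agreement makes the two forms equal globally after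
multiplication, and χ = 1 at x. -/
lemma congr_left (hα : IsSmoothForm α) (hα' : IsSmoothForm α') (hβ : IsSmoothForm β) {x : M}
    (h : ∀ᶠ y in 𝓝 x, α y = α' y) : D.toFun α β x = D.toFun α' β x := by
  obtain ⟨χ, hχ1, hχs⟩ := exists_bump (n := n) h
  have e : (fun y => χ y • α y) = fun y => χ y • α' y := by
    funext y
    by_cases hy : y ∈ tsupport χ
    · rw [show α y = α' y from hχs hy]
    · rw [image_eq_zero_of_notMem_tsupport hy, zero_smul, zero_smul]
  have h1 := congrFun (D.smul_left χ α β hα hβ) x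
  have h2 := congrFun (D.smul_left χ α' β hα' hβ) x
  rw [e, h2] at h1
  simpa [hχ1.self_of_nhds] using h1.symm

lemma congr_right (hα : IsSmoothForm α) (hβ : IsSmoothForm β) (hβ' : IsSmoothForm β') {x : M}
    (h : ∀ᶠ y in 𝓝 x, β y = β' y) : D.toFun α β x = D.toFun α β' x := by
  obtain ⟨χ, hχ1, hχs⟩ := exists_bump (n := n) h
  have e : (fun y => χ y • β y) = fun y => χ y • β' y := by
    funext y
    by_cases hy : y ∈ tsupport χ
    · rw [show β y = β' y from hχs hy]
    · rw [image_eq_zero_of_notMem_tsupport hy, zero_smul, zero_smul]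
  have h1 := congrFun (D.leibniz χ α β hα hβ) x
  have h2 := congrFun (D.leibniz χ α β' hα hβ') x
  rw [e, h2] at h1
  -- The extra Leibniz term disappears because χ is constant near x.
  have h3 : dfun χ x (sharp P α x) = 0 := by
    rw [dfun_congr hχ1, dfun_const]
  simpa [hχ1.self_of_nhds, h3] using h1.symm

variable (c : CoordDomain n M)

lemma exists_coeff (hα : IsSmoothForm α) {x : M} (hx : x ∈ c.s) :
    ∃ a : Fin n → C^∞⟮𝓡 n, M; ℝ⟯, (∀ i, ⇑(a i) =ᶠ[𝓝 x] fun y => α y (frame c.φ i y)) ∧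
      ∀ᶠ y in 𝓝 x, α y = ∑ i, a i y • dfun (c.f i) y := by
  have h : ∀ i, ∃ g : C^∞⟮𝓡 n, M; ℝ⟯, ⇑g =ᶠ[𝓝 x] fun y => α y (frame c.φ i y) := fun i =>
    exists_smooth_extension c.φ.open_source (c.subset hx) (hα c.φ c.mem i)
  choose a ha using h
  refine ⟨a, ha, ?_⟩
  filter_upwards [eventually_all.2 ha, c.isOpen.mem_nhds hx] with y hy hy'
  rw [c.form_eq_sum α hy']
  exact Finset.sum_congr rfl fun i _ => by rw [hy i]

lemma apply_left (hα : IsSmoothForm α) (hβ : IsSmoothForm β) {x : M} (hx : x ∈ c.s) :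
    D.toFun α β x = ∑ i, α x (frame c.φ i x) • D.toFun (dfun (c.f i)) β x := by
  obtain ⟨a, ha, h⟩ := exists_coeff c hα hx
  rw [D.congr_left hα (IsSmoothForm.sum _ fun i => (isSmoothForm_dfun (c.f i)).smul (a i)) hβ h,
    D.sum_left _ _ (fun i => isSmoothForm_dfun (c.f i)) hβ]
  exact Finset.sum_congr rfl fun i _ => by rw [(ha i).self_of_nhds]

lemma apply_right (hα : IsSmoothForm α) (hβ : IsSmoothForm β) {x : M} (hx : x ∈ c.s) :
    D.toFun α β x = ∑ i, (β x (frame c.φ i x) • D.toFun α (dfun (c.f i)) x +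
      dfun (n := n) (fun y => β y (frame c.φ i y)) x (sharp P α x) • dx c.φ i x) := by
  obtain ⟨a, ha, h⟩ := exists_coeff c hβ hx
  rw [D.congr_right hα hβ (IsSmoothForm.sum _ fun i => (isSmoothForm_dfun (c.f i)).smul (a i)) h,
    D.sum_right _ _ hα (fun i => isSmoothForm_dfun (c.f i))]
  exact Finset.sum_congr rfl fun i _ => by
    rw [(ha i).self_of_nhds, dfun_congr (ha i), c.dfun_f i hx]

end ContravariantConnection
end Bump

/-! ### The ring of smooth functions on a domain, and the local model over it. -/

section SmoothRing

open Filter Topology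

variable {n : ℕ} {M : Type*} [TopologicalSpace M] [ChartedSpace (EuclideanSpace ℝ (Fin n)) M]

open Classical in
/-- The extension by zero of a function on a subset. -/
def extendZero {M : Type*} (s : Set M) (f : s → ℝ) : M → ℝ := fun x =>
  if h : x ∈ s then f ⟨x, h⟩ else 0

lemma extendZero_of_mem {M : Type*} {s : Set M} (f : s → ℝ) {x : M} (hx : x ∈ s) :
    extendZero s f x = f ⟨x, hx⟩ := dif_pos hx

lemma extendZero_restrict {M : Type*} {s : Set M} (g : M → ℝ) :
    Set.EqOn (extendZero s fun x => g x) g s := fun _ hx => extendZero_of_mem _ hx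

variable (n) in
/-- The algebra of smooth functions on a subset. -/
def smoothRing (s : Set M) : Subalgebra ℝ (s → ℝ) where
  carrier := {f | ContMDiffOn (𝓡 n) 𝓘(ℝ, ℝ) ∞ (extendZero s f) s}
  add_mem' {f g} hf hg := (ContMDiffOn.add hf hg).congr fun x hx => by
    simp [extendZero_of_mem _ hx]
  mul_mem' {f g} hf hg := (ContMDiffOn.mul hf hg).congr fun x hx => by
    simp [extendZero_of_mem _ hx]
  algebraMap_mem' r := (contMDiffOn_const (c := r)).congr fun x hx => by
    simp [extendZero_of_mem _ hx]

namespace smoothRing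

variable {s : Set M}

/-- The restriction of a function which is smooth on `s`. -/
def ofSmooth (g : M → ℝ) (hg : ContMDiffOn (𝓡 n) 𝓘(ℝ, ℝ) ∞ g s) : smoothRing n s :=
  ⟨fun x => g x, hg.congr (extendZero_restrict g)⟩

/-- Evaluation at a point. -/
def ev (x : s) : smoothRing n s →+* ℝ := (Pi.evalRingHom (fun _ : s => ℝ) x).comp
  (smoothRing n s).val.toRingHom

@[simp] lemma ev_ofSmooth (g : M → ℝ) (hg : ContMDiffOn (𝓡 n) 𝓘(ℝ, ℝ) ∞ g s) (x : s) :
    ev x (ofSmooth g hg) = g x := rfl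

lemma ext_ev {f g : smoothRing n s} (h : ∀ x : s, ev x f = ev x g) : f = g :=
  Subtype.ext (funext h)

lemma smooth (f : smoothRing n s) : ContMDiffOn (𝓡 n) 𝓘(ℝ, ℝ) ∞ (extendZero s f.1) s := f.2

lemma extendZero_eq (f : smoothRing n s) (x : s) : extendZero s f.1 x = ev x f :=
  extendZero_of_mem _ x.2

/-- Evaluation of the coefficients of a formal power series at a point. -/
def evS (x : s) : MvPowerSeries (Fin n) (smoothRing n s) →+* MvPowerSeries (Fin n) ℝ :=
  MvPowerSeries.map (ev x)

@[simp] lemma coeff_evS (x : s) (F : MvPowerSeries (Fin n) (smoothRing n s)) (m : Fin n →₀ ℕ) :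
    MvPowerSeries.coeff m (evS x F) = ev x (MvPowerSeries.coeff m F) :=
  MvPowerSeries.coeff_map _ _ _

@[simp] lemma evS_C (x : s) (f : smoothRing n s) :
    evS x (MvPowerSeries.C f) = MvPowerSeries.C (ev x f) := MvPowerSeries.map_C _ _

@[simp] lemma evS_X (x : s) (k : Fin n) :
    evS x (MvPowerSeries.X k : MvPowerSeries (Fin n) (smoothRing n s)) = MvPowerSeries.X k :=
  MvPowerSeries.map_X _ _

@[simp] lemma constantCoeff_evS (x : s) (F : MvPowerSeries (Fin n) (smoothRing n s)) :
    MvPowerSeries.constantCoeff (evS x F) = ev x (MvPowerSeries.constantCoeff F) :=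
  MvPowerSeries.constantCoeff_map _ _

@[simp] lemma evS_pderiv (x : s) (F : MvPowerSeries (Fin n) (smoothRing n s)) (k : Fin n) :
    evS x (MvPowerSeries.pderiv _ k F) = MvPowerSeries.pderiv ℝ k (evS x F) := by
  ext m
  simp [MvPowerSeries.coeff_pderiv]

lemma ext_evS {F G : MvPowerSeries (Fin n) (smoothRing n s)} (h : ∀ x : s, evS x F = evS x G) :
    F = G := by
  refine MvPowerSeries.ext fun m => ext_ev fun x => ?_
  rw [← coeff_evS, ← coeff_evS, h]

/-- A family of formal power series with smooth coefficients as a formal power series. -/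
def ofField (F : FField n M) (hF : SmoothCoeffOn F s) : MvPowerSeries (Fin n) (smoothRing n s) :=
  fun m => ofSmooth (fun x => MvPowerSeries.coeff m (F x)) (hF m)

@[simp] lemma evS_ofField (F : FField n M) (hF : SmoothCoeffOn F s) (x : s) :
    evS x (ofField F hF) = F x := by
  ext m
  rw [coeff_evS]
  rfl

open Classical in
/-- The family of formal power series given by a formal power series with smooth coefficients. -/
def toField (F : MvPowerSeries (Fin n) (smoothRing n s)) : FField n M := fun x =>
  if h : x ∈ s then evS ⟨x, h⟩ F else 0

lemma toField_of_mem (F : MvPowerSeries (Fin n) (smoothRing n s)) {x : M} (hx : x ∈ s) :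
    toField F x = evS ⟨x, hx⟩ F := dif_pos hx

lemma coeff_toField (F : MvPowerSeries (Fin n) (smoothRing n s)) (m : Fin n →₀ ℕ) :
    Set.EqOn (fun x => MvPowerSeries.coeff m (toField F x))
      (extendZero s (MvPowerSeries.coeff m F).1) s := by
  intro x hx
  simp only [toField_of_mem F hx, coeff_evS]
  exact (extendZero_eq _ ⟨x, hx⟩).symm

lemma smoothCoeffOn_toField (F : MvPowerSeries (Fin n) (smoothRing n s)) :
    SmoothCoeffOn (toField F) s := fun m =>
  (smooth (MvPowerSeries.coeff m F)).congr (coeff_toField F m)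

end smoothRing

section ChartDeriv

variable [IsManifold (𝓡 n) ∞ M] {φ : OpenPartialHomeomorph M (EuclideanSpace ℝ (Fin n))} {s : Set M}

open smoothRing

/-- The coordinate derivation `∂/∂x^i`. -/
def chartDeriv (hφ : φ ∈ Charts n M) (hs : IsOpen s) (hsφ : s ⊆ φ.source) (i : Fin n) :
    Derivation ℝ (smoothRing n s) (smoothRing n s) :=
  Derivation.mk'
    { toFun := fun g => ofSmooth _ (contMDiffOn_dfun_frame hφ hs hsφ (smooth g) i)
      map_add' := fun g h => by
        refine ext_ev fun x => ?_
        rw [map_add, ev_ofSmooth, ev_ofSmooth, ev_ofSmooth, ← dfun_add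
          (mdifferentiableAt_of_contMDiffOn hs (smooth g) x.2)
          (mdifferentiableAt_of_contMDiffOn hs (smooth h) x.2)]
        rw [dfun_congr]
        filter_upwards [hs.mem_nhds x.2] with y hy
        simp [extendZero_of_mem _ hy]
      map_smul' := fun r g => by
        refine ext_ev fun x => ?_
        have e : ev x (r • ofSmooth _ (contMDiffOn_dfun_frame hφ hs hsφ (smooth g) i)) =
          r * dfun (n := n) (extendZero s g.1) x (frame φ i x) := rfl
        rw [RingHom.id_apply, e, ev_ofSmooth]
        have h := dfun_mul (mdifferentiableAt_const (c := r))
          (mdifferentiableAt_of_contMDiffOn hs (smooth g) x.2) (frame φ i x)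
        rw [dfun_const, mul_zero, add_zero] at h
        rw [← h, dfun_congr]
        filter_upwards [hs.mem_nhds x.2] with y hy
        simp [extendZero_of_mem _ hy] }
    (fun g h => by
      refine ext_ev fun x => ?_
      change dfun (n := n) (extendZero s (g * h).1) x (frame φ i x) =
        ev x g * dfun (n := n) (extendZero s h.1) x (frame φ i x) +
        ev x h * dfun (n := n) (extendZero s g.1) x (frame φ i x)
      rw [← extendZero_eq, ← extendZero_eq, ← dfun_mul
          (mdifferentiableAt_of_contMDiffOn hs (smooth g) x.2)
          (mdifferentiableAt_of_contMDiffOn hs (smooth h) x.2)]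
      rw [dfun_congr]
      filter_upwards [hs.mem_nhds x.2] with y hy
      simp [extendZero_of_mem _ hy])

lemma ev_chartDeriv (hφ : φ ∈ Charts n M) (hs : IsOpen s) (hsφ : s ⊆ φ.source) (i : Fin n)
    (g : smoothRing n s) (x : s) :
    ev x (chartDeriv hφ hs hsφ i g) = dfun (n := n) (extendZero s g.1) x (frame φ i x) := rfl

lemma ev_chartDeriv_ofSmooth (hφ : φ ∈ Charts n M) (hs : IsOpen s) (hsφ : s ⊆ φ.source) (i : Fin n)
    (g : M → ℝ) (hg : ContMDiffOn (𝓡 n) 𝓘(ℝ, ℝ) ∞ g s) (x : s) :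
    ev x (chartDeriv hφ hs hsφ i (ofSmooth g hg)) = dfun (n := n) g x (frame φ i x) := by
  rw [ev_chartDeriv, dfun_congr]
  filter_upwards [hs.mem_nhds x.2] with y hy
  exact extendZero_restrict g hy

end ChartDeriv

namespace CoordDomain

variable [IsManifold (𝓡 n) ∞ M] (c : CoordDomain n M)

open smoothRing

/-- The coordinate derivations of a coordinate domain. -/
def deriv (i : Fin n) : Derivation ℝ (smoothRing n c.s) (smoothRing n c.s) :=
  chartDeriv c.mem c.isOpen c.subset i

lemma ev_deriv_ofSmooth (i : Fin n) (g : M → ℝ) (hg : ContMDiffOn (𝓡 n) 𝓘(ℝ, ℝ) ∞ g c.s) (x : c.s) :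
    ev x (c.deriv i (ofSmooth g hg)) = dfun (n := n) g x (frame c.φ i x) :=
  ev_chartDeriv_ofSmooth c.mem c.isOpen c.subset i g hg x

lemma deriv_comm (i j : Fin n) (g : smoothRing n c.s) :
    c.deriv i (c.deriv j g) = c.deriv j (c.deriv i g) := by
  refine ext_ev fun x => ?_
  have h : ∀ j, c.deriv j g = ofSmooth _ (contMDiffOn_dfun_frame c.mem c.isOpen c.subset (smooth g) j) :=
    fun j => rfl
  rw [h i, h j, ev_deriv_ofSmooth, ev_deriv_ofSmooth]
  exact dfun_frame_comm c.mem c.isOpen c.subset (smooth g) i j x.2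

variable {P : PoissonStructure n M}

lemma bivector_right (α β : Form n M) {x : M} (hx : x ∈ c.s) :
    P.bivector x (α x) (β x) =
      ∑ s, P.bivector x (α x) (dfun (c.f s) x) * β x (frame c.φ s x) := by
  conv_lhs => rw [c.form_eq_sum β hx]
  simp [mul_comm]

lemma bivector_dfun_f (i j : Fin n) {x : M} (hx : x ∈ c.s) :
    P.bivector x (dfun (c.f i) x) (dfun (c.f j) x) = P.comp c.φ i j x := by
  rw [c.dfun_f i hx, c.dfun_f j hx, PoissonStructure.comp]

variable (P) in
/-- The components of the Poisson tensor as elements of the ring of smooth functions. -/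
def poisson (i j : Fin n) : smoothRing n c.s :=
  ofSmooth (poissonBracket P (c.f i) (c.f j)) (poissonBracket P (c.f i) (c.f j)).contMDiff.contMDiffOn

lemma ev_poisson (i j : Fin n) (x : c.s) :
    ev x (c.poisson P i j) = P.bivector x (dfun (c.f i) x) (dfun (c.f j) x) := rfl

lemma ev_poisson' (i j : Fin n) (x : c.s) : ev x (c.poisson P i j) = P.comp c.φ i j x :=
  c.bivector_dfun_f i j x.2

/-- The Christoffel symbols of a contravariant connection. -/
def christoffelSymbol (D : ContravariantConnection P) (i j k : Fin n) : smoothRing n c.s :=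
  ofSmooth (fun x => - D.toFun (dfun (c.f i)) (dfun (c.f j)) x (frame c.φ k x))
    (((D.smooth _ _ (isSmoothForm_dfun (c.f i)) (isSmoothForm_dfun (c.f j)) c.φ c.mem k).neg).mono
      c.subset)

lemma ev_christoffelSymbol (D : ContravariantConnection P) (i j k : Fin n) (x : c.s) :
    ev x (c.christoffelSymbol D i j k) =
      - D.toFun (dfun (c.f i)) (dfun (c.f j)) x (frame c.φ k x) := rfl

lemma sum_poisson_deriv (i : Fin n) (g : C^∞⟮𝓡 n, M; ℝ⟯) (x : c.s) :
    ∑ s, ev x (c.poisson P i s) * dfun g x (frame c.φ s x) =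
      P.bivector x (dfun (c.f i) x) (dfun g x) := by
  rw [c.bivector_right (dfun (c.f i)) (dfun g) x.2]
  rfl

lemma ev_deriv_poisson (s i j : Fin n) (x : c.s) : ev x (c.deriv s (c.poisson P i j)) =
    dfun (poissonBracket P (c.f i) (c.f j)) x (frame c.φ s x) := c.ev_deriv_ofSmooth _ _ _ _

/-- The local model of a Poisson manifold with a pair of contravariant connections. -/
def model (D D' : ContravariantConnection P) (hassoc : Associated D D') (htor : TorsionFree D') :
    LocalModel n (smoothRing n c.s) where
  δ := c.deriv
  δ_comm := c.deriv_comm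
  π := c.poisson P
  skew i j := ext_ev fun x => by
    rw [map_neg, ev_poisson, ev_poisson]
    exact bivector_antisymm P _ _ _
  jacobi i j k := ext_ev fun x => by
    simp only [map_sum, map_add, map_mul, ev_deriv_poisson, Finset.sum_add_distrib,
      sum_poisson_deriv, map_zero]
    exact P.jacobi (c.f i) (c.f j) (c.f k) x
  Γ := c.christoffelSymbol D
  Γ' := c.christoffelSymbol D'
  assoc i j k := ext_ev fun x => by
    have h1 := hassoc _ _ _ (isSmoothForm_dfun (c.f i)) (isSmoothForm_dfun (c.f j))
      (isSmoothForm_dfun (c.f k)) x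
    -- On coordinate forms, association is the identity between Γ and Γ' plus three derivative
    -- terms, which form the Jacobi sum.
    have h2 := P.jacobi (c.f i) (c.f j) (c.f k) x
    simp only [ContravariantConnection.pairVField, apply_sharp, formBracket_dfun] at h1
    have h3 : ∀ (D : ContravariantConnection P) (i j k : Fin n),
        ∑ l, ev x (c.christoffelSymbol D i k l) * ev x (c.poisson P j l) =
        - P.bivector x (dfun (c.f j) x) (D.toFun (dfun (c.f i)) (dfun (c.f k)) x) := by
      intro D i j k
      rw [c.bivector_right (dfun (c.f j)) (D.toFun (dfun (c.f i)) (dfun (c.f k))) x.2,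
        ← Finset.sum_neg_distrib]
      exact Finset.sum_congr rfl fun l _ => by rw [ev_christoffelSymbol, ev_poisson]; ring
    simp only [map_sum, map_mul, h3]
    have h4 : dfun (n := n) (fun y => P.bivector y (dfun (c.f k) y) (dfun (c.f i) y)) x =
        - dfun (n := n) (fun y => P.bivector y (dfun (c.f i) y) (dfun (c.f k) y)) x := by
      rw [show (fun y => P.bivector y (dfun (c.f k) y) (dfun (c.f i) y)) =
        fun y => - P.bivector y (dfun (c.f i) y) (dfun (c.f k) y) from
        funext fun y => bivector_antisymm P _ _ _]
      exact mfderiv_neg (I := 𝓡 n) (x := (x : M))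
        (f := fun y => P.bivector y (dfun (c.f i) y) (dfun (c.f k) y))
    have h5 : P.bivector x (dfun (poissonBracket P (c.f i) (c.f j)) x) (dfun (c.f k) x) =
        - P.bivector x (dfun (c.f k) x)
          (dfun (n := n) (fun y => P.bivector y (dfun (c.f i) y) (dfun (c.f j) y)) x) :=
      bivector_antisymm P _ _ _
    rw [h5] at h1
    rw [h4, map_neg] at h2
    linarith
  torsion l k s := ext_ev fun x => by
    have h1 := congrArg (fun β : Cot (n := n) (x : M) => β (frame c.φ s x))
      (htor _ _ (isSmoothForm_dfun (c.f l)) (isSmoothForm_dfun (c.f k)) x)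
    rw [formBracket_dfun] at h1
    rw [map_sub, ev_christoffelSymbol, ev_christoffelSymbol, ev_deriv_poisson]
    simp only [sub_apply, zero_apply] at h1
    linarith

end CoordDomain
end SmoothRing

/-! ### Linear changes of the fibre coordinates. -/

section LinearSubst

open MvPowerSeries

variable {n : ℕ} {S : Type*} [CommRing S]

/-- The linear substitution with matrix `a`. -/
def linSubst (a : Fin n → Fin n → S) (i : Fin n) : MvPowerSeries (Fin n) S := ∑ k, a i k • X k

lemma constantCoeff_linSubst (a : Fin n → Fin n → S) (i : Fin n) :
    constantCoeff (linSubst a i) = 0 := by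
  simp [linSubst, smul_eq_C_mul]

lemma hasSubst_linSubst (a : Fin n → Fin n → S) : HasSubst (linSubst a) :=
  hasSubst_of_constantCoeff_zero fun i => constantCoeff_linSubst a i

/-- The ring homomorphism given by a linear substitution. -/
def linHom (a : Fin n → Fin n → S) : MvPowerSeries (Fin n) S →ₐ[S] MvPowerSeries (Fin n) S :=
  substAlgHom (hasSubst_linSubst a)

lemma linHom_apply (a : Fin n → Fin n → S) (F : MvPowerSeries (Fin n) S) :
    linHom a F = subst (linSubst a) F := substAlgHom_apply _ _

@[simp] lemma linHom_X (a : Fin n → Fin n → S) (i : Fin n) : linHom a (X i) = linSubst a i :=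
  substAlgHom_X _ _

@[simp] lemma linHom_C (a : Fin n → Fin n → S) (r : S) : linHom a (C r) = C r :=
  (linHom a).commutes r

lemma linHom_linHom (a b : Fin n → Fin n → S) (F : MvPowerSeries (Fin n) S) :
    linHom b (linHom a F) = linHom (fun i l => ∑ k, a i k * b k l) F := by
  simp only [linHom_apply]
  rw [subst_comp_subst_apply (hasSubst_linSubst a) (hasSubst_linSubst b)]
  congr 1
  funext i
  rw [← linHom_apply]
  simp only [linSubst, map_sum, map_smul, linHom_X, Finset.smul_sum, Finset.sum_smul, smul_smul]
  exact Finset.sum_comm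

lemma linHom_one (F : MvPowerSeries (Fin n) S) :
    linHom (fun i k => if i = k then 1 else 0) F = F := by
  rw [linHom_apply]
  have : linSubst (fun i k : Fin n => if i = k then (1 : S) else 0) = X := by
    funext i
    simp [linSubst]
  rw [this, subst_self]
  rfl

lemma map_linHom {T : Type*} [CommRing T] (h : S →+* T) (a : Fin n → Fin n → S)
    (F : MvPowerSeries (Fin n) S) :
    MvPowerSeries.map h (linHom a F) = linHom (fun i k => h (a i k)) (MvPowerSeries.map h F) := by
  rw [linHom_apply, linHom_apply, map_subst (hasSubst_linSubst a)]
  congr 1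
  funext i
  simp [linSubst, smul_eq_C_mul]

lemma constantCoeff_linHom (a : Fin n → Fin n → S) (F : MvPowerSeries (Fin n) S) [Algebra ℝ S] :
    constantCoeff (linHom a F) = constantCoeff F := by
  obtain ⟨G, hG⟩ := exists_eq_C_add_sum_X_mul F
  rw [hG]
  simp [constantCoeff_linSubst]

/-- Chain rule. The defect satisfies the Leibniz rule over `linHom a`, so constants and variables
suffice. -/
lemma pderiv_linHom [Algebra ℝ S] (a : Fin n → Fin n → S) (F : MvPowerSeries (Fin n) S)
    (k : Fin n) : pderiv S k (linHom a F) = ∑ i, a i k • linHom a (pderiv S i F) := by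
  classical
  rw [← sub_eq_zero]
  refine eq_zero_of_leibniz (linHom a).toRingHom (fun k => ?_)
    (fun F => pderiv S k (linHom a F) - ∑ i, a i k • linHom a (pderiv S i F)) ?_ ?_ ?_ ?_ F
  · exact (congrArg constantCoeff (linHom_X a k)).trans (constantCoeff_linSubst a k)
  · intro F G
    simp only [map_add, smul_add, Finset.sum_add_distrib]
    ring
  · intro F G
    change _ = linHom a F * _ + linHom a G * _
    simp only [map_mul, Derivation.leibniz, map_add, smul_eq_mul, smul_add,
      Finset.sum_add_distrib, mul_sub, Finset.mul_sum, mul_smul_comm]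
    ring
  · intro r
    simp
  · intro j
    rw [linHom_X, linSubst, map_sum]
    have h1 : ∀ i, a i k • linHom a (pderiv S i (X j)) = if j = i then C (a j k) else 0 := by
      intro i
      split_ifs with h
      · subst h
        simp [smul_eq_C_mul]
      · rw [pderiv_X_of_ne h]
        simp
    have h2 : ∀ l, pderiv S k (a j l • X l) = if k = l then C (a j k) else 0 := by
      intro l
      split_ifs with h
      · subst h
        simp [smul_eq_C_mul]
      · rw [Derivation.map_smul, pderiv_X_of_ne (Ne.symm h), smul_zero]
    simp only [h1, h2]
    simp

end LinearSubst

/-! ### Formal functions under a change of chart. -/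

section ChartChange

open Filter Topology smoothRing

variable {n : ℕ} {M : Type*} [TopologicalSpace M] [ChartedSpace (EuclideanSpace ℝ (Fin n)) M]

lemma toChart_eq (φ : OpenPartialHomeomorph M (EuclideanSpace ℝ (Fin n))) (F : FField n M) (x : M) :
    toChart φ F x = linHom (fun i k => dx φ k x (stdVec x i)) (F x) := (linHom_apply _ _).symm

lemma SmoothCoeffOn.mono {F : FField n M} {s t : Set M} (hF : SmoothCoeffOn F s) (h : t ⊆ s) :
    SmoothCoeffOn F t := fun m => (hF m).mono h

lemma SmoothCoeffOn.congr {F G : FField n M} {s : Set M} (hF : SmoothCoeffOn F s)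
    (h : Set.EqOn G F s) : SmoothCoeffOn G s := fun m => (hF m).congr fun x hx => by rw [h hx]

variable [IsManifold (𝓡 n) ∞ M] {φ ψ : OpenPartialHomeomorph M (EuclideanSpace ℝ (Fin n))}

lemma toChart_toChart (hφ : φ ∈ Charts n M) {x : M} (hx : x ∈ φ.source) (F : FField n M) :
    linHom (fun i k => dx ψ k x (frame φ i x)) (toChart φ F x) = toChart ψ F x := by
  rw [toChart_eq, toChart_eq, linHom_linHom]
  congr 2
  funext i l
  conv_rhs => rw [vector_eq_sum hφ hx (stdVec x i)]
  simp

lemma toChart_chartAt_self (F : FField n M) (x : M) :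
    toChart (chartAt (EuclideanSpace ℝ (Fin n)) x) F x = F x := by
  rw [toChart_eq]
  have : (fun i k => dx (chartAt (EuclideanSpace ℝ (Fin n)) x) k x (stdVec x i)) =
      fun i k => if i = k then (1 : ℝ) else 0 := by
    funext i k
    rw [dx_chartAt_self, stdCovec_stdVec]
    simp [eq_comm]
  rw [this, linHom_one]

/-- The inverse of `toChart` at a point. -/
def fromChart (φ : OpenPartialHomeomorph M (EuclideanSpace ℝ (Fin n))) (G : FField n M) :
    FField n M := fun x => linHom (fun i k => stdCovec x k (frame φ i x)) (G x)

lemma stdCovec_eq_sum (x : M) (w : TangentSpace (𝓡 n) x) : w = ∑ k, stdCovec x k w • stdVec x k := by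
  have := vector_eq_sum (IsManifold.chart_mem_maximalAtlas x) (mem_chart_source _ x) w
  simpa only [dx_chartAt_self, frame_chartAt_self] using this

lemma toChart_fromChart (hφ : φ ∈ Charts n M) {x : M} (hx : x ∈ φ.source) (G : FField n M) :
    toChart φ (fromChart φ G) x = G x := by
  rw [toChart_eq, fromChart, linHom_linHom]
  conv_rhs => rw [← linHom_one (G x)]
  congr 2
  funext i l
  have h := dx_frame hφ hx l i
  rw [stdCovec_eq_sum x (frame φ i x)] at h
  rw [show (if i = l then (1 : ℝ) else 0) = if l = i then 1 else 0 by simp only [eq_comm], ← h]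
  simp

lemma toChart_injective (hφ : φ ∈ Charts n M) {x : M} (hx : x ∈ φ.source) {F G : FField n M}
    (h : toChart φ F x = toChart φ G x) : F x = G x := by
  rw [← toChart_chartAt_self F x, ← toChart_chartAt_self G x, ← toChart_toChart hφ hx, h,
    toChart_toChart hφ hx]

lemma toChart_hat (x : M) (w : TangentSpace (𝓡 n) x) :
    linHom (fun i k => dx φ k x (stdVec x i)) (hat x w) =
      ∑ k, dx φ k x w • MvPowerSeries.X k := by
  have h : ∀ k, dx φ k x w = ∑ i, stdCovec x i w * dx φ k x (stdVec x i) := by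
    intro k
    conv_lhs => rw [stdCovec_eq_sum x w]
    simp
  simp only [hat, LinearMap.sum_apply, LinearMap.smulRight_apply, map_sum, map_smul, linHom_X,
    linSubst, Finset.smul_sum, smul_smul, h, Finset.sum_smul]
  exact Finset.sum_comm

/-- The matrix of the change of fibre coordinates. -/
def transition (hφ : φ ∈ Charts n M) (hψ : ψ ∈ Charts n M) {t : Set M}
    (ht : t ⊆ φ.source ∩ ψ.source) (i k : Fin n) : smoothRing n t :=
  ofSmooth (fun x => dx ψ k x (frame φ i x)) ((contMDiffOn_dx_frame hφ hψ i k).mono ht)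

lemma evS_transition (hφ : φ ∈ Charts n M) (hψ : ψ ∈ Charts n M) {t : Set M}
    (ht : t ⊆ φ.source ∩ ψ.source) (x : t) (F : FField n M)
    (G : MvPowerSeries (Fin n) (smoothRing n t)) (hG : evS x G = toChart φ F x) :
    evS x (linHom (transition hφ hψ ht) G) = toChart ψ F x := by
  rw [← toChart_toChart hφ (ht x.2).1, ← hG]
  exact map_linHom _ _ _

/-- Smoothness of the coefficients of a formal function does not depend on the chart. -/
lemma smoothCoeffOn_toChart (hφ : φ ∈ Charts n M) (hψ : ψ ∈ Charts n M) {t : Set M}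
    (ht : t ⊆ φ.source ∩ ψ.source) {F : FField n M} (hF : SmoothCoeffOn (toChart φ F) t) :
    SmoothCoeffOn (toChart ψ F) t := by
  refine (smoothCoeffOn_toField (linHom (transition hφ hψ ht) (ofField _ hF))).congr fun x hx => ?_
  rw [toField_of_mem _ hx, evS_transition hφ hψ ht ⟨x, hx⟩ F _ (evS_ofField _ _ _)]

end ChartChange

/-! ### Chart independence of ∇̄. -/

section NablaBar

open Filter Topology smoothRing

variable {n : ℕ} {M : Type*} [TopologicalSpace M] [ChartedSpace (EuclideanSpace ℝ (Fin n)) M]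

/-- The value at a point of the first order operator `w^s δ_s + γ^j_k ξ_j ∂/∂ξ_k`. -/
def connOp {t : Set M} (d : Fin n → Derivation ℝ (smoothRing n t) (smoothRing n t)) (x : t)
    (w : Fin n → ℝ) (γ : Fin n → Fin n → ℝ) (G : MvPowerSeries (Fin n) (smoothRing n t)) :
    MvPowerSeries (Fin n) ℝ :=
  (∑ s, w s • evS x (coeffDerivation (d s) G)) +
    ∑ j, ∑ k, γ j k • (MvPowerSeries.X j * MvPowerSeries.pderiv ℝ k (evS x G))

section connOp

variable {t : Set M} (d : Fin n → Derivation ℝ (smoothRing n t) (smoothRing n t)) (x : t)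
  (w : Fin n → ℝ) (γ : Fin n → Fin n → ℝ)

lemma connOp_add (F G : MvPowerSeries (Fin n) (smoothRing n t)) :
    connOp d x w γ (F + G) = connOp d x w γ F + connOp d x w γ G := by
  simp only [connOp, map_add, mul_add, smul_add, Finset.sum_add_distrib]
  ring

/-- The operator is a derivation along evaluation at the point, which brings the comparison of two
such operators within reach of `eq_zero_of_leibniz`. -/
lemma connOp_mul (F G : MvPowerSeries (Fin n) (smoothRing n t)) :
    connOp d x w γ (F * G) = evS x F * connOp d x w γ G + evS x G * connOp d x w γ F := by
  simp only [connOp, map_add, Derivation.leibniz, smul_eq_mul, map_mul, mul_add, smul_add,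
    Finset.sum_add_distrib, Finset.mul_sum, mul_smul_comm, mul_left_comm (MvPowerSeries.X _)]
  ring

lemma connOp_C (r : smoothRing n t) :
    connOp d x w γ (MvPowerSeries.C r) = MvPowerSeries.C (∑ s, w s * ev x (d s r)) := by
  simp [connOp, MvPowerSeries.smul_eq_C_mul]

lemma connOp_X (k : Fin n) : connOp d x w γ (MvPowerSeries.X k) =
    ∑ j, γ j k • MvPowerSeries.X j := by
  classical
  rw [connOp]
  simp only [coeffDerivation_X, map_zero, smul_zero, Finset.sum_const_zero, zero_add, evS_X]
  refine Finset.sum_congr rfl fun j _ => ?_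
  rw [Finset.sum_eq_single k]
  · simp
  · intro l _ hl
    rw [MvPowerSeries.pderiv_X_of_ne hl.symm, mul_zero, smul_zero]
  · simp

variable [IsManifold (𝓡 n) ∞ M]

lemma connOp_chartDeriv_ofField {φ : OpenPartialHomeomorph M (EuclideanSpace ℝ (Fin n))}
    (hφ : φ ∈ Charts n M) (ht : IsOpen t) (htφ : t ⊆ φ.source) {F : FField n M}
    (hF : SmoothCoeffOn (toChart φ F) t) :
    connOp (chartDeriv hφ ht htφ) x w γ (ofField _ hF) = (∑ s, w s • partialBase φ s F x) +
      ∑ j, ∑ k, γ j k • (MvPowerSeries.X j * MvPowerSeries.pderiv ℝ k (toChart φ F x)) := by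
  rw [connOp]
  simp only [evS_ofField]
  congr 1
  refine Finset.sum_congr rfl fun s _ => ?_
  congr 1
  refine MvPowerSeries.ext fun m => ?_
  rw [coeff_evS, coeff_coeffDerivation]
  exact ev_chartDeriv_ofSmooth hφ ht htφ s _ (hF m) x

end connOp

variable [IsManifold (𝓡 n) ∞ M] [T2Space M]

lemma isSmoothForm_coordForm (x : M) (j : Fin n) : IsSmoothForm (coordForm (n := n) x j) := by
  intro φ hφ i y hy
  have hψ := IsManifold.chart_mem_maximalAtlas (I := 𝓡 n) (n := ∞) x
  set ψ := chartAt (EuclideanSpace ℝ (Fin n)) x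
  set χ := Classical.arbitrary (SmoothBumpFunction (𝓡 n) x)
  by_cases h : y ∈ tsupport χ
  · have hyψ : y ∈ ψ.source := χ.tsupport_subset_chartAt_source h
    have h1 := (contMDiffOn_dx_frame hφ hψ i j).contMDiffAt
      ((φ.open_source.inter ψ.open_source).mem_nhds ⟨hy, hyψ⟩)
    exact (χ.contMDiffAt.mul h1).contMDiffWithinAt
  · refine (ContMDiffAt.congr_of_eventuallyEq (contMDiffAt_const (c := (0 : ℝ))) ?_).contMDiffWithinAt
    have h1 := notMem_tsupport_iff_eventuallyEq.1 h
    filter_upwards [h1] with z hz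
    change χ z * _ = 0
    rw [hz]
    simp

variable {P : PoissonStructure n M} (D : ContravariantConnection P)

/-- The connection is local in its second argument, so the cut-off forms in the definition may be
replaced by the exact forms of the extended coordinates. -/
lemma nablaBar_eq_connOp {α : Form n M} (hα : IsSmoothForm α) {x : M} (c : CoordDomain n M)
    (hc : c.φ = chartAt (EuclideanSpace ℝ (Fin n)) x) {t : Set M} (ht : IsOpen t) (htc : t ⊆ c.s)
    (hx : x ∈ t) {F : FField n M} (hF : SmoothCoeffOn (toChart c.φ F) t) :
    nablaBar D α F x = connOp (chartDeriv c.mem ht (htc.trans c.subset)) ⟨x, hx⟩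
      (fun s => dx c.φ s x (sharp P α x))
      (fun j k => - D.toFun α (dfun (c.f j)) x (frame c.φ k x)) (ofField _ hF) := by
  have h : ∀ j, D.toFun α (coordForm x j) x = D.toFun α (dfun (c.f j)) x := by
    intro j
    refine D.congr_right hα (isSmoothForm_coordForm x j) (isSmoothForm_dfun _) ?_
    filter_upwards [ht.mem_nhds hx,
      (Classical.arbitrary (SmoothBumpFunction (𝓡 n) x)).eventuallyEq_one] with y hy hy1
    rw [c.dfun_f j (htc hy), coordForm, hy1, hc]
    simp
  rw [connOp_chartDeriv_ofField]
  simp only [nablaBar, h, ← hc]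

/-- The expression of `∇̄` in the coordinates of an arbitrary chart. -/
lemma toChart_nablaBar_eq_connOp {α : Form n M} (hα : IsSmoothForm α) {x : M} (c : CoordDomain n M)
    (hx : x ∈ c.s) {F : FField n M} (hF : SmoothCoeffOn (toChart c.φ F) c.s) :
    toChart c.φ (nablaBar D α F) x = connOp c.deriv ⟨x, hx⟩ (fun s => dx c.φ s x (sharp P α x))
      (fun j k => - D.toFun α (dfun (c.f j)) x (frame c.φ k x)) (ofField _ hF) := by
  -- The domain `b` uses the preferred chart at x, in which ∇̄ is defined at x; the comparison with
  -- `c` takes place on the overlap.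
  obtain ⟨b, hb, hxb⟩ := CoordDomain.exists_mem
    (IsManifold.chart_mem_maximalAtlas (I := 𝓡 n) (n := ∞) x) (mem_chart_source _ x)
  have ht : IsOpen (c.s ∩ b.s) := c.isOpen.inter b.isOpen
  have hsub : c.s ∩ b.s ⊆ c.φ.source ∩ b.φ.source := Set.inter_subset_inter c.subset b.subset
  have hF' : SmoothCoeffOn (toChart c.φ F) (c.s ∩ b.s) := hF.mono Set.inter_subset_left
  have hFb : SmoothCoeffOn (toChart b.φ F) (c.s ∩ b.s) := smoothCoeffOn_toChart c.mem b.mem hsub hF'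
  have hx' : x ∈ c.s ∩ b.s := ⟨hx, hxb⟩
  have hres := (connOp_chartDeriv_ofField ⟨x, hx⟩ (fun s => dx c.φ s x (sharp P α x))
      (fun j k => - D.toFun α (dfun (c.f j)) x (frame c.φ k x)) c.mem c.isOpen c.subset hF).trans
      (connOp_chartDeriv_ofField ⟨x, hx'⟩ _ _ c.mem ht
        (Set.inter_subset_left.trans c.subset) hF').symm
  refine Eq.trans ?_ hres.symm
  rw [toChart_eq, nablaBar_eq_connOp D hα b hb ht Set.inter_subset_right hx' hFb]
  have hloc : ofField _ hFb = linHom (transition c.mem b.mem hsub) (ofField _ hF') :=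
    ext_evS fun y => by
      rw [evS_transition c.mem b.mem hsub y F _ (evS_ofField _ _ _), evS_ofField]
  rw [hloc]
  set T : MvPowerSeries (Fin n) ℝ →ₐ[ℝ] MvPowerSeries (Fin n) ℝ :=
    linHom (fun i k => dx c.φ k x (stdVec x i)) with hT
  have hTe : ∀ G : MvPowerSeries (Fin n) (smoothRing n (c.s ∩ b.s)),
      T (evS ⟨x, hx'⟩ (linHom (transition c.mem b.mem hsub) G)) = evS ⟨x, hx'⟩ G := by
    intro G
    have h1 := evS_transition c.mem b.mem hsub ⟨x, hx'⟩ (fromChart c.φ (toField G)) G (by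
      rw [toChart_fromChart c.mem (hsub hx').1, toField_of_mem G hx'])
    have h2 := toChart_chartAt_self (fromChart c.φ (toField G)) x
    rw [← hb] at h2
    rw [h1, h2, hT, ← toChart_eq, toChart_fromChart c.mem (hsub hx').1, toField_of_mem G hx']
  have hC : ∀ (e : CoordDomain n M) (he : c.s ∩ b.s ⊆ e.s) (r : smoothRing n (c.s ∩ b.s)),
      ∑ s, dx e.φ s x (sharp P α x) *
          ev ⟨x, hx'⟩ (chartDeriv e.mem ht (he.trans e.subset) s r) =
        dfun (n := n) (extendZero (c.s ∩ b.s) r.1) x (sharp P α x) := by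
    intro e he r
    rw [covector_apply_eq_sum e.mem (e.subset (he hx')) _ (sharp P α x)]
    exact Finset.sum_congr rfl fun s _ => mul_comm _ _
  rw [← sub_eq_zero]
  -- Both expressions are derivations along evaluation at x. On constants both differentiate along
  -- #α; on fibre coordinates the transformation law of the Christoffel symbols is needed.
  refine eq_zero_of_leibniz (evS (⟨x, hx'⟩ : (c.s ∩ b.s : Set M))) (fun k => by simp)
    (fun G => T (connOp (chartDeriv b.mem ht (Set.inter_subset_right.trans b.subset)) ⟨x, hx'⟩
      (fun s => dx b.φ s x (sharp P α x))
      (fun j k => - D.toFun α (dfun (b.f j)) x (frame b.φ k x))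
        (linHom (transition c.mem b.mem hsub) G)) -
      connOp (chartDeriv c.mem ht (Set.inter_subset_left.trans c.subset)) ⟨x, hx'⟩
      (fun s => dx c.φ s x (sharp P α x))
      (fun j k => - D.toFun α (dfun (c.f j)) x (frame c.φ k x)) G) ?_ ?_ ?_ ?_ (ofField _ hF')
  · intro F G
    rw [map_add (linHom _), connOp_add, connOp_add, map_add]
    ring
  · intro F G
    rw [map_mul (linHom _), connOp_mul, connOp_mul, map_add, map_mul, map_mul, hTe, hTe]
    ring
  · intro r
    rw [linHom_C, connOp_C, connOp_C, hT, linHom_C, ← map_sub, hC b Set.inter_subset_right,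
      hC c Set.inter_subset_left, sub_self, map_zero]
  · intro k
    have hxφ : x ∈ c.φ.source := c.subset hx
    have hxb' : x ∈ b.φ.source := b.subset hxb
    set G : Fin n → ℝ := fun i => D.toFun α (dfun (c.f i)) x (frame c.φ k x) with hG
    set E : Fin n → ℝ := fun l =>
      dfun (n := n) (fun y => dx b.φ l y (frame c.φ k y)) x (sharp P α x) with hE
    have h1 : ∀ l, ∑ s, dx b.φ s x (sharp P α x) * ev ⟨x, hx'⟩
        (chartDeriv b.mem ht (Set.inter_subset_right.trans b.subset) s
          (transition c.mem b.mem hsub k l)) = E l := by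
      intro l
      rw [hC b Set.inter_subset_right, hE, dfun_congr]
      filter_upwards [ht.mem_nhds hx'] with y hy
      exact extendZero_restrict (fun y => dx b.φ l y (frame c.φ k y)) hy
    -- The Leibniz rule of ∇ gives the inhomogeneous term E. It cancels the term that arises when ∇̄
    -- differentiates the transition matrix.
    have h2 : ∀ j, D.toFun α (dfun (b.f j)) x (frame c.φ k x) =
        ∑ i, dx b.φ j x (frame c.φ i x) * G i + E j := by
      intro j
      have h3 := congrArg (fun β : Cot (n := n) x => β (frame c.φ k x))
        (D.apply_right c hα (isSmoothForm_dfun (b.f j)) hx)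
      simp only [sum_apply, add_apply, smul_apply, smul_eq_mul, Finset.sum_add_distrib,
        dx_frame c.mem hxφ, mul_ite, mul_one, mul_zero, Finset.sum_ite_eq', Finset.mem_univ,
        if_true, b.dfun_f j hxb] at h3
      rw [h3]
      congr 1
      rw [hE, dfun_congr]
      filter_upwards [ht.mem_nhds hx'] with y hy
      rw [b.dfun_f j hy.2]
    have h4 : connOp (chartDeriv b.mem ht (Set.inter_subset_right.trans b.subset)) ⟨x, hx'⟩
        (fun s => dx b.φ s x (sharp P α x))
        (fun j k => - D.toFun α (dfun (b.f j)) x (frame b.φ k x))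
        (linHom (transition c.mem b.mem hsub) (MvPowerSeries.X k)) =
        - ∑ j, (∑ i, dx b.φ j x (frame c.φ i x) * G i) • MvPowerSeries.X j := by
      rw [linHom_X, linSubst]
      refine (map_sum (AddMonoidHom.mk' _ (connOp_add _ _ _ _)) _ _).trans ?_
      simp only [AddMonoidHom.mk'_apply, MvPowerSeries.smul_eq_C_mul, connOp_mul, connOp_X,
        connOp_C, h1, evS_C, evS_X, Finset.sum_add_distrib, Finset.mul_sum]
      rw [Finset.sum_comm, ← Finset.sum_add_distrib, ← Finset.sum_neg_distrib]
      refine Finset.sum_congr rfl fun j _ => ?_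
      have h5 : ∑ l, dx b.φ l x (frame c.φ k x) * - D.toFun α (dfun (b.f j)) x (frame b.φ l x) =
          - D.toFun α (dfun (b.f j)) x (frame c.φ k x) := by
        conv_rhs => rw [vector_eq_sum b.mem hxb' (frame c.φ k x)]
        simp
      have h6 : ∑ i, dx b.φ j x (frame c.φ i x) * G i =
          - (∑ l, dx b.φ l x (frame c.φ k x) * - D.toFun α (dfun (b.f j)) x (frame b.φ l x) + E j) := by
        rw [h5, h2]; ring
      rw [h6]
      simp only [transition, ev_ofSmooth, ← mul_assoc, ← map_mul]
      rw [← Finset.sum_mul, ← map_sum, map_neg, map_add]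
      ring
    rw [h4, connOp_X, hT]
    simp only [map_neg, map_sum, map_smul, linHom_X, linSubst, Finset.smul_sum, smul_smul]
    rw [Finset.sum_comm, ← Finset.sum_neg_distrib, ← Finset.sum_sub_distrib]
    refine Finset.sum_eq_zero fun l _ => ?_
    rw [← Finset.sum_smul, ← neg_smul, ← sub_smul]
    convert zero_smul ℝ _
    simp only [Finset.sum_mul]
    rw [Finset.sum_comm]
    have h7 : ∀ i, ∑ j, dx b.φ j x (frame c.φ i x) * G i * dx c.φ l x (stdVec x j) =
        G i * (if l = i then 1 else 0) := by
      intro i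
      rw [← dx_frame c.mem hxφ l i]
      conv_rhs => rw [stdCovec_eq_sum x (frame c.φ i x)]
      simp only [hb, dx_chartAt_self, map_sum, map_smul, smul_eq_mul, Finset.mul_sum]
      exact Finset.sum_congr rfl fun j _ => by ring
    simp only [h7]
    simp [hG]

end NablaBar

/-! ### The global connection and its curvature expressed in the local model. -/

section LocalNabla

open Filter Topology smoothRing

variable {n : ℕ} {M : Type*} [TopologicalSpace M] [ChartedSpace (EuclideanSpace ℝ (Fin n)) M]

/-- `G` is the expression of the formal function `F` in the coordinates of `c`. -/
def CoordDomain.Expr (c : CoordDomain n M) (G : MvPowerSeries (Fin n) (smoothRing n c.s))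
    (F : FField n M) : Prop := ∀ x : c.s, toChart c.φ F x = evS x G

namespace CoordDomain

variable {c : CoordDomain n M} {G : MvPowerSeries (Fin n) (smoothRing n c.s)} {F : FField n M}

lemma Expr.smoothCoeffOn (h : c.Expr G F) : SmoothCoeffOn (toChart c.φ F) c.s :=
  (smoothCoeffOn_toField G).congr fun x hx => by rw [toField_of_mem G hx]; exact h ⟨x, hx⟩

lemma expr_ofField (hF : SmoothCoeffOn (toChart c.φ F) c.s) : c.Expr (ofField _ hF) F :=
  fun x => (evS_ofField _ hF x).symm

lemma Expr.ofField_eq (h : c.Expr G F) : ofField _ h.smoothCoeffOn = G :=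
  ext_evS fun x => by rw [evS_ofField, h x]

lemma Expr.sub {G' : MvPowerSeries (Fin n) (smoothRing n c.s)} {F' : FField n M}
    (h : c.Expr G F) (h' : c.Expr G' F') : c.Expr (G - G') (F - F') := by
  intro x
  rw [map_sub, ← h x, ← h' x, toChart_eq, toChart_eq, toChart_eq, ← map_sub]
  rfl

variable [IsManifold (𝓡 n) ∞ M] {P : PoissonStructure n M} {D D' : ContravariantConnection P}
  {hassoc : Associated D D'} {htor : TorsionFree D'}

/-- Shrinking the domain changes the coefficient ring, so the two models are compared pointwise;
only values and first derivatives at the point occur. -/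
lemma ev_curvCoeff_restrict {t : Set M} (ht : IsOpen t) (htc : t ⊆ c.s)
    (x : (c.restrict t ht htc).s) (i j l k : Fin n) :
    ev x (((c.restrict t ht htc).model D D' hassoc htor).curvCoeff i j l k) =
      ev (⟨x, htc x.2⟩ : c.s) ((c.model D D' hassoc htor).curvCoeff i j l k) := by
  set L := c.model D D' hassoc htor
  set L' := (c.restrict t ht htc).model D D' hassoc htor
  have hπ : ∀ i j, ev x (L'.π i j) = ev (⟨x, htc x.2⟩ : c.s) (L.π i j) := fun i j => rfl
  have hΓ : ∀ i j k, ev x (L'.Γ i j k) = ev (⟨x, htc x.2⟩ : c.s) (L.Γ i j k) := fun i j k => rfl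
  have hδπ : ∀ s i j, ev x (L'.δ s (L'.π i j)) = ev (⟨x, htc x.2⟩ : c.s) (L.δ s (L.π i j)) :=
    fun s i j => ((c.restrict t ht htc).ev_deriv_poisson s i j x).trans
      (c.ev_deriv_poisson s i j ⟨x, htc x.2⟩).symm
  have h : ∀ (e : CoordDomain n M) (x : e.s) (s i j k : Fin n),
      ev x (e.deriv s (e.christoffelSymbol D i j k)) = dfun (n := n)
        (fun y => - D.toFun (dfun (e.f i)) (dfun (e.f j)) y (frame e.φ k y)) x (frame e.φ s x) :=
    fun e x s i j k => e.ev_deriv_ofSmooth s _ _ x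
  have hδΓ : ∀ s i j k,
      ev x (L'.δ s (L'.Γ i j k)) = ev (⟨x, htc x.2⟩ : c.s) (L.δ s (L.Γ i j k)) :=
    fun s i j k => (h (c.restrict t ht htc) x s i j k).trans (h c ⟨x, htc x.2⟩ s i j k).symm
  simp only [LocalModel.curvCoeff, map_sum, map_add, map_sub, map_mul, hπ, hΓ, hδπ, hδΓ]

variable [T2Space M]

lemma Expr.toChart_nablaBar (h : c.Expr G F) {α : Form n M} (hα : IsSmoothForm α) (x : c.s) :
    toChart c.φ (nablaBar D α F) x =
      ∑ i, α x (frame c.φ i x) • evS x ((c.model D D' hassoc htor).nabla i G) := by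
  rw [toChart_nablaBar_eq_connOp D hα c x.2 h.smoothCoeffOn, h.ofField_eq, connOp]
  have h1 : ∀ s, dx c.φ s x (sharp P α x) =
      ∑ i, α x (frame c.φ i x) * ev x (c.poisson P i s) := by
    intro s
    rw [apply_sharp]
    conv_lhs => rw [covector_eq_sum c.mem (c.subset x.2) (α x)]
    simp only [map_sum, map_smul, LinearMap.sum_apply, LinearMap.smul_apply, smul_eq_mul,
      ev_poisson', PoissonStructure.comp]
  have h2 : ∀ j k, - D.toFun α (dfun (c.f j)) x (frame c.φ k x) =
      ∑ i, α x (frame c.φ i x) * ev x (c.christoffelSymbol D i j k) := by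
    intro j k
    rw [D.apply_left c hα (isSmoothForm_dfun (c.f j)) x.2]
    simp [ev_christoffelSymbol]
  have h3 : ∀ i, evS x ((c.model D D' hassoc htor).nabla i G) =
      ∑ s, ev x (c.poisson P i s) • evS x (coeffDerivation (c.deriv s) G) +
        ∑ k, ∑ j, ev x (c.christoffelSymbol D i j k) •
          (MvPowerSeries.X j * MvPowerSeries.pderiv ℝ k (evS x G)) := by
    intro i
    simp only [LocalModel.nabla_apply, LocalModel.christoffel, map_add, map_sum, map_mul, evS_C,
      evS_X, evS_pderiv, MvPowerSeries.smul_eq_C_mul, Finset.sum_mul, mul_assoc]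
    rfl
  simp only [h1, h2, h3, smul_add, Finset.sum_add_distrib, Finset.sum_smul, Finset.smul_sum,
    mul_smul]
  congr 1
  · exact Finset.sum_comm
  · rw [Finset.sum_comm]
    exact (Finset.sum_congr rfl fun k _ => Finset.sum_comm).trans Finset.sum_comm

lemma Expr.nablaBar_dfun_f (h : c.Expr G F) (i : Fin n) :
    c.Expr ((c.model D D' hassoc htor).nabla i G) (nablaBar D (dfun (c.f i)) F) := by
  intro x
  rw [h.toChart_nablaBar (hassoc := hassoc) (htor := htor) (isSmoothForm_dfun _)]
  simp [c.dfun_f _ x.2, dx_frame c.mem (c.subset x.2)]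

lemma Expr.nablaBar_dfun_poissonBracket (h : c.Expr G F) (i j : Fin n) :
    c.Expr (∑ s, MvPowerSeries.C (c.deriv s (c.poisson P i j)) *
      (c.model D D' hassoc htor).nabla s G)
      (nablaBar D (dfun (poissonBracket P (c.f i) (c.f j))) F) := by
  intro x
  rw [h.toChart_nablaBar (hassoc := hassoc) (htor := htor) (isSmoothForm_dfun _)]
  simp only [map_sum, map_mul, evS_C, ev_deriv_poisson, MvPowerSeries.smul_eq_C_mul]

/-- The curvature in the coordinates of a chart. -/
lemma toChart_curvatureBar (x : c.s) (i j m : Fin n) :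
    toChart c.φ (fun y => curvatureBar D (dfun (c.f i)) (dfun (c.f j)) y (frame c.φ m y)) x =
      evS x ((c.model D D' hassoc htor).curv i j (MvPowerSeries.X m)) := by
  set ψ := chartAt (EuclideanSpace ℝ (Fin n)) (x : M) with hψdef
  have hψ : ψ ∈ Charts n M := IsManifold.chart_mem_maximalAtlas (x : M)
  have hxψ : (x : M) ∈ ψ.source := mem_chart_source _ _
  have hxφ : (x : M) ∈ c.φ.source := c.subset x.2
  -- The curvature at x is defined on the fibre coordinates of the preferred chart. On the common
  -- domain these are `R`-linear combinations of those of `c`, and the local curvature is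
  -- `R`-linear.
  let e := c.restrict (c.s ∩ ψ.source) (c.isOpen.inter ψ.open_source) Set.inter_subset_left
  let y : e.s := ⟨x, x.2, hxψ⟩
  let L := e.model D D' hassoc htor
  have hsub : e.s ⊆ ψ.source ∩ c.φ.source := fun z hz => ⟨hz.2, c.subset hz.1⟩
  have hG : ∀ k, e.Expr (linSubst (transition hψ c.mem hsub) k) (fibreCoord ψ k) := by
    intro k z
    rw [toChart_eq, fibreCoord, toChart_hat, linSubst, map_sum]
    refine Finset.sum_congr rfl fun l _ => ?_
    rw [MvPowerSeries.smul_eq_C_mul, MvPowerSeries.smul_eq_C_mul, map_mul, evS_C, evS_X]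
    rfl
  have hR : ∀ k, toChart c.φ (nablaBar D (dfun (c.f i)) (nablaBar D (dfun (c.f j)) (fibreCoord ψ k))
      - nablaBar D (dfun (c.f j)) (nablaBar D (dfun (c.f i)) (fibreCoord ψ k))
      - nablaBar D (formBracket P (dfun (c.f i)) (dfun (c.f j))) (fibreCoord ψ k)) x =
      ∑ l, dx c.φ l x (frame ψ k x) • evS y (L.curv i j (MvPowerSeries.X l)) := by
    intro k
    have h1 := fun i => (hG k).nablaBar_dfun_f (D := D) (hassoc := hassoc) (htor := htor) i
    have h2 := fun i j => (h1 j).nablaBar_dfun_f (D := D) (hassoc := hassoc) (htor := htor) i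
    have h3 := (((h2 i j).sub (h2 j i)).sub
      ((hG k).nablaBar_dfun_poissonBracket (hassoc := hassoc) (htor := htor) i j)) y
    rw [formBracket_dfun]
    refine h3.trans ?_
    refine (congrArg (evS y) (L.curv_apply i j _).symm).trans ?_
    rw [linSubst, map_sum, map_sum]
    refine Finset.sum_congr rfl fun l _ => ?_
    rw [MvPowerSeries.smul_eq_C_mul, MvPowerSeries.smul_eq_C_mul, LocalModel.curv_C_mul, map_mul,
      evS_C]
    rfl
  have h1 : toChart c.φ (fun y => curvatureBar D (dfun (c.f i)) (dfun (c.f j)) y (frame c.φ m y)) x =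
      ∑ k, dx ψ k x (frame c.φ m x) • ∑ l, dx c.φ l x (frame ψ k x) •
        evS y (L.curv i j (MvPowerSeries.X l)) := by
    simp only [← hR]
    simp only [toChart_eq, curvatureBar, LinearMap.sum_apply, LinearMap.smulRight_apply, map_sum,
      map_smul]
    rfl
  have h2 : ∀ l, evS y (L.curv i j (MvPowerSeries.X l)) =
      evS x ((c.model D D' hassoc htor).curv i j (MvPowerSeries.X l)) := by
    intro l
    simp only [LocalModel.curv_X, map_sum, map_mul, evS_C, evS_X]
    refine Finset.sum_congr rfl fun r _ => ?_
    exact congrArg (fun a => MvPowerSeries.C a * MvPowerSeries.X r) (ev_curvCoeff_restrict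
      (hassoc := hassoc) (htor := htor) (c.isOpen.inter ψ.open_source) Set.inter_subset_left y i j r l)
  rw [h1]
  simp only [h2, Finset.smul_sum, smul_smul]
  rw [Finset.sum_comm]
  have h3 : ∀ l, ∑ k, dx ψ k x (frame c.φ m x) * dx c.φ l x (frame ψ k x) =
      if l = m then 1 else 0 := by
    intro l
    rw [← dx_frame c.mem hxφ l m]
    conv_rhs => rw [vector_eq_sum hψ hxψ (frame c.φ m x)]
    simp
  simp only [← Finset.sum_smul, h3]
  simp

end CoordDomain

end LocalNabla

/-! ### Fibrewise Hamiltonian fields and the bracket at a point. -/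

section Hamiltonian

open Filter Topology smoothRing

variable {n : ℕ} {M : Type*} [TopologicalSpace M] [ChartedSpace (EuclideanSpace ℝ (Fin n)) M]

/-- The substitution which expresses a formal power series on the fibre at `x` in the coordinates
of the chart `φ`. -/
abbrev chartHom (φ : OpenPartialHomeomorph M (EuclideanSpace ℝ (Fin n))) (x : M) :
    MvPowerSeries (Fin n) ℝ →ₐ[ℝ] MvPowerSeries (Fin n) ℝ :=
  linHom (fun i k => dx φ k x (stdVec x i))

/-- The vector field with values `w` is Hamiltonian with Hamiltonian `G` on the fibre at `x`. -/
def IsHamAt (P : PoissonStructure n M) (x : M) (G : MvPowerSeries (Fin n) ℝ)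
    (w : TangentSpace (𝓡 n) x →ₗ[ℝ] MvPowerSeries (Fin n) ℝ) : Prop :=
  ∀ γ : Cot (n := n) x, ∑ l, γ (stdVec x l) • MvPowerSeries.pderiv ℝ l G =
    ∑ k, P.bivector x γ (stdCovec x k) • w (stdVec x k)

/-- The derivative of `G` along a vertical vector field on the fibre at `x`. -/
def actAt (x : M) (w : TangentSpace (𝓡 n) x →ₗ[ℝ] MvPowerSeries (Fin n) ℝ) :
    Derivation ℝ (MvPowerSeries (Fin n) ℝ) (MvPowerSeries (Fin n) ℝ) :=
  vert fun k => w (stdVec x k)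

lemma actAt_apply (x : M) (w : TangentSpace (𝓡 n) x →ₗ[ℝ] MvPowerSeries (Fin n) ℝ)
    (G : MvPowerSeries (Fin n) ℝ) :
    actAt x w G = ∑ k, w (stdVec x k) * MvPowerSeries.pderiv ℝ k G := vert_apply _ _

lemma omega_eq_sum (P : PoissonStructure n M) (H K : VertField n M) (x : M) :
    Omega P H K x = - ∑ j, K x (stdVec x j) *
      ∑ i, P.bivector x (stdCovec x j) (stdCovec x i) • H x (stdVec x i) := by
  simp only [Omega, Finset.mul_sum]
  rw [Finset.sum_comm, ← Finset.sum_neg_distrib]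
  refine Finset.sum_congr rfl fun i _ => ?_
  rw [← Finset.sum_neg_distrib]
  refine Finset.sum_congr rfl fun j _ => ?_
  rw [bivector_antisymm P x (stdCovec x j), mul_smul_comm, neg_smul, mul_comm]

variable [IsManifold (𝓡 n) ∞ M] {φ : OpenPartialHomeomorph M (EuclideanSpace ℝ (Fin n))}

lemma chartHom_injective (hφ : φ ∈ Charts n M) {x : M} (hx : x ∈ φ.source) :
    Function.Injective (chartHom φ x) := by
  intro F G h
  exact toChart_injective (F := fun _ => F) (G := fun _ => G) hφ hx
    (by rw [toChart_eq, toChart_eq]; exact h)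

lemma chartHom_actAt (hφ : φ ∈ Charts n M) {x : M} (hx : x ∈ φ.source)
    (w : TangentSpace (𝓡 n) x →ₗ[ℝ] MvPowerSeries (Fin n) ℝ) (G : MvPowerSeries (Fin n) ℝ) :
    chartHom φ x (actAt x w G) = vert (fun k => chartHom φ x (w (frame φ k x))) (chartHom φ x G) := by
  rw [actAt_apply, vert_apply, map_sum]
  simp only [pderiv_linHom, Finset.mul_sum]
  rw [Finset.sum_comm]
  refine Finset.sum_congr rfl fun i _ => ?_
  conv_lhs => rw [vector_eq_sum hφ hx (stdVec x i)]
  simp [Finset.sum_mul]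

lemma sum_bivector_smul (P : PoissonStructure n M) (hφ : φ ∈ Charts n M) {x : M} (hx : x ∈ φ.source)
    (w : TangentSpace (𝓡 n) x →ₗ[ℝ] MvPowerSeries (Fin n) ℝ) (γ : Cot (n := n) x) :
    ∑ k, P.bivector x γ (stdCovec x k) • w (stdVec x k) =
      ∑ k, P.bivector x γ (dx φ k x) • w (frame φ k x) := by
  have h : ∀ k, P.bivector x γ (stdCovec x k) =
      ∑ l, stdCovec x k (frame φ l x) * P.bivector x γ (dx φ l x) := by
    intro k
    conv_lhs => rw [covector_eq_sum hφ hx (stdCovec x k)]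
    simp
  simp only [h, Finset.sum_smul]
  rw [Finset.sum_comm]
  refine Finset.sum_congr rfl fun l _ => ?_
  conv_rhs => rw [stdCovec_eq_sum x (frame φ l x)]
  simp [Finset.smul_sum, smul_smul, mul_comm]

/-- The condition is tensorial in γ and w, so it can be tested on the coordinate frames of any
chart. -/
lemma isHamAt_iff {P : PoissonStructure n M} (hφ : φ ∈ Charts n M) {x : M} (hx : x ∈ φ.source)
    {G : MvPowerSeries (Fin n) ℝ} {w : TangentSpace (𝓡 n) x →ₗ[ℝ] MvPowerSeries (Fin n) ℝ} :
    IsHamAt P x G w ↔ ∀ l, MvPowerSeries.pderiv ℝ l (chartHom φ x G) =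
      ∑ k, P.comp φ l k x • chartHom φ x (w (frame φ k x)) := by
  have h1 : ∀ l, MvPowerSeries.pderiv ℝ l (chartHom φ x G) =
      chartHom φ x (∑ i, dx φ l x (stdVec x i) • MvPowerSeries.pderiv ℝ i G) := by
    intro l
    rw [pderiv_linHom, map_sum]
    simp
  have h2 : ∀ l, ∑ k, P.comp φ l k x • chartHom φ x (w (frame φ k x)) =
      chartHom φ x (∑ k, P.bivector x (dx φ l x) (stdCovec x k) • w (stdVec x k)) := by
    intro l
    rw [sum_bivector_smul P hφ hx, map_sum]
    simp [PoissonStructure.comp]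
  simp only [h1, h2, (chartHom_injective hφ hx).eq_iff]
  constructor
  · exact fun h l => h _
  · intro h γ
    have h3 := covector_eq_sum hφ hx γ
    have h4 : ∀ i, γ (stdVec x i) = ∑ l, γ (frame φ l x) * dx φ l x (stdVec x i) := fun i => by
      conv_lhs => rw [h3]
      simp
    have h5 : ∀ k, P.bivector x γ (stdCovec x k) =
        ∑ l, γ (frame φ l x) * P.bivector x (dx φ l x) (stdCovec x k) := fun k => by
      conv_lhs => rw [h3]
      simp
    simp only [h4, h5, Finset.sum_smul, mul_smul]
    refine Finset.sum_comm.trans (Eq.trans ?_ Finset.sum_comm)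
    refine Finset.sum_congr rfl fun l _ => ?_
    rw [← Finset.smul_sum, ← Finset.smul_sum, h l]

lemma chartHom_chartAt_self (x : M) (G : MvPowerSeries (Fin n) ℝ) :
    chartHom (chartAt (EuclideanSpace ℝ (Fin n)) x) x G = G := by
  have := toChart_chartAt_self (fun _ => G) x
  rwa [toChart_eq] at this

lemma isHamAt_iff_std {P : PoissonStructure n M} {x : M}
    {G : MvPowerSeries (Fin n) ℝ} {w : TangentSpace (𝓡 n) x →ₗ[ℝ] MvPowerSeries (Fin n) ℝ} :
    IsHamAt P x G w ↔ ∀ l, MvPowerSeries.pderiv ℝ l G =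
      ∑ k, P.bivector x (stdCovec x l) (stdCovec x k) • w (stdVec x k) := by
  rw [isHamAt_iff (IsManifold.chart_mem_maximalAtlas x) (mem_chart_source _ x)]
  simp only [chartHom_chartAt_self, PoissonStructure.comp, dx_chartAt_self, frame_chartAt_self]

lemma actAt_swap {P : PoissonStructure n M} {x : M} {F G : MvPowerSeries (Fin n) ℝ}
    {w z : TangentSpace (𝓡 n) x →ₗ[ℝ] MvPowerSeries (Fin n) ℝ} (hF : IsHamAt P x F w)
    (hG : IsHamAt P x G z) : actAt x w G = - actAt x z F := by
  rw [actAt_apply, actAt_apply]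
  simp only [isHamAt_iff_std.1 hF, isHamAt_iff_std.1 hG, Finset.mul_sum]
  rw [Finset.sum_comm, ← Finset.sum_neg_distrib]
  refine Finset.sum_congr rfl fun i _ => ?_
  rw [← Finset.sum_neg_distrib]
  refine Finset.sum_congr rfl fun j _ => ?_
  rw [bivector_antisymm P x (stdCovec x j), mul_smul_comm, mul_smul_comm, neg_smul, mul_comm]

/-- Testing against the constant fields ∂/∂ξ_l recovers each component of the equation. -/
lemma forall_omega_eq_iff {P : PoissonStructure n M} {F : FField n M} {H : VertField n M} :
    (∀ K : VertField n M, Omega P H K = - K.act F) ↔ ∀ x, IsHamAt P x (F x) (H x) := by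
  simp only [isHamAt_iff_std]
  constructor
  · intro h x l
    have h1 := congrFun (h fun y => LinearMap.smulRight
      ((stdCovec y l : Cot (n := n) y) : TangentSpace (𝓡 n) y →ₗ[ℝ] ℝ) 1) x
    rw [omega_eq_sum] at h1
    simpa [VertField.act, stdCovec_stdVec] using h1.symm
  · intro h K
    funext x
    rw [omega_eq_sum]
    simp only [VertField.act, Pi.neg_apply, h]

lemma IsHamiltonianField.isHamAt {P : PoissonStructure n M} {F : FField n M} {H : VertField n M}
    (h : IsHamiltonianField P F H) (x : M) : IsHamAt P x (F x) (H x) :=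
  forall_omega_eq_iff.1 h.eq x

/-- Any field that is Hamiltonian on the one fibre over x computes the bracket there: the swap -H_G
F no longer involves the field of F. -/
lemma bracketOmega_apply {P : PoissonStructure n M} {F G : FField n M} {H K : VertField n M}
    (hF : IsHamiltonianField P F H) (hG : IsHamiltonianField P G K) {x : M}
    {w : TangentSpace (𝓡 n) x →ₗ[ℝ] MvPowerSeries (Fin n) ℝ} (hw : IsHamAt P x (F x) w) :
    bracketOmega P F G x = actAt x w (G x) := by
  rw [(bracketOmega_eq hF hG).2.1, actAt_swap hw (hG.isHamAt x), actAt_apply]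
  rfl

end Hamiltonian

/-! ### Gluing local Hamiltonian fields. -/

section Patch

open Filter Topology smoothRing

variable {n : ℕ} {M : Type*} [TopologicalSpace M] [ChartedSpace (EuclideanSpace ℝ (Fin n)) M]

/-- The vertical field with the coefficients `a` in the coordinates of `c`. -/
def CoordDomain.vertField (c : CoordDomain n M)
    (a : Fin n → MvPowerSeries (Fin n) (smoothRing n c.s)) : VertField n M := fun y =>
  ∑ k, LinearMap.smulRight ((dx c.φ k y : Cot (n := n) y) : TangentSpace (𝓡 n) y →ₗ[ℝ] ℝ)
    (fromChart c.φ (toField (a k)) y)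

variable [IsManifold (𝓡 n) ∞ M]

lemma CoordDomain.chartHom_vertField (c : CoordDomain n M)
    (a : Fin n → MvPowerSeries (Fin n) (smoothRing n c.s)) (y : c.s)
    (w : TangentSpace (𝓡 n) (y : M)) :
    chartHom c.φ y (c.vertField a y w) = ∑ k, dx c.φ k y w • evS y (a k) := by
  simp only [vertField, LinearMap.sum_apply, LinearMap.smulRight_apply, map_sum, map_smul]
  refine Finset.sum_congr rfl fun k _ => ?_
  rw [chartHom, ← toChart_eq, toChart_fromChart c.mem (c.subset y.2), toField_of_mem _ y.2]
  rfl

lemma CoordDomain.smoothCoeffOn_vertField (c : CoordDomain n M)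
    (a : Fin n → MvPowerSeries (Fin n) (smoothRing n c.s))
    {φ : OpenPartialHomeomorph M (EuclideanSpace ℝ (Fin n))} (hφ : φ ∈ Charts n M) (k : Fin n) :
    SmoothCoeffOn (toChart φ fun y => c.vertField a y (frame φ k y)) (c.s ∩ φ.source) := by
  have ht : c.s ∩ φ.source ⊆ c.φ.source ∩ φ.source := Set.inter_subset_inter_left _ c.subset
  refine smoothCoeffOn_toChart c.mem hφ ht fun m => ?_
  have h : ContMDiffOn (𝓡 n) 𝓘(ℝ, ℝ) ∞ (fun y => ∑ l, dx c.φ l y (frame φ k y) *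
      MvPowerSeries.coeff m (toField (a l) y)) (c.s ∩ φ.source) :=
    contMDiffOn_finsetSum fun l _ => ((contMDiffOn_dx_frame hφ c.mem k l).mono
      (fun y hy => ⟨hy.2, c.subset hy.1⟩)).mul
      ((smoothCoeffOn_toField (a l) m).mono Set.inter_subset_left)
  refine h.congr fun y hy => ?_
  have := c.chartHom_vertField a ⟨y, hy.1⟩ (frame φ k y)
  rw [toChart_eq]
  refine (congrArg (MvPowerSeries.coeff m) this).trans ?_
  simp [toField_of_mem _ hy.1]

/-- `F` has the Hamiltonian vertical field with coefficients `a` in the coordinates of `c`. -/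
def CoordDomain.HamOn (c : CoordDomain n M) (P : PoissonStructure n M) (F : FField n M)
    (a : Fin n → MvPowerSeries (Fin n) (smoothRing n c.s)) : Prop :=
  ∀ (y : c.s) (l : Fin n), MvPowerSeries.pderiv ℝ l (toChart c.φ F y) =
    ∑ k, P.comp c.φ l k y • evS y (a k)

lemma CoordDomain.HamOn.isHamAt {c : CoordDomain n M} {P : PoissonStructure n M} {F : FField n M}
    {a : Fin n → MvPowerSeries (Fin n) (smoothRing n c.s)} (h : c.HamOn P F a) (y : c.s) :
    IsHamAt P y (F y) (c.vertField a y) := by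
  rw [isHamAt_iff c.mem (c.subset y.2)]
  intro l
  rw [← toChart_eq, h]
  simp [c.chartHom_vertField, dx_frame c.mem (c.subset y.2)]

/-- For fixed F the condition on the field is affine and pointwise, so a partition of unity combines
local fields into a global one. -/
lemma exists_isHamiltonianField [T2Space M] [SecondCountableTopology M] {P : PoissonStructure n M}
    {F : FField n M} (h : ∀ x, ∃ c : CoordDomain n M, x ∈ c.s ∧ ∃ a, c.HamOn P F a) :
    ∃ H, IsHamiltonianField P F H := by
  have : LocallyCompactSpace M := ChartedSpace.locallyCompactSpace (EuclideanSpace ℝ (Fin n)) M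
  choose c hc a ha using h
  obtain ⟨ρ, hρ⟩ := SmoothPartitionOfUnity.exists_isSubordinate (𝓡 n) isClosed_univ
    (fun x => (c x).s) (fun x => (c x).isOpen) (fun x _ => Set.mem_iUnion.2 ⟨x, hc x⟩)
  refine ⟨fun y => ∑ i ∈ ρ.finsupport y, ρ i y • (c i).vertField (a i) y, fun φ hφ k m y hy => ?_,
    forall_omega_eq_iff.2 fun y γ => ?_⟩
  · have h1 : (fun y => MvPowerSeries.coeff m (toChart φ (fun y =>
        (∑ i ∈ ρ.finsupport y, ρ i y • (c i).vertField (a i) y) (frame φ k y)) y)) =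
        fun y => ∑ᶠ i, ρ i y • MvPowerSeries.coeff m
          (toChart φ (fun y => (c i).vertField (a i) y (frame φ k y)) y) := by
      funext y
      rw [← ρ.sum_finsupport_smul_eq_finsum y fun i y => MvPowerSeries.coeff m
          (toChart φ (fun y => (c i).vertField (a i) y (frame φ k y)) y)]
      simp [toChart_eq]
    rw [h1]
    refine (ρ.contMDiffAt_finsum fun i hi => ?_).contMDiffWithinAt
    exact ((c i).smoothCoeffOn_vertField (a i) hφ k m).contMDiffAt
      (((c i).isOpen.inter φ.open_source).mem_nhds ⟨hρ i hi, hy⟩)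
  · have h1 : ∀ i ∈ ρ.finsupport y, IsHamAt P y (F y) ((c i).vertField (a i) y) := by
      intro i hi
      exact (ha i).isHamAt ⟨y, hρ i (subset_tsupport _ ((ρ.mem_finsupport y).1 hi))⟩
    simp only [LinearMap.sum_apply, LinearMap.smul_apply, Finset.smul_sum, smul_comm _ (ρ _ _)]
    rw [Finset.sum_comm]
    have h2 : ∀ i ∈ ρ.finsupport y, ∑ k, ρ i y • P.bivector y γ (stdCovec y k) •
        (c i).vertField (a i) y (stdVec y k) =
        ρ i y • ∑ l, γ (stdVec y l) • MvPowerSeries.pderiv ℝ l (F y) := by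
      intro i hi
      rw [h1 i hi γ, Finset.smul_sum]
    rw [Finset.sum_congr rfl h2, ← Finset.sum_smul, ρ.sum_finsupport y (Set.mem_univ y), one_smul]

end Patch

/-! ### From the potentials of U to a solution over the local model. -/

section LocalPotential

open Filter Topology smoothRing

variable {n : ℕ} {M : Type*} [TopologicalSpace M] [ChartedSpace (EuclideanSpace ℝ (Fin n)) M]
  {P : PoissonStructure n M} {U : VertForm n M}

/-- The coefficients of the Hamiltonian vector field of `U(α)`. -/
def CoordDomain.evalCoeff (c : CoordDomain n M) {u : Fin n → FField n M}
    {v : Fin n → Fin n → FField n M} (h : IsLocalPotential P U c.φ u v) {α : Form n M}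
    (hα : IsSmoothForm α) (k : Fin n) : MvPowerSeries (Fin n) (smoothRing n c.s) :=
  ∑ i, MvPowerSeries.C (ofSmooth _ ((hα c.φ c.mem i).mono c.subset)) *
    ofField _ ((h.smooth_v i k).mono c.subset)

lemma CoordDomain.evS_evalCoeff (c : CoordDomain n M) {u : Fin n → FField n M}
    {v : Fin n → Fin n → FField n M} (h : IsLocalPotential P U c.φ u v) {α : Form n M}
    (hα : IsSmoothForm α) (k : Fin n) (y : c.s) :
    evS y (c.evalCoeff h hα k) = ∑ i, α y (frame c.φ i y) • v i k y := by
  simp [evalCoeff, MvPowerSeries.smul_eq_C_mul]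

variable [IsManifold (𝓡 n) ∞ M]

lemma chartHom_omega {φ : OpenPartialHomeomorph M (EuclideanSpace ℝ (Fin n))} (hφ : φ ∈ Charts n M)
    {x : M} (hx : x ∈ φ.source) (H K : VertField n M) :
    chartHom φ x (Omega P H K x) = ∑ i, ∑ j, P.comp φ i j x •
      (chartHom φ x (H x (frame φ i x)) * chartHom φ x (K x (frame φ j x))) := by
  have h1 : ∀ i, ∑ j, P.bivector x (stdCovec x i) (stdCovec x j) •
      (H x (stdVec x i) * K x (stdVec x j)) =
      ∑ j, P.bivector x (stdCovec x i) (dx φ j x) • (H x (stdVec x i) * K x (frame φ j x)) :=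
    fun i => sum_bivector_smul P hφ hx ((LinearMap.mulLeft ℝ (H x (stdVec x i))).comp (K x)) _
  have h2 : ∀ j, ∑ i, P.bivector x (stdCovec x i) (dx φ j x) •
      (H x (stdVec x i) * K x (frame φ j x)) =
      ∑ i, P.comp φ i j x • (H x (frame φ i x) * K x (frame φ j x)) := by
    intro j
    have h3 := sum_bivector_smul P hφ hx
      ((LinearMap.mulRight ℝ (K x (frame φ j x))).comp (H x)) (dx φ j x)
    rw [← neg_inj, ← Finset.sum_neg_distrib, ← Finset.sum_neg_distrib] at h3
    simp only [← neg_smul, ← bivector_antisymm P] at h3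
    exact h3
  simp only [Omega, h1]
  rw [Finset.sum_comm]
  simp only [h2]
  rw [Finset.sum_comm]
  simp

/-- The expression of `U(dx^i)` in local coordinates. -/
lemma CoordDomain.expr_eval_dfun (c : CoordDomain n M) {u : Fin n → FField n M}
    {v : Fin n → Fin n → FField n M} (h : IsLocalPotential P U c.φ u v) (i : Fin n) :
    c.Expr (∑ k, MvPowerSeries.C (c.poisson P i k) * ofField _ ((h.smooth_u k).mono c.subset))
      (U.eval (dfun (c.f i))) := by
  intro y
  have h1 := h.potential y (c.subset y.2) i
  rw [toChart_eq, VertForm.eval] at h1 ⊢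
  rw [c.dfun_f i y.2, h1]
  simp [ev_poisson', MvPowerSeries.smul_eq_C_mul]

lemma chartHom_eval {φ : OpenPartialHomeomorph M (EuclideanSpace ℝ (Fin n))} (hφ : φ ∈ Charts n M)
    {u : Fin n → FField n M} {v : Fin n → Fin n → FField n M} (h : IsLocalPotential P U φ u v)
    {y : M} (hy : y ∈ φ.source) (γ : Cot (n := n) y) :
    chartHom φ y (U y γ) = ∑ i, γ (frame φ i y) • ∑ k, P.comp φ i k y • u k y := by
  conv_lhs => rw [covector_eq_sum hφ hy γ]
  rw [map_sum, map_sum]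
  refine Finset.sum_congr rfl fun i _ => ?_
  rw [map_smul, map_smul, ← h.potential y hy, toChart_eq]
  rfl

lemma CoordDomain.hamOn_eval (c : CoordDomain n M) {u : Fin n → FField n M}
    {v : Fin n → Fin n → FField n M} (h : IsLocalPotential P U c.φ u v) {α : Form n M}
    (hα : IsSmoothForm α) : c.HamOn P (U.eval α) (c.evalCoeff h hα) := by
  intro y l
  rw [toChart_eq, VertForm.eval, ← chartHom, chartHom_eval c.mem h (c.subset y.2)]
  have h1 : ∀ i, ∑ k, P.comp c.φ i k y • MvPowerSeries.pderiv ℝ l (u k y) =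
      ∑ k, P.comp c.φ l k y • v i k y := fun i => (h.agree y (c.subset y.2) l i).symm
  simp only [map_sum, Derivation.map_smul, h1]
  simp only [evS_evalCoeff, Finset.smul_sum]
  rw [Finset.sum_comm]
  exact Finset.sum_congr rfl fun _ _ => Finset.sum_congr rfl fun _ _ => smul_comm _ _ _

variable [T2Space M]

lemma HasLocalPotentials.exists_coordDomain (hpot : HasLocalPotentials P U) (x : M) :
    ∃ c : CoordDomain n M, x ∈ c.s ∧ ∃ u v, IsLocalPotential P U c.φ u v := by
  obtain ⟨φ, hφ, hx, u, v, h⟩ := hpot x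
  obtain ⟨c, rfl, hc⟩ := CoordDomain.exists_mem hφ hx
  exact ⟨c, hc, u, v, h⟩

lemma HasLocalPotentials.exists_isHamiltonianField [SecondCountableTopology M]
    (hpot : HasLocalPotentials P U) {α : Form n M} (hα : IsSmoothForm α) :
    ∃ H, IsHamiltonianField P (U.eval α) H := by
  refine FormalLift.exists_isHamiltonianField fun x => ?_
  obtain ⟨c, hc, u, v, h⟩ := hpot.exists_coordDomain x
  exact ⟨c, hc, _, c.hamOn_eval h hα⟩

variable {D D' : ContravariantConnection P} {hassoc : Associated D D'} {htor : TorsionFree D'}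

lemma CoordDomain.chartHom_Qbar (c : CoordDomain n M) (y : c.s) (i j : Fin n) :
    chartHom c.φ y (Qbar D (dfun (c.f i)) (dfun (c.f j)) y) =
      evS y ((c.model D D' hassoc htor).q i j) := by
  have h1 : ∀ s, chartHom c.φ y (euler (y : M) (frame c.φ s y)) = MvPowerSeries.X s := by
    intro s
    rw [euler, chartHom, toChart_hat]
    simp [dx_frame c.mem (c.subset y.2)]
  have h2 : ∀ k, chartHom c.φ y (curvatureBar D (dfun (c.f i)) (dfun (c.f j)) y (frame c.φ k y)) =
      evS y ((c.model D D' hassoc htor).curv i j (MvPowerSeries.X k)) := by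
    intro k
    rw [← c.toChart_curvatureBar, toChart_eq]
  have h3 : chartHom c.φ y (Qbar D (dfun (c.f i)) (dfun (c.f j)) y) = (1 / 2 : ℝ) •
      chartHom c.φ y (Omega P euler (curvatureBar D (dfun (c.f i)) (dfun (c.f j))) y) :=
    map_smul (chartHom c.φ (y : M)) _ _
  have h4 : ∀ (r : ℝ) (G : MvPowerSeries (Fin n) (smoothRing n c.s)), evS y (r • G) = r • evS y G :=
    fun r G => rfl
  rw [h3, chartHom_omega c.mem (c.subset y.2), LocalModel.q, h4]
  simp only [h1, h2, map_sum, map_mul, evS_C, evS_X, MvPowerSeries.smul_eq_C_mul,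
    ← c.ev_poisson']
  rfl

/-- The local potentials of a solution of the Fundamental Equation. -/
def CoordDomain.potential [SecondCountableTopology M] (c : CoordDomain n M)
    {u : Fin n → FField n M} {v : Fin n → Fin n → FField n M} (h : IsLocalPotential P U c.φ u v)
    (hpot : HasLocalPotentials P U) (hFE : FundamentalEquation D U) :
    (c.model D D' hassoc htor).Potential where
  u k := ofField _ ((h.smooth_u k).mono c.subset)
  v i k := ofField _ ((h.smooth_v i k).mono c.subset)
  agree i j := ext_evS fun y => by
    have h1 := h.agree y (c.subset y.2) i j
    simp only [map_sum, map_mul, evS_C, evS_pderiv, evS_ofField]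
    simp only [MvPowerSeries.smul_eq_C_mul, ← c.ev_poisson'] at h1
    exact h1
  u_mod i k := ext_ev fun y => by
    have h1 := h.u_mod y (c.subset y.2) k (Finsupp.single i 1) (by simp)
    rw [← constantCoeff_evS, evS_pderiv, evS_ofField, ← MvPowerSeries.coeff_zero_eq_constantCoeff_apply,
      MvPowerSeries.coeff_pderiv, zero_add, h1]
    classical
    simp only [map_neg, MvPowerSeries.coeff_X, Finsupp.single_left_inj one_ne_zero]
    split_ifs <;> simp
  v_mod i k := ext_ev fun y => by
    have h1 := h.v_mod y (c.subset y.2) i k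
    rw [← constantCoeff_evS, evS_ofField, h1]
    split_ifs <;> simp
  fundamental i j := ext_evS fun y => by
    have hU := c.expr_eval_dfun h
    -- The global equation is applied to the exact forms df_i and df_j and read in the chart; the
    -- field built from v computes the bracket term at y.
    have h1 := congrArg (chartHom c.φ (y : M)) (congrFun (hFE _ _ (isSmoothForm_dfun (c.f i))
      (isSmoothForm_dfun (c.f j))) (y : M))
    obtain ⟨H, hH⟩ := hpot.exists_isHamiltonianField (isSmoothForm_dfun (c.f i))
    obtain ⟨K, hK⟩ := hpot.exists_isHamiltonianField (isSmoothForm_dfun (c.f j))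
    have h2 := (c.hamOn_eval h (isSmoothForm_dfun (c.f i))).isHamAt y
    simp only [Pi.add_apply, Pi.sub_apply, map_add, map_sub, bracketOmega_apply hH hK h2,
      c.chartHom_Qbar (hassoc := hassoc) (htor := htor), chartHom_actAt c.mem (c.subset y.2),
      formBracket_dfun] at h1
    have h3 : chartHom c.φ y (MvPowerSeries.C (P.bivector y (dfun (c.f i) y) (dfun (c.f j) y))) =
        evS y (MvPowerSeries.C (c.poisson P i j)) := by
      rw [chartHom, linHom_C, evS_C, ev_poisson]
    have h4 : ∀ i j, chartHom c.φ y (nablaBar D (dfun (c.f i)) (U.eval (dfun (c.f j))) y) =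
        evS y ((c.model D D' hassoc htor).nabla i (∑ k, MvPowerSeries.C (c.poisson P j k) *
          ofField _ ((h.smooth_u k).mono c.subset))) := by
      intro i j
      rw [← (hU j).nablaBar_dfun_f i y, toChart_eq]
    have h5 : chartHom c.φ y (U.eval (dfun (poissonBracket P (c.f i) (c.f j))) y) =
        evS y (∑ s, MvPowerSeries.C (c.deriv s (c.poisson P i j)) *
          (∑ k, MvPowerSeries.C (c.poisson P s k) * ofField _ ((h.smooth_u k).mono c.subset))) := by
      rw [VertForm.eval, chartHom_eval c.mem h (c.subset y.2)]
      simp [ev_deriv_poisson, ev_poisson', MvPowerSeries.smul_eq_C_mul]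
    have h6 : chartHom c.φ y (U.eval (dfun (c.f j)) y) =
        evS y (∑ k, MvPowerSeries.C (c.poisson P j k) *
          ofField _ ((h.smooth_u k).mono c.subset)) := by
      rw [← hU j y, toChart_eq]
    have h7 : ∀ k, chartHom c.φ y (c.vertField (c.evalCoeff h (isSmoothForm_dfun (c.f i))) y
        (frame c.φ k y)) = evS y (ofField _ ((h.smooth_v i k).mono c.subset)) := by
      intro k
      rw [chartHom_vertField]
      simp [dx_frame c.mem (c.subset y.2), evS_evalCoeff, c.dfun_f i y.2]
    simp only [h3, h4, h5, h6, h7] at h1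
    refine h1.trans ?_
    simp only [map_add, map_sub]
    congr 1
    simp only [vert_apply, map_sum, map_mul, evS_pderiv]
    rfl

end LocalPotential

/-! ### Local solutions, gluing, and the Poisson morphism. -/

section Lifting

open Filter Topology smoothRing

variable {n : ℕ} {M : Type*} [TopologicalSpace M] [ChartedSpace (EuclideanSpace ℝ (Fin n)) M]
  {P : PoissonStructure n M}

/-- A solution of the Fundamental Equation for a pair of associated contravariant connections. -/
structure FundamentalSolution (P : PoissonStructure n M) where
  /-- the connection `∇` -/
  D : ContravariantConnection P
  /-- the associated connection -/
  D' : ContravariantConnection P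
  assoc : Associated D D'
  torsion : TorsionFree D'
  /-- the vertical form -/
  U : VertForm n M
  potentials : HasLocalPotentials P U
  fundamental : FundamentalEquation D U

/-- A coordinate domain with local potentials. -/
structure FundamentalSolution.Domain (S : FundamentalSolution P) extends CoordDomain n M where
  /-- the potentials `u_k` -/
  u : Fin n → FField n M
  /-- the potentials `v^i_k` -/
  v : Fin n → Fin n → FField n M
  isLocalPotential : IsLocalPotential P S.U φ u v

variable {S : FundamentalSolution P}

/-- `F` solves the system `∇̄^α F = {U(α), F}_Ω` at the point `x`. -/
def FundamentalSolution.SolAt (S : FundamentalSolution P) (x : M) (F : FField n M) : Prop :=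
  ∀ (α : Form n M) (w : TangentSpace (𝓡 n) x →ₗ[ℝ] MvPowerSeries (Fin n) ℝ), IsSmoothForm α →
    IsHamAt P x (S.U x (α x)) w → nablaBar S.D α F x = actAt x w (F x)

/-- A smaller domain with the same potentials. -/
def FundamentalSolution.Domain.shrink (d : S.Domain) (t : Set M) (ht : IsOpen t) (hts : t ⊆ d.s) :
    S.Domain :=
  { d.toCoordDomain.restrict t ht hts with
    u := d.u
    v := d.v
    isLocalPotential := d.isLocalPotential }

lemma constantCoeff_toChart {φ : OpenPartialHomeomorph M (EuclideanSpace ℝ (Fin n))}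
    (F : FField n M) (x : M) :
    MvPowerSeries.constantCoeff (toChart φ F x) = MvPowerSeries.constantCoeff (F x) := by
  rw [toChart_eq, constantCoeff_linHom]

variable [IsManifold (𝓡 n) ∞ M]

namespace FundamentalSolution.Domain

variable (d : S.Domain)

/-- The local model on the domain. -/
def model : LocalModel n (smoothRing n d.s) := d.toCoordDomain.model S.D S.D' S.assoc S.torsion

variable {d} in
lemma hamOn {F : FField n M} {G : MvPowerSeries (Fin n) (smoothRing n d.s)} (h : d.Expr G F)
    {a : Fin n → MvPowerSeries (Fin n) (smoothRing n d.s)} (ha : d.model.Ham G a) :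
    d.HamOn P F a := by
  intro y l
  rw [h y, ← evS_pderiv, ha l]
  simp only [map_sum, map_mul, evS_C, MvPowerSeries.smul_eq_C_mul, ← d.ev_poisson']
  rfl

variable [T2Space M] [SecondCountableTopology M]

/-- The potentials on the domain. -/
def pot : d.model.Potential :=
  d.toCoordDomain.potential d.isLocalPotential S.potentials S.fundamental

variable {d} {F : FField n M} {G : MvPowerSeries (Fin n) (smoothRing n d.s)}

lemma chartHom_actAt_evalCoeff (h : d.Expr G F) {α : Form n M} (hα : IsSmoothForm α) (y : d.s) :
    chartHom d.φ y (actAt (y : M) (d.vertField (d.evalCoeff d.isLocalPotential hα) y) (F y)) =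
      ∑ i, α y (frame d.φ i y) • evS y (vert (d.pot.v i) G) := by
  have h1 : ∀ i k, evS y (d.pot.v i k) = d.v i k y := fun i k =>
    evS_ofField _ ((d.isLocalPotential.smooth_v i k).mono d.subset) y
  rw [chartHom_actAt d.mem (d.subset y.2), chartHom, ← toChart_eq, h y]
  simp only [d.chartHom_vertField, vert_apply, d.evS_evalCoeff, map_sum, map_mul, h1, evS_pderiv,
    dx_frame d.mem (d.subset y.2)]
  simp only [ite_smul, one_smul, zero_smul, Finset.sum_ite_eq', Finset.mem_univ, if_true]
  simp only [Finset.sum_mul, Finset.smul_sum, smul_mul_assoc]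
  exact Finset.sum_comm

/-- The forms dx^i span, so n equations suffice. A fibrewise Hamiltonian field w of U(α) may differ
from the one built from v by a field in the kernel of Π. This is harmless, since a solution F is
itself Hamiltonian and the derivative can be moved onto U(α). -/
lemma solAt_iff (h : d.Expr G F) :
    (∀ y : d.s, S.SolAt y F) ↔ ∀ i, d.pot.op i G = 0 := by
  constructor
  · intro hS i
    refine ext_evS fun y => ?_
    have hα := isSmoothForm_dfun (d.f i)
    have h1 := congrArg (chartHom d.φ (y : M)) (hS y _ _ hα
      ((d.hamOn_eval d.isLocalPotential hα).isHamAt y))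
    rw [chartHom_actAt_evalCoeff h hα, chartHom, ← toChart_eq,
      h.toChart_nablaBar (hassoc := S.assoc) (htor := S.torsion) hα y, eq_comm, ← sub_eq_zero,
      ← Finset.sum_sub_distrib] at h1
    rw [map_zero, ← h1, LocalModel.Potential.op_apply, map_sub, Finset.sum_eq_single i]
    · simp only [d.dfun_f i y.2, dx_frame d.mem (d.subset y.2), if_true, one_smul]
      rfl
    · intro j _ hj
      simp [d.dfun_f i y.2, dx_frame d.mem (d.subset y.2), hj.symm]
    · simp
  · intro hop y α w hα hw
    have hU : IsHamAt P (y : M) (S.U y (α y)) _ := (d.hamOn_eval d.isLocalPotential hα).isHamAt y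
    have hF := (hamOn h (d.pot.exists_ham hop)).isHamAt y
    rw [actAt_swap hw hF, ← actAt_swap hU hF]
    refine chartHom_injective d.mem (d.subset y.2) ?_
    rw [chartHom_actAt_evalCoeff h hα, chartHom, ← toChart_eq,
      h.toChart_nablaBar (hassoc := S.assoc) (htor := S.torsion) hα y]
    refine Finset.sum_congr rfl fun i _ => ?_
    have h1 := congrArg (evS y) (hop i)
    rw [LocalModel.Potential.op_apply, map_sub, map_zero, sub_eq_zero] at h1
    exact congrArg _ h1.symm

/-- A solution of the system is determined by its values on the zero section. -/
lemma eq_of_solAt (d : S.Domain) {F F' : FField n M} (hF : SmoothCoeffOn (toChart d.φ F) d.s)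
    (hF' : SmoothCoeffOn (toChart d.φ F') d.s) (hS : ∀ y : d.s, S.SolAt y F)
    (hS' : ∀ y : d.s, S.SolAt y F') (h : ∀ y : d.s,
      MvPowerSeries.constantCoeff (F y) = MvPowerSeries.constantCoeff (F' y)) (y : d.s) :
    F y = F' y := by
  have h1 := d.expr_ofField hF
  have h2 := d.expr_ofField hF'
  have h3 := d.pot.eq_of_op_eq_zero ((solAt_iff h1).1 hS) ((solAt_iff h2).1 hS')
    (ext_ev fun y => by
      rw [← constantCoeff_evS, ← constantCoeff_evS, evS_ofField, evS_ofField, constantCoeff_toChart,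
        constantCoeff_toChart, h])
  refine toChart_injective d.mem (d.subset y.2) ?_
  rw [h1 y, h2 y, h3]

end FundamentalSolution.Domain

namespace FundamentalSolution

variable [T2Space M]

lemma exists_domain (S : FundamentalSolution P) (x : M) :
    ∃ d : S.Domain, x ∈ d.s := by
  obtain ⟨c, hc, u, v, h⟩ := S.potentials.exists_coordDomain x
  exact ⟨⟨c, u, v, h⟩, hc⟩

variable [SecondCountableTopology M] (S)

/-- A formal function which solves the system locally is a solution. -/
lemma isLift_of_solAt {f : C^∞⟮𝓡 n, M; ℝ⟯} {F : FField n M}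
    (h : ∀ x, ∃ d : S.Domain, x ∈ d.s ∧ ∃ G, d.Expr G F ∧ ∀ i, d.pot.op i G = 0)
    (hf : ∀ x, MvPowerSeries.constantCoeff (F x) = f x) : IsLift S.D S.U f F := by
  have hs : F ∈ formalFunctions n M := by
    intro φ hφ m x hx
    obtain ⟨d, hd, G, hG, -⟩ := h x
    exact ((smoothCoeffOn_toChart d.mem hφ (Set.inter_subset_inter_left _ d.subset)
      (hG.smoothCoeffOn.mono Set.inter_subset_left) m).contMDiffAt
      ((d.isOpen.inter φ.open_source).mem_nhds ⟨hd, hx⟩)).contMDiffWithinAt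
  obtain ⟨H, hH⟩ : ∃ H, IsHamiltonianField P F H := exists_isHamiltonianField fun x => by
    obtain ⟨d, hd, G, hG, hop⟩ := h x
    exact ⟨d.toCoordDomain, hd, _, Domain.hamOn hG (d.pot.exists_ham hop)⟩
  refine ⟨⟨hs, H, hH⟩, fun α hα => ?_, hf⟩
  obtain ⟨K, hK⟩ := S.potentials.exists_isHamiltonianField hα
  funext x
  obtain ⟨d, hd, G, hG, hop⟩ := h x
  rw [bracketOmega_apply hK hH (hK.isHamAt x)]
  exact (Domain.solAt_iff hG).2 hop ⟨x, hd⟩ α _ hα (hK.isHamAt x)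

variable {S}

lemma solAt_of_isLift {f : C^∞⟮𝓡 n, M; ℝ⟯} {F : FField n M} (h : IsLift S.D S.U f F) (x : M) :
    S.SolAt x F := by
  intro α w hα hw
  obtain ⟨K, hK⟩ := S.potentials.exists_isHamiltonianField hα
  obtain ⟨H, hH⟩ := h.mem.2
  rw [h.eq α hα, bracketOmega_apply hK hH hw]

/-- The local expressions of a solution. -/
lemma exists_expr_of_isLift {f : C^∞⟮𝓡 n, M; ℝ⟯} {F : FField n M} (h : IsLift S.D S.U f F)
    (d : S.Domain) : ∃ G, d.Expr G F ∧ (∀ i, d.pot.op i G = 0) ∧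
      MvPowerSeries.constantCoeff G = ofSmooth f f.contMDiff.contMDiffOn := by
  have hG := d.expr_ofField ((h.mem.1 d.φ d.mem).mono d.subset)
  refine ⟨_, hG, (Domain.solAt_iff hG).1 fun y => solAt_of_isLift h y, ext_ev fun y => ?_⟩
  rw [← constantCoeff_evS, ← hG y, constantCoeff_toChart, h.initial, ev_ofSmooth]

lemma eq_of_isLift {f : C^∞⟮𝓡 n, M; ℝ⟯} {F F' : FField n M} (h : IsLift S.D S.U f F)
    (h' : IsLift S.D S.U f F') : F = F' := by
  funext x
  obtain ⟨d, hd⟩ := S.exists_domain x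
  exact d.eq_of_solAt ((h.mem.1 d.φ d.mem).mono d.subset) ((h'.mem.1 d.φ d.mem).mono d.subset)
    (fun y => solAt_of_isLift h y) (fun y => solAt_of_isLift h' y)
    (fun y => by rw [h.initial, h'.initial]) ⟨x, hd⟩

variable (S)

/-- Local solutions with the same restriction to Z coincide on overlaps by uniqueness, so the value
over x can be taken from the domain chosen at x. -/
lemma exists_isLift (f : C^∞⟮𝓡 n, M; ℝ⟯) : ∃ F, IsLift S.D S.U f F := by
  choose d hd using S.exists_domain
  have h := fun x => (d x).pot.exists_solution (ofSmooth f f.contMDiff.contMDiffOn)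
  choose G hGf hG using h
  let F' : M → FField n M := fun x => fromChart (d x).φ (toField (G x))
  have hF' : ∀ x, (d x).Expr (G x) (F' x) := by
    intro x y
    rw [toChart_fromChart (d x).mem ((d x).subset y.2), toField_of_mem _ y.2]
  have hsol : ∀ x, ∀ y : (d x).s, S.SolAt y (F' x) := fun x =>
    (Domain.solAt_iff (hF' x)).2 (hG x)
  have hinit : ∀ x, ∀ y : (d x).s, MvPowerSeries.constantCoeff (F' x y) = f y := by
    intro x y
    rw [← constantCoeff_toChart (φ := (d x).φ), hF' x y, constantCoeff_evS, hGf, ev_ofSmooth]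
  have heq : ∀ x z, ∀ y ∈ (d x).s ∩ (d z).s, F' x y = F' z y := by
    intro x z y hy
    let e := (d x).shrink ((d x).s ∩ (d z).s) ((d x).isOpen.inter (d z).isOpen)
      Set.inter_subset_left
    exact e.eq_of_solAt ((hF' x).smoothCoeffOn.mono Set.inter_subset_left)
      (smoothCoeffOn_toChart (d z).mem (d x).mem
        (fun y hy => ⟨(d z).subset hy.2, (d x).subset hy.1⟩)
        ((hF' z).smoothCoeffOn.mono Set.inter_subset_right))
      (fun y => hsol x ⟨y, y.2.1⟩) (fun y => hsol z ⟨y, y.2.2⟩)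
      (fun y => (hinit x ⟨y, y.2.1⟩).trans (hinit z ⟨y, y.2.2⟩).symm) ⟨y, hy⟩
  refine ⟨fun x => F' x x, S.isLift_of_solAt (fun x => ⟨d x, hd x, G x, fun y => ?_, hG x⟩)
    fun x => hinit x ⟨x, hd x⟩⟩
  rw [← hF' x y, toChart_eq, toChart_eq, heq y x y ⟨hd y, y.2⟩]

variable {S}

lemma isLift_algebraMap (r : ℝ) :
    IsLift S.D S.U (algebraMap ℝ C^∞⟮𝓡 n, M; ℝ⟯ r) (algebraMap ℝ (FField n M) r) := by
  refine S.isLift_of_solAt (fun x => ?_) fun x => ?_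
  · obtain ⟨d, hd⟩ := S.exists_domain x
    refine ⟨d, hd, MvPowerSeries.C (algebraMap ℝ _ r), fun y => ?_, fun i => by
      simp [LocalModel.Potential.op_C]⟩
    rw [toChart_algebraMap]
    exact (evS_C y (algebraMap ℝ (smoothRing n d.s) r)).symm
  · exact MvPowerSeries.constantCoeff_C (σ := Fin n) r

lemma isLift_add {f g : C^∞⟮𝓡 n, M; ℝ⟯} {F F' : FField n M} (h : IsLift S.D S.U f F)
    (h' : IsLift S.D S.U g F') : IsLift S.D S.U (f + g) (F + F') := by
  refine S.isLift_of_solAt (fun x => ?_) fun x => ?_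
  · obtain ⟨d, hd⟩ := S.exists_domain x
    obtain ⟨G, hG, hop, -⟩ := exists_expr_of_isLift h d
    obtain ⟨G', hG', hop', -⟩ := exists_expr_of_isLift h' d
    refine ⟨d, hd, G + G', fun y => ?_, fun i => by rw [map_add, hop, hop', add_zero]⟩
    rw [toChart_add, map_add, ← hG y, ← hG' y]
    rfl
  · exact (map_add _ _ _).trans (congrArg₂ _ (h.initial x) (h'.initial x))

lemma isLift_mul {f g : C^∞⟮𝓡 n, M; ℝ⟯} {F F' : FField n M} (h : IsLift S.D S.U f F)
    (h' : IsLift S.D S.U g F') : IsLift S.D S.U (f * g) (F * F') := by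
  refine S.isLift_of_solAt (fun x => ?_) fun x => ?_
  · obtain ⟨d, hd⟩ := S.exists_domain x
    obtain ⟨G, hG, hop, -⟩ := exists_expr_of_isLift h d
    obtain ⟨G', hG', hop', -⟩ := exists_expr_of_isLift h' d
    refine ⟨d, hd, G * G', fun y => ?_, fun i => by
      rw [Derivation.leibniz, hop, hop', smul_zero, smul_zero, add_zero]⟩
    rw [toChart_mul, map_mul, ← hG y, ← hG' y]
    rfl
  · exact (map_mul _ _ _).trans (congrArg₂ _ (h.initial x) (h'.initial x))

lemma isLift_bracketOmega {f g : C^∞⟮𝓡 n, M; ℝ⟯} {F F' : FField n M} (h : IsLift S.D S.U f F)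
    (h' : IsLift S.D S.U g F') :
    IsLift S.D S.U (poissonBracket P f g) (bracketOmega P F F') := by
  obtain ⟨H, hH⟩ := h.mem.2
  obtain ⟨K, hK⟩ := h'.mem.2
  have hloc : ∀ d : S.Domain, ∃ G, d.Expr G (bracketOmega P F F') ∧ (∀ i, d.pot.op i G = 0) ∧
      ∀ y : d.s, ev y (MvPowerSeries.constantCoeff G) = poissonBracket P f g y := by
    intro d
    obtain ⟨G, hG, hop, hGf⟩ := exists_expr_of_isLift h d
    obtain ⟨G', hG', hop', hGg⟩ := exists_expr_of_isLift h' d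
    -- The bracket is computed with the local field W'⁻¹∂_xF of the solution, not with the global H.
    have ha := d.pot.exists_ham hop
    refine ⟨_, fun y => ?_, d.pot.op_vert_eq_zero hop hop' ha (d.pot.exists_ham hop'), fun y => ?_⟩
    · rw [toChart_eq, bracketOmega_apply hH hK ((Domain.hamOn hG ha).isHamAt y), ← chartHom,
        chartHom_actAt d.mem (d.subset y.2), chartHom, ← toChart_eq, hG' y]
      simp only [d.chartHom_vertField, dx_frame d.mem (d.subset y.2), vert_apply, map_sum, map_mul,
        evS_pderiv, ite_smul, one_smul, zero_smul, Finset.sum_ite_eq', Finset.mem_univ, if_true]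
    · rw [d.pot.constantCoeff_vert hop hop' ha, hGf, hGg]
      change _ = P.bivector y (dfun f y) (dfun g y)
      rw [bivector_eq_sum P d.mem (d.subset y.2)]
      simp only [map_sum, map_mul]
      refine Finset.sum_congr rfl fun i _ => Finset.sum_congr rfl fun s _ => ?_
      have h1 : ∀ (i : Fin n) (f : C^∞⟮𝓡 n, M; ℝ⟯),
          ev y (d.model.δ i (ofSmooth f f.contMDiff.contMDiffOn)) = dfun f y (frame d.φ i y) :=
        fun i f => d.ev_deriv_ofSmooth i f _ y
      have h2 : ev y (d.model.π i s) = P.comp d.φ i s y := d.ev_poisson' i s y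
      rw [h1, h1, h2]
      ring
  refine S.isLift_of_solAt (fun x => ?_) fun x => ?_
  · obtain ⟨d, hd⟩ := S.exists_domain x
    obtain ⟨G, hG, hop, -⟩ := hloc d
    exact ⟨d, hd, G, hG, hop⟩
  · obtain ⟨d, hd⟩ := S.exists_domain x
    obtain ⟨G, hG, hop, hG0⟩ := hloc d
    rw [← hG0 ⟨x, hd⟩, ← constantCoeff_evS, ← hG, constantCoeff_toChart]

/-- The Poisson morphism `θ`. -/
lemma exists_lift_algHom (S : FundamentalSolution P) :
    ∃ θ : C^∞⟮𝓡 n, M; ℝ⟯ →ₐ[ℝ] hamiltonianFunctions P,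
      (∀ (f : C^∞⟮𝓡 n, M; ℝ⟯) (F : FField n M), IsLift S.D S.U f F ↔ F = θ f) ∧
      ∀ f g : C^∞⟮𝓡 n, M; ℝ⟯, (θ (poissonBracket P f g) : FField n M) =
        bracketOmega P (θ f) (θ g) := by
  choose F hF using S.exists_isLift
  have h1 : IsLift S.D S.U 1 1 := by
    have := isLift_algebraMap (S := S) 1
    rwa [map_one, map_one] at this
  have h0 : IsLift S.D S.U 0 0 := by
    have := isLift_algebraMap (S := S) 0
    rwa [map_zero, map_zero] at this
  -- Each algebraic identity compares two lifts of the same function, so uniqueness proves it.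
  refine ⟨{ toFun := fun f => ⟨F f, (hF f).mem⟩
            map_one' := Subtype.ext (eq_of_isLift (hF 1) h1)
            map_mul' := fun f g => Subtype.ext (eq_of_isLift (hF _) (isLift_mul (hF f) (hF g)))
            map_zero' := Subtype.ext (eq_of_isLift (hF 0) h0)
            map_add' := fun f g => Subtype.ext (eq_of_isLift (hF _) (isLift_add (hF f) (hF g)))
            commutes' := fun r => Subtype.ext (eq_of_isLift (hF _) (isLift_algebraMap r)) },
    fun f F' => ⟨fun h => eq_of_isLift h (hF f), fun h => h ▸ hF f⟩,
    fun f g => eq_of_isLift (hF _) (isLift_bracketOmega (hF f) (hF g))⟩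

end FundamentalSolution

end Lifting
end FormalLift

end

theorem propositionP {n : ℕ} {M : Type*} [TopologicalSpace M] [T2Space M]
    [SecondCountableTopology M] [ChartedSpace (EuclideanSpace ℝ (Fin n)) M]
    [IsManifold (𝓡 n) ∞ M]
    (P : FormalLift.PoissonStructure n M)
    (D D' : FormalLift.ContravariantConnection P)
    (hassoc : FormalLift.Associated D D')
    (htor : FormalLift.TorsionFree D')
    (U : FormalLift.VertForm n M) (hU : FormalLift.IsSmoothVertForm U)
    (hpot : FormalLift.HasLocalPotentials P U)
    (hFE : FormalLift.FundamentalEquation D U) :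
    ∃ θ : C^∞⟮𝓡 n, M; ℝ⟯ →ₐ[ℝ] FormalLift.hamiltonianFunctions P,
      (∀ (f : C^∞⟮𝓡 n, M; ℝ⟯) (F : FormalLift.FField n M),
        FormalLift.IsLift D U f F ↔ F = θ f) ∧
      ∀ f g : C^∞⟮𝓡 n, M; ℝ⟯,
        (θ (FormalLift.poissonBracket P f g) : FormalLift.FField n M) =
          FormalLift.bracketOmega P (θ f) (θ g) :=
  FormalLift.FundamentalSolution.exists_lift_algHom ⟨D, D', hassoc, htor, U, hpot, hFE⟩
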